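/- For an integer $N\ge 1$ let $\Gamma_N$ be the star graph consisting of $N$ half-lines $[0,\infty)$ with their endpoints $0$ identified. Let $H^1(\Gamma_N)$ be the space of all $\psi\in L_2(\Gamma_N)$ whose restrictions $\psi_1,\dots,\psi_N$ to the edges belong to $H^1(0,\infty)$ and satisfy $\psi_1(0)=\dots=\psi_N(0)$. Let $\gamma\ge 1/2$. For $V:\Gamma_N\to\mathbb R$ with $V_-=\max(-V,0)\in L_{\gamma+1/2}(\Gamma_N)$ and $V_+=\max(V,0)\in L_1^{\rm loc}(\Gamma_N)$, let $H=-\frac{d^2}{dx^2}+V$ be the self-adjoint operator in $L_2(\Gamma_N)$ associated with the quadratic form $$ h[\psi]=\int_{\Gamma_N}\left(|\psi'|^2+V|\psi|^2\right)dx,\qquad \psi\in H^1(\Gamma_N)\cap L_2(\Gamma_N,V_+\,dx) $$ (the Schrödinger operator with Kirchhoff conditions at the vertex), and let $\operatorname{tr}H_-^\gamma$ be the sum of the $\gamma$-th powers of the absolute values of the negative eigenvalues of $H$, counted with multiplicities. Let $L_{\gamma,N}\in[0,\infty]$ be the optimal (that is, smallest possible) constant such that $$ \operatorname{tr}H_-^\gamma\le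 L_{\gamma,N}\int_{\Gamma_N}V_-^{\gamma+1/2}\,dx $$ for all such $V$. Likewise, let $L_\gamma\in[0,\infty]$ be the optimal constant such that $$ \operatorname{tr}\left(-\frac{d^2}{dx^2}+V\right)_-^\gamma\le L_\gamma\int_{\mathbb R}V_-^{\gamma+1/2}\,dx $$ for all $V:\mathbb R\to\mathbb R$ with $V_-\in L_{\gamma+1/2}(\mathbb R)$ and $V_+\in L_1^{\rm loc}(\mathbb R)$, where $-\frac{d^2}{dx^2}+V$ is the self-adjoint operator in $L_2(\mathbb R)$ associated with the form $\int_{\mathbb R}(|\psi'|^2+V|\psi|^2)\,dx$ on $H^1(\mathbb R)\cap L_2(\mathbb R,V_+\,dx)$. If $N$ is even, then $L_{\gamma,N}=L_\gamma$. If $N$ is odd, then $L_{\gamma,N}\le\frac{N+1}{N}\,L_\gamma$. -/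

import Mathlib

open MeasureTheory

noncomputable section

namespace StarLT

/-! ### Operators given by quadratic forms, and their negative eigenvalues -/

section Form

variable {E : Type*} [NormedAddCommGroup E] [InnerProductSpace ℂ E]

/-- For a sesquilinear form `h` (antilinear in the first argument) with form domain `D` in a
Hilbert space `E`, this says that `u` lies in the operator domain of the operator `H` associated
with the form, and that `H u = f`. -/
def OperatorRel (D : Set E) (h : E → E → ℂ) (u f : E) : Prop :=
  u ∈ D ∧ ∀ v ∈ D, h v u = inner ℂ v f

/-- The multiplicity of `t` as an eigenvalue of the operator associated with the form, that is,
the dimension of the space of all `u` with `H u = t u` (`0` if `t` is not an eigenvalue). -/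
def multiplicity (D : Set E) (h : E → E → ℂ) (t : ℝ) : ℕ∞ :=
  Cardinal.toENat
    (Module.rank ℂ (Submodule.span ℂ {u : E | OperatorRel D h u ((t : ℂ) • u)}))

/-- `tr H_-^γ`: the sum of the `γ`-th powers of the absolute values of the negative eigenvalues,
counted with multiplicities. -/
def negTrace (D : Set E) (h : E → E → ℂ) (γ : ℝ) : ENNReal :=
  ∑' t : Set.Iio (0 : ℝ),
    (multiplicity D h (t : ℝ) : ENNReal) * ENNReal.ofReal (|(t : ℝ)| ^ γ)

end Form

/-! ### Sobolev functions on an open set of the line -/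

/-- `g` is a weak derivative of `u` on the open set `Ω`. -/
def HasWeakDeriv (Ω : Set ℝ) (u g : ℝ → ℂ) : Prop :=
  ∀ φ : ℝ → ℝ, ContDiff ℝ (⊤ : ℕ∞) φ → HasCompactSupport φ → tsupport φ ⊆ Ω →
    ∫ x in Ω, ((deriv φ x : ℝ) : ℂ) * u x = -∫ x in Ω, ((φ x : ℝ) : ℂ) * g x

/-- `u` has a weak derivative in `L²(Ω)`. -/
def HasL2WeakDeriv (Ω : Set ℝ) (u : ℝ → ℂ) : Prop :=
  ∃ g : ℝ → ℂ, MemLp g 2 (volume.restrict Ω) ∧ HasWeakDeriv Ω u g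

/-- `u ∈ H¹(Ω)`. -/
def MemH1 (Ω : Set ℝ) (u : ℝ → ℂ) : Prop :=
  MemLp u 2 (volume.restrict Ω) ∧ HasL2WeakDeriv Ω u

open Classical in
/-- The weak derivative in `L²(Ω)` (unique almost everywhere on `Ω`) of a function that has one. -/
def weakDeriv (Ω : Set ℝ) (u : ℝ → ℂ) : ℝ → ℂ :=
  if h : HasL2WeakDeriv Ω u then h.choose else 0

/-- The continuous representative on `[0,∞)` of `u` takes the value `c` at `0`. -/
def HasBoundaryValue (u : ℝ → ℂ) (c : ℂ) : Prop :=
  ∃ w : ℝ → ℂ, ContinuousOn w (Set.Ici 0) ∧ w =ᵐ[volume.restrict (Set.Ioi 0)] u ∧ w 0 = c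

/-! ### The Schrödinger operator on the star graph with `N` half-line edges

Functions on the star graph are families of functions on `(0,∞)` indexed by the edges `Fin N`. -/

/-- `L²(Γ_N)`. -/
abbrev StarL2 (N : ℕ) : Type :=
  PiLp 2 (fun _ : Fin N => Lp ℂ 2 (volume.restrict (Set.Ioi (0 : ℝ))))

/-- The Sobolev space `H¹(Γ_N)`: each restriction to an edge is in `H¹(0,∞)`, and the values at
the vertex coincide. -/
def starH1 (N : ℕ) : Set (StarL2 N) :=
  {u | (∀ j, MemH1 (Set.Ioi 0) (u j)) ∧ ∃ c : ℂ, ∀ j, HasBoundaryValue (u j) c}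

/-- The form domain `H¹(Γ_N) ∩ L²(Γ_N, V₊ dx)`. -/
def starDomain {N : ℕ} (V : Fin N → ℝ → ℝ) : Set (StarL2 N) :=
  {u | u ∈ starH1 N ∧ ∀ j, IntegrableOn (fun x => max (V j x) 0 * ‖u j x‖ ^ 2) (Set.Ioi 0)}

/-- The sesquilinear form of `h[u] = ∫ (|u'|² + V |u|²) dx` on the star graph. -/
def starForm {N : ℕ} (V : Fin N → ℝ → ℝ) (v u : StarL2 N) : ℂ :=
  ∑ j, ∫ x in Set.Ioi (0 : ℝ),
    (starRingEnd ℂ (weakDeriv (Set.Ioi 0) (v j) x) * weakDeriv (Set.Ioi 0) (u j) x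
      + (V j x : ℂ) * (starRingEnd ℂ (v j x) * u j x))

/-- Admissible potentials: `V₊ ∈ L¹_loc(Γ_N)` (up to and including the vertex) and
`V₋ ∈ L^p(Γ_N)`. -/
def StarPotential {N : ℕ} (p : ℝ) (V : Fin N → ℝ → ℝ) : Prop :=
  ∀ j, LocallyIntegrableOn (fun x => max (V j x) 0) (Set.Ici 0) ∧
    MemLp (fun x => max (-V j x) 0) (ENNReal.ofReal p) (volume.restrict (Set.Ioi 0))

/-- The Lieb–Thirring inequality on `Γ_N` holds with the constant `L`. -/
def StarLiebThirring (γ : ℝ) (N : ℕ) (L : ENNReal) : Prop :=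
  ∀ V : Fin N → ℝ → ℝ, StarPotential (γ + 1 / 2) V →
    negTrace (starDomain V) (starForm V) γ ≤
      L * ∑ j, ∫⁻ x in Set.Ioi (0 : ℝ), ENNReal.ofReal (max (-V j x) 0 ^ (γ + 1 / 2))

/-- The optimal constant `L_{γ,N}`. -/
def starConst (γ : ℝ) (N : ℕ) : ENNReal :=
  sInf {L : ENNReal | StarLiebThirring γ N L}

/-! ### The Schrödinger operator on the line -/

/-- `L²(ℝ)`. -/
abbrev LineL2 : Type := Lp ℂ 2 (volume : Measure ℝ)

/-- The form domain `H¹(ℝ) ∩ L²(ℝ, V₊ dx)`. -/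
def lineDomain (V : ℝ → ℝ) : Set LineL2 :=
  {u | MemH1 Set.univ u ∧ Integrable (fun x => max (V x) 0 * ‖u x‖ ^ 2)}

/-- The sesquilinear form of `h[u] = ∫ (|u'|² + V |u|²) dx` on the line. -/
def lineForm (V : ℝ → ℝ) (v u : LineL2) : ℂ :=
  ∫ x : ℝ, (starRingEnd ℂ (weakDeriv Set.univ v x) * weakDeriv Set.univ u x
    + (V x : ℂ) * (starRingEnd ℂ (v x) * u x))

/-- Admissible potentials on the line: `V₊ ∈ L¹_loc(ℝ)` and `V₋ ∈ L^p(ℝ)`. -/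
def LinePotential (p : ℝ) (V : ℝ → ℝ) : Prop :=
  LocallyIntegrable (fun x => max (V x) 0) ∧
    MemLp (fun x => max (-V x) 0) (ENNReal.ofReal p) volume

/-- The Lieb–Thirring inequality on the line holds with the constant `L`. -/
def LineLiebThirring (γ : ℝ) (L : ENNReal) : Prop :=
  ∀ V : ℝ → ℝ, LinePotential (γ + 1 / 2) V →
    negTrace (lineDomain V) (lineForm V) γ ≤
      L * ∫⁻ x : ℝ, ENNReal.ofReal (max (-V x) 0 ^ (γ + 1 / 2))

/-- The optimal constant `L_γ` on the line. -/
def lineConst (γ : ℝ) : ENNReal :=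
  sInf {L : ENNReal | LineLiebThirring γ L}

end StarLT

end

noncomputable section

open Filter Topology

namespace StarLT

/-! ### Hermitian forms and the variational principle below zero -/

section VariationalPrinciple

variable {E : Type*} [NormedAddCommGroup E] [InnerProductSpace ℂ E]

/-! Both directions compare quadratic forms. If the form of one operator is the restriction of the
form of another, up to an isometry of the underlying spaces, then passing to the larger form domain
lowers the eigenvalues and can only increase the trace.

Upper bound. Group the edges of the star into pairs and glue each pair to a line. A function in the
star domain takes one value at the vertex, so each glued function is in H¹ of the line; the star
form is thus a restriction of an orthogonal sum of line forms. The line inequality for each pair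
adds up to the star inequality with the same constant when N is even (`starLiebThirring_of_even`).
When N is odd, one edge is left over. It is glued to its own mirror image and the result is
multiplied by 1/√2, which keeps norm and form unchanged but counts the integral of its potential
twice. Choosing the edge with the smallest integral bounds the excess by the average, whence the
factor 1 + 1/N (`starLiebThirring_of_odd`). Both cases rest on `negTrace_star_le_sum`.

Lower bound. Given a potential on the line, shift it by R along a single edge and put zero on the
others. Finitely many eigenfunctions, shifted by R and cut off near the vertex, vanish at the vertex
and are admissible trial functions on the star. As R → ∞ their Gram and form matrices converge to
those on the line, so any star constant is a line constant (`lineLiebThirring_of_star`). This holds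
for every N ≥ 1.

The trace is defined through eigenvectors, so the comparison needs a variational principle that
turns trial functions into eigenvectors (`exists_eigenvector`, `sum_le_negTrace_of_trial`). It is
obtained by direct minimization: below zero the infimum of the Rayleigh quotient on the orthogonal
complement of finitely many eigenvectors is attained. The required compactness
(`hasMinimizers_graph`) combines weak sequential compactness, Fatou's lemma for the positive part of
the potential and dominated convergence for its negative part. The assumption γ ≥ 1/2 makes the
negative part integrable up to a small bounded error, hence form bounded. -/

/-- `D` is a linear subspace, and `h` is a Hermitian sesquilinear form on it. -/
structure IsHermitianForm (D : Set E) (h : E → E → ℂ) : Prop where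
  zero_mem : (0 : E) ∈ D
  add_mem : ∀ {u v : E}, u ∈ D → v ∈ D → u + v ∈ D
  smul_mem : ∀ (c : ℂ) {u : E}, u ∈ D → c • u ∈ D
  add_right : ∀ {v u u' : E}, v ∈ D → u ∈ D → u' ∈ D → h v (u + u') = h v u + h v u'
  smul_right : ∀ (c : ℂ) {v u : E}, v ∈ D → u ∈ D → h v (c • u) = c * h v u
  conj_symm : ∀ {u v : E}, u ∈ D → v ∈ D → starRingEnd ℂ (h u v) = h v u

/-- The form `h` is bounded from below, and every minimizing sequence in the unit ball has a
limit point on which the form does not exceed the limit of its values, and which satisfies all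
orthogonality relations that the sequence does. -/
structure HasMinimizers (D : Set E) (h : E → E → ℂ) : Prop where
  bddBelow : ∃ C : ℝ, ∀ u ∈ D, -C * ‖u‖ ^ 2 ≤ (h u u).re
  exists_limit : ∀ v : ℕ → E, (∀ n, v n ∈ D) → (∀ n, ‖v n‖ ≤ 1) → ∀ m : ℝ,
    Tendsto (fun n => (h (v n) (v n)).re) atTop (𝓝 m) →
    ∃ u ∈ D, ‖u‖ ≤ 1 ∧ (h u u).re ≤ m ∧
      ∀ e : E, (∀ n, inner ℂ e (v n) = 0) → inner ℂ e u = 0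

namespace IsHermitianForm

variable {D : Set E} {h : E → E → ℂ}

theorem add_left (hf : IsHermitianForm D h) {v v' u : E} (hv : v ∈ D) (hv' : v' ∈ D)
    (hu : u ∈ D) : h (v + v') u = h v u + h v' u := by
  rw [← hf.conj_symm hu (hf.add_mem hv hv'), hf.add_right hu hv hv', map_add,
    hf.conj_symm hu hv, hf.conj_symm hu hv']

theorem smul_left (hf : IsHermitianForm D h) (c : ℂ) {v u : E} (hv : v ∈ D) (hu : u ∈ D) :
    h (c • v) u = starRingEnd ℂ c * h v u := by
  rw [← hf.conj_symm hu (hf.smul_mem c hv), hf.smul_right c hu hv, map_mul, hf.conj_symm hu hv]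

theorem zero_left (hf : IsHermitianForm D h) {u : E} (hu : u ∈ D) : h 0 u = 0 := by
  simpa using hf.smul_left 0 hf.zero_mem hu

theorem zero_right (hf : IsHermitianForm D h) {u : E} (hu : u ∈ D) : h u 0 = 0 := by
  simpa using hf.smul_right 0 hu hf.zero_mem

theorem sum_mem (hf : IsHermitianForm D h) {ι : Type*} (s : Finset ι) {u : ι → E}
    (hu : ∀ i, u i ∈ D) : ∑ i ∈ s, u i ∈ D := by
  classical
  induction s using Finset.induction_on with
  | empty => simpa using hf.zero_mem
  | insert a s ha ih => rw [Finset.sum_insert ha]; exact hf.add_mem (hu a) ih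

theorem sum_right (hf : IsHermitianForm D h) {ι : Type*} (s : Finset ι) {u : ι → E} {v : E}
    (hv : v ∈ D) (hu : ∀ i, u i ∈ D) : h v (∑ i ∈ s, u i) = ∑ i ∈ s, h v (u i) := by
  classical
  induction s using Finset.induction_on with
  | empty => simpa using hf.zero_right hv
  | insert a s ha ih =>
    rw [Finset.sum_insert ha, Finset.sum_insert ha, hf.add_right hv (hu a) (hf.sum_mem s hu), ih]

theorem sum_left (hf : IsHermitianForm D h) {ι : Type*} (s : Finset ι) {u : ι → E} {v : E}
    (hv : v ∈ D) (hu : ∀ i, u i ∈ D) : h (∑ i ∈ s, u i) v = ∑ i ∈ s, h (u i) v := by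
  rw [← hf.conj_symm hv (hf.sum_mem s hu), hf.sum_right s hv hu, map_sum]
  exact Finset.sum_congr rfl fun i _ => hf.conj_symm hv (hu i)

/-- The form on linear combinations of finitely many vectors. -/
theorem apply_sum_smul (hf : IsHermitianForm D h) {n : ℕ} {w : Fin n → E} (hw : ∀ i, w i ∈ D)
    (c : Fin n → ℂ) :
    h (∑ i, c i • w i) (∑ i, c i • w i)
      = ∑ i, ∑ j, starRingEnd ℂ (c i) * c j * h (w i) (w j) := by
  have hcw : ∀ i, c i • w i ∈ D := fun i => hf.smul_mem _ (hw i)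
  rw [hf.sum_left _ (hf.sum_mem _ hcw) hcw]
  refine Finset.sum_congr rfl fun i _ => ?_
  rw [hf.sum_right _ (hcw i) hcw]
  refine Finset.sum_congr rfl fun j _ => ?_
  rw [hf.smul_left _ (hw i) (hcw j), hf.smul_right _ (hw i) (hw j), mul_assoc]

theorem re_smul_smul (hf : IsHermitianForm D h) (c : ℂ) {u : E} (hu : u ∈ D) :
    (h (c • u) (c • u)).re = ‖c‖ ^ 2 * (h u u).re := by
  rw [hf.smul_left c hu (hf.smul_mem c hu), hf.smul_right c hu hu, ← mul_assoc,
    Complex.conj_mul', ← Complex.ofReal_pow, Complex.re_ofReal_mul]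

theorem re_add_smul (hf : IsHermitianForm D h) (s : ℝ) {u x : E} (hu : u ∈ D) (hx : x ∈ D) :
    (h (u + (s : ℂ) • x) (u + (s : ℂ) • x)).re
      = (h u u).re + 2 * s * (h x u).re + s ^ 2 * (h x x).re := by
  have hsx := hf.smul_mem (s : ℂ) hx
  rw [hf.add_left hu hsx (hf.add_mem hu hsx), hf.add_right hu hu hsx, hf.add_right hsx hu hsx,
    hf.smul_right _ hu hx, hf.smul_left _ hx hu, hf.smul_left _ hx hsx, hf.smul_right _ hx hx,
    ← hf.conj_symm hx hu]
  simp
  ring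

/-- The eigenspace of the operator associated with the form. -/
def eigenspace (hf : IsHermitianForm D h) (t : ℝ) : Submodule ℂ E where
  carrier := {u | OperatorRel D h u ((t : ℂ) • u)}
  zero_mem' := ⟨hf.zero_mem, fun v hv => by simp [hf.zero_right hv]⟩
  add_mem' := by
    rintro u u' ⟨hu, hu1⟩ ⟨hu', hu1'⟩
    refine ⟨hf.add_mem hu hu', fun v hv => ?_⟩
    rw [hf.add_right hv hu hu', hu1 v hv, hu1' v hv, smul_add, inner_add_right]
  smul_mem' := by
    rintro c u ⟨hu, hu1⟩
    refine ⟨hf.smul_mem c hu, fun v hv => ?_⟩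
    rw [hf.smul_right c hv hu, hu1 v hv]
    simp only [inner_smul_right]
    ring

/-- The span in the definition is there because for an arbitrary `h` the solutions need not form a
subspace; for a Hermitian form they do, and the span changes nothing. -/
theorem multiplicity_eq (hf : IsHermitianForm D h) (t : ℝ) :
    multiplicity D h t = Cardinal.toENat (Module.rank ℂ (hf.eigenspace t)) := by
  have : Submodule.span ℂ {u : E | OperatorRel D h u ((t : ℂ) • u)} = hf.eigenspace t :=
    Submodule.span_eq (hf.eigenspace t)
  rw [multiplicity, this]

theorem inner_eq_zero (hf : IsHermitianForm D h) {s t : ℝ} (hst : s ≠ t) {u v : E}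
    (hu : OperatorRel D h u ((s : ℂ) • u)) (hv : OperatorRel D h v ((t : ℂ) • v)) :
    inner ℂ u v = 0 := by
  have h1 := hu.2 v hv.1
  have h2 := hv.2 u hu.1
  rw [← hf.conj_symm hv.1 hu.1, h1, inner_smul_right, inner_smul_right, map_mul,
    inner_conj_symm, Complex.conj_ofReal] at h2
  have h3 : ((s : ℂ) - t) * inner ℂ u v = 0 := by rw [sub_mul, h2, sub_self]
  rcases mul_eq_zero.1 h3 with h4 | h4
  · exact absurd (by exact_mod_cast sub_eq_zero.1 h4) hst
  · exact h4

end IsHermitianForm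

/-- For small s the linear term dominates, so its coefficient must vanish. This is how the first
variation at a minimizer is extracted. -/
theorem eq_zero_of_forall_quadratic_nonneg {a b : ℝ} (hab : ∀ s : ℝ, 0 ≤ 2 * s * a + s ^ 2 * b) :
    a = 0 := by
  by_contra ha
  have hb := hab (-a / (|b| + 1))
  have hpos : 0 < |b| + 1 := by positivity
  have : 2 * (-a / (|b| + 1)) * a + (-a / (|b| + 1)) ^ 2 * b
      = (a ^ 2 / (|b| + 1) ^ 2) * (b - 2 * (|b| + 1)) := by
    field_simp
    ring
  rw [this] at hb
  have h2 : b - 2 * (|b| + 1) < 0 := by linarith [le_abs_self b, abs_nonneg b]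
  have h3 : 0 < a ^ 2 / (|b| + 1) ^ 2 := by positivity
  nlinarith

variable {D : Set E} {h : E → E → ℂ}

/-- If the form takes a negative value somewhere on the orthogonal complement of finitely many
eigenvectors, then this complement contains a further eigenvector. -/
theorem exists_eigenvector (hf : IsHermitianForm D h) (hm : HasMinimizers D h) {k : ℕ}
    {u : Fin k → E} (hu : Orthonormal ℂ u) {μ : Fin k → ℝ}
    (hμ : ∀ i, OperatorRel D h (u i) ((μ i : ℂ) • u i)) {w : E} (hwD : w ∈ D) (hw0 : w ≠ 0)
    (hw : ∀ i, inner ℂ (u i) w = 0) {l : ℝ} (hl : l < 0) (hwl : (h w w).re ≤ l * ‖w‖ ^ 2) :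
    ∃ (x : E) (m : ℝ), m ≤ l ∧ ‖x‖ = 1 ∧ (∀ i, inner ℂ (u i) x = 0) ∧
      OperatorRel D h x ((m : ℂ) • x) := by
  -- The eigenvalue sought is the infimum of the form over unit vectors orthogonal to the given
  -- eigenvectors.
  set S : Set ℝ := {r | ∃ v ∈ D, ‖v‖ = 1 ∧ (∀ i, inner ℂ (u i) v = 0) ∧ (h v v).re = r}
    with hS
  have hnorm : ∀ v ∈ D, v ≠ 0 → (∀ i, inner ℂ (u i) v = 0) → (h v v).re / ‖v‖ ^ 2 ∈ S := by
    intro v hv hv0 hvu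
    have hvn : ‖v‖ ≠ 0 := norm_ne_zero_iff.2 hv0
    refine ⟨((‖v‖⁻¹ : ℝ) : ℂ) • v, hf.smul_mem _ hv, ?_, fun i => ?_, ?_⟩
    · rw [norm_smul, Complex.norm_real, norm_inv, norm_norm, inv_mul_cancel₀ hvn]
    · rw [inner_smul_right, hvu i, mul_zero]
    · rw [hf.re_smul_smul _ hv, Complex.norm_real, norm_inv, norm_norm]
      field_simp
  have hSne : S.Nonempty := ⟨_, hnorm w hwD hw0 hw⟩
  have hSb : BddBelow S := by
    obtain ⟨C, hC⟩ := hm.bddBelow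
    refine ⟨-C, ?_⟩
    rintro r ⟨v, hv, hv1, -, rfl⟩
    simpa [hv1] using hC v hv
  obtain ⟨r, -, hr, hrS⟩ := exists_seq_tendsto_sInf hSne hSb
  set m := sInf S with hmdef
  have hml : m ≤ l := by
    refine (csInf_le hSb (hnorm w hwD hw0 hw)).trans ?_
    rw [div_le_iff₀ (by positivity)]
    exact hwl
  choose v hvD hv1 hvu hvr using hrS
  obtain ⟨x, hxD, hx1, hxm, hxe⟩ := hm.exists_limit v hvD (fun n => (hv1 n).le) m
    (by simpa only [hvr] using hr)
  have hxu : ∀ i, inner ℂ (u i) x = 0 := fun i => hxe _ fun n => hvu n i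
  have hge : ∀ y ∈ D, (∀ i, inner ℂ (u i) y = 0) → m * ‖y‖ ^ 2 ≤ (h y y).re := by
    intro y hy hyu
    by_cases hy0 : y = 0
    · simp [hy0, hf.zero_right hf.zero_mem]
    · have := csInf_le hSb (hnorm y hy hy0 hyu)
      rwa [le_div_iff₀ (by positivity)] at this
  -- A weak limit of unit vectors may lose norm. Here it does not: m‖x‖² ≤ h(x,x) ≤ m with m < 0
  -- forces ‖x‖ ≥ 1. This is where negativity of `l` enters.
  have hx2 : ‖x‖ ^ 2 = 1 := by
    have h1 := hge x hxD hxu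
    have h2 : ‖x‖ ^ 2 ≤ 1 := pow_le_one₀ (norm_nonneg x) hx1
    nlinarith
  have hxm' : (h x x).re = m := le_antisymm hxm (by simpa [hx2] using hge x hxD hxu)
  -- The first variation of h(x + sy) − m‖x + sy‖² ≥ 0, which vanishes at s = 0.
  have hre : ∀ y ∈ D, (∀ i, inner ℂ (u i) y = 0) →
      (h y x).re = (m * inner ℂ y x : ℂ).re := by
    intro y hy hyu
    rw [← sub_eq_zero]
    refine eq_zero_of_forall_quadratic_nonneg (b := (h y y).re - m * ‖y‖ ^ 2) fun s => ?_
    have h1 := hge (x + (s : ℂ) • y) (hf.add_mem hxD (hf.smul_mem _ hy)) fun i => by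
      rw [inner_add_right, inner_smul_right, hxu i, hyu i]; simp
    rw [hf.re_add_smul s hxD hy, norm_add_sq (𝕜 := ℂ), inner_smul_right, norm_smul,
      Complex.norm_real, Real.norm_eq_abs, mul_pow, sq_abs, hx2, hxm',
      ← inner_conj_symm x y] at h1
    simp only [RCLike.re_to_complex, Complex.re_ofReal_mul, Complex.conj_re] at h1 ⊢
    nlinarith
  have hperp : ∀ y ∈ D, (∀ i, inner ℂ (u i) y = 0) → h y x = m * inner ℂ y x := by
    intro y hy hyu
    refine Complex.ext (hre y hy hyu) ?_
    -- Real variations only see real parts; the direction iy supplies the imaginary part.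
    have h1 := hre (Complex.I • y) (hf.smul_mem _ hy) fun i => by
      rw [inner_smul_right, hyu i, mul_zero]
    rw [hf.smul_left _ hy hxD, inner_smul_left] at h1
    simpa using h1
  refine ⟨x, m, hml, ?_, hxu, hxD, fun y hy => ?_⟩
  · nlinarith [norm_nonneg x]
  · have huD : ∀ i, u i ∈ D := fun i => (hμ i).1
    have hsD : ∑ i, inner ℂ (u i) y • u i ∈ D :=
      hf.sum_mem _ fun i => hf.smul_mem _ (huD i)
    -- A general test vector splits into its projection p onto the old eigenvectors and a remainder
    -- q. Since the `u i` are eigenvectors orthogonal to x, both h(p,x) and ⟨p,x⟩ are zero, so only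
    -- q matters.
    set p : E := ∑ i, inner ℂ (u i) y • u i with hp
    set q : E := y + (-1 : ℂ) • p with hq
    have hqD : q ∈ D := hf.add_mem hy (hf.smul_mem _ hsD)
    have hqu : ∀ i, inner ℂ (u i) q = 0 := by
      intro i
      rw [hq, inner_add_right, inner_smul_right, hp, hu.inner_right_fintype]
      ring
    have hy' : y = q + p := by simp [hq]
    have hux : ∀ i, inner ℂ (u i) y • u i ∈ D := fun i => hf.smul_mem _ (huD i)
    have hpx : h p x = 0 := by
      rw [hp, hf.sum_left _ hxD hux]
      refine Finset.sum_eq_zero fun i _ => ?_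
      rw [hf.smul_left _ (huD i) hxD, ← hf.conj_symm hxD (huD i), (hμ i).2 x hxD,
        inner_smul_right, inner_eq_zero_symm.1 (hxu i)]
      simp
    have hpx' : inner ℂ p x = 0 := by
      rw [hp, sum_inner]
      refine Finset.sum_eq_zero fun i _ => ?_
      rw [inner_smul_left, hxu i, mul_zero]
    rw [inner_smul_right, hy', hf.add_left hqD hsD hxD, inner_add_left, hpx, hpx',
      hperp q hqD hqu, add_zero, add_zero]

/-- A system of trial subspaces yields orthonormal eigenvectors. -/
theorem exists_eigensystem (hf : IsHermitianForm D h) (hm : HasMinimizers D h) :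
    ∀ (n : ℕ) (l : Fin n → ℝ), (∀ k, l k < 0) →
    (∀ (k : Fin n) (u : Fin k → E), ∃ w ∈ D, w ≠ 0 ∧ (∀ i, inner ℂ (u i) w = 0) ∧
      (h w w).re ≤ l k * ‖w‖ ^ 2) →
    ∃ (u : Fin n → E) (μ : Fin n → ℝ), Orthonormal ℂ u ∧ (∀ i, μ i ≤ l i) ∧
      ∀ i, OperatorRel D h (u i) ((μ i : ℂ) • u i) := by
  intro n
  induction n with
  | zero =>
    intro l _ _
    exact ⟨fun i => i.elim0, fun i => i.elim0, ⟨fun i => i.elim0, fun i => i.elim0⟩,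
      fun i => i.elim0, fun i => i.elim0⟩
  | succ n ih =>
    intro l hl hw
    obtain ⟨u, μ, huo, hμl, hμ⟩ := ih (fun i => l i.castSucc) (fun i => hl _)
      (fun k u => hw k.castSucc u)
    obtain ⟨w, hwD, hw0, hwu, hwl⟩ := hw (Fin.last n) u
    obtain ⟨x, m, hml, hx1, hxu, hx⟩ :=
      exists_eigenvector hf hm huo hμ hwD hw0 hwu (hl _) hwl
    refine ⟨Fin.snoc u x, Fin.snoc μ m, ⟨?_, ?_⟩, ?_, ?_⟩
    · intro i
      refine Fin.lastCases ?_ (fun j => ?_) i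
      · simpa using hx1
      · simpa using huo.1 j
    · intro i j
      refine Fin.lastCases ?_ (fun i => ?_) i <;> refine Fin.lastCases ?_ (fun j => ?_) j
      · intro hij; exact absurd rfl hij
      · intro _
        simp only [Fin.snoc_last, Fin.snoc_castSucc]
        exact inner_eq_zero_symm.1 (hxu j)
      · intro _
        simp only [Fin.snoc_last, Fin.snoc_castSucc]
        exact hxu i
      · intro hij
        simp only [Fin.snoc_castSucc]
        exact huo.2 fun hh => hij (by rw [hh])
    · intro i
      refine Fin.lastCases ?_ (fun j => ?_) i
      · simpa using hml
      · simpa using hμl j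
    · intro i
      refine Fin.lastCases ?_ (fun j => ?_) i
      · simpa using hx
      · simpa using hμ j

end VariationalPrinciple

/-! ### Trace bounds from eigensystems and trial functions -/

section NegTrace

variable {E : Type*} [NormedAddCommGroup E] [InnerProductSpace ℂ E]
variable {D : Set E} {h : E → E → ℂ}

theorem card_le_multiplicity (hf : IsHermitianForm D h) {ι : Type*} [Fintype ι] {u : ι → E}
    (hu : LinearIndependent ℂ u) {t : ℝ} (ht : ∀ i, OperatorRel D h (u i) ((t : ℂ) • u i)) :
    (Fintype.card ι : ℕ∞) ≤ multiplicity D h t := by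
  rw [hf.multiplicity_eq, Cardinal.natCast_le_toENat]
  have hu' : LinearIndependent ℂ (fun i => (⟨u i, ht i⟩ : hf.eigenspace t)) := by
    refine LinearIndependent.of_comp (hf.eigenspace t).subtype ?_
    exact hu
  simpa using hu'.cardinal_lift_le_rank

/-- The sum over an orthonormal system of eigenvectors does not exceed the trace. -/
theorem sum_le_negTrace (hf : IsHermitianForm D h) {n : ℕ} {u : Fin n → E}
    (hu : Orthonormal ℂ u) {μ : Fin n → ℝ} (hneg : ∀ i, μ i < 0)
    (hμ : ∀ i, OperatorRel D h (u i) ((μ i : ℂ) • u i)) (γ : ℝ) :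
    ∑ i, ENNReal.ofReal (|μ i| ^ γ) ≤ negTrace D h γ := by
  classical
  -- Indices are grouped by eigenvalue; each group is a linearly independent family in one
  -- eigenspace, so its size is at most the multiplicity.
  set ν : Fin n → Set.Iio (0 : ℝ) := fun i => ⟨μ i, hneg i⟩ with hν
  have h1 : ∑ i, ENNReal.ofReal (|μ i| ^ γ)
      = ∑ t ∈ Finset.univ.image ν,
        (Finset.univ.filter (fun i => ν i = t)).card • ENNReal.ofReal (|(t : ℝ)| ^ γ) :=
    Finset.sum_comp (fun t : Set.Iio (0 : ℝ) => ENNReal.ofReal (|(t : ℝ)| ^ γ)) ν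
  rw [h1]
  refine le_trans (Finset.sum_le_sum fun t _ => ?_) (ENNReal.sum_le_tsum (Finset.univ.image ν))
  rw [nsmul_eq_mul]
  gcongr
  have h2 : (Fintype.card {i // ν i = t} : ℕ∞) ≤ multiplicity D h (t : ℝ) := by
    refine card_le_multiplicity hf (u := fun i : {i // ν i = t} => u i)
      (hu.linearIndependent.comp _ Subtype.val_injective) fun i => ?_
    have := hμ i
    rwa [show μ i = (t : ℝ) from congrArg Subtype.val i.2] at this
  rw [Fintype.card_subtype] at h2
  exact_mod_cast (ENat.toENNReal_le.2 h2)

/-- `S` may have infinite dimension and `E` need not be complete, so an orthonormal basis is taken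
only of the span of k independent vectors. -/
theorem exists_orthonormal_of_le_rank (S : Submodule ℂ E) {k : ℕ}
    (hk : (k : ℕ∞) ≤ Cardinal.toENat (Module.rank ℂ S)) :
    ∃ u : Fin k → E, Orthonormal ℂ u ∧ ∀ i, u i ∈ S := by
  rw [Cardinal.natCast_le_toENat] at hk
  obtain ⟨s, hs, hli⟩ := exists_finset_linearIndependent_of_le_rank hk
  set T : Submodule ℂ S := Submodule.span ℂ (s : Set S)
  have hT : Module.finrank ℂ T = k := by
    rw [← hs]
    exact finrank_span_finset_eq_card hli
  have : FiniteDimensional ℂ T := FiniteDimensional.span_finset ℂ s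
  set b := (stdOrthonormalBasis ℂ T).reindex (finCongr hT)
  refine ⟨fun i => ((b i : S) : E), ?_, fun i => (b i : S).2⟩
  exact (b.orthonormal.comp_linearIsometry T.subtypeₗᵢ).comp_linearIsometry S.subtypeₗᵢ

/-- To bound the trace it suffices to bound the sums over finite orthonormal systems of
eigenvectors. -/
theorem negTrace_le (hf : IsHermitianForm D h) {γ : ℝ} {B : ENNReal}
    (hB : ∀ (n : ℕ) (u : Fin n → E) (t : Fin n → ℝ), Orthonormal ℂ u → Monotone t →
      (∀ i, t i < 0) → (∀ i, OperatorRel D h (u i) ((t i : ℂ) • u i)) →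
      ∑ i, ENNReal.ofReal (|t i| ^ γ) ≤ B) :
    negTrace D h γ ≤ B := by
  classical
  -- Multiplicities are replaced by arbitrary finite lower bounds `k t`, which covers finite and
  -- infinite multiplicity at once.
  have key : ∀ (s : Finset (Set.Iio (0 : ℝ))) (k : Set.Iio (0 : ℝ) → ℕ),
      (∀ t, (k t : ℕ∞) ≤ multiplicity D h (t : ℝ)) →
      ∑ t ∈ s, (k t : ENNReal) * ENNReal.ofReal (|(t : ℝ)| ^ γ) ≤ B := by
    intro s k hk
    have hex : ∀ t : Set.Iio (0 : ℝ), ∃ u : Fin (k t) → E, Orthonormal ℂ u ∧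
        ∀ i, u i ∈ hf.eigenspace t := fun t =>
      exists_orthonormal_of_le_rank _ (by rw [← hf.multiplicity_eq]; exact hk t)
    choose u huo hue using hex
    set ι := Σ t : s, Fin (k t)
    set e : Fin (Fintype.card ι) ≃ ι := (Fintype.equivFin ι).symm
    set τ : ι → ℝ := fun x => ((x.1 : Set.Iio (0 : ℝ)) : ℝ)
    -- Sorting supplies the monotone order of the eigenvalues that the hypothesis asks for.
    set σ := Tuple.sort (τ ∘ e)
    have ho : Orthonormal ℂ (fun x : ι => u x.1 x.2) := by
      refine ⟨fun x => (huo _).1 _, ?_⟩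
      rintro ⟨t, i⟩ ⟨t', i'⟩ hne
      by_cases htt : t = t'
      · subst htt
        exact (huo _).2 fun hi => hne (Sigma.ext rfl (heq_of_eq hi))
      · refine hf.inner_eq_zero (s := (t : Set.Iio (0 : ℝ))) (t := (t' : Set.Iio (0 : ℝ)))
          (fun hh => htt (Subtype.ext (Subtype.ext hh))) (hue _ i) (hue _ i')
    have h1 := hB (Fintype.card ι) (fun i => u (e (σ i)).1 (e (σ i)).2) (fun i => τ (e (σ i)))
      (ho.comp (fun i => e (σ i)) (e.injective.comp σ.injective)) (Tuple.monotone_sort (τ ∘ e))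
      (fun i => (e (σ i)).1.1.2) (fun i => hue _ _)
    refine le_trans (le_of_eq ?_) h1
    rw [show ∑ i, ENNReal.ofReal (|τ (e (σ i))| ^ γ) = ∑ x, ENNReal.ofReal (|τ x| ^ γ) from
      (σ.trans e).sum_comp (fun x => ENNReal.ofReal (|τ x| ^ γ)), Fintype.sum_sigma, ← Finset.sum_coe_sort s]
    simp [τ]
  rw [negTrace, ENNReal.tsum_eq_iSup_sum]
  refine iSup_le fun s => ?_
  -- An eigenvalue of infinite multiplicity admits every finite lower bound, which forces `B = ⊤`.
  by_cases htop : ∃ t ∈ s, multiplicity D h (t : ℝ) = ⊤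
  · obtain ⟨t, hts, ht⟩ := htop
    have hpos : 0 < ENNReal.ofReal (|(t : ℝ)| ^ γ) :=
      ENNReal.ofReal_pos.2 (Real.rpow_pos_of_pos (abs_pos.2 (ne_of_lt t.2)) _)
    have hBtop : B = ⊤ := by
      refine ENNReal.eq_top_of_forall_nnreal_le fun r => ?_
      obtain ⟨k, hk⟩ := ENNReal.exists_nat_mul_gt hpos.ne' (ENNReal.coe_ne_top (r := r))
      have := key {t} (fun t' => if t' = t then k else 0) (fun t' => by
        by_cases h' : t' = t
        · subst h'; simp [ht]
        · simp [h'])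
      simp only [Finset.sum_singleton, if_true] at this
      exact hk.le.trans this
    rw [hBtop]
    exact le_top
  · push Not at htop
    refine le_trans (le_of_eq (Finset.sum_congr rfl fun t ht => ?_))
      (key s (fun t => (multiplicity D h (t : ℝ)).toNat) fun t => ENat.natCast_toNat_le_self _)
    congr 1
    conv_lhs => rw [← ENat.natCast_toNat (htop t ht)]
    simp

/-- The variational principle: trial subspaces give a lower bound on the trace. -/
theorem sum_le_negTrace_of_trial (hf : IsHermitianForm D h) (hm : HasMinimizers D h) {γ : ℝ}
    (hγ : 0 ≤ γ) {n : ℕ} {w : Fin n → E} (hw : ∀ i, w i ∈ D) {l : Fin n → ℝ}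
    (hl : ∀ k, l k < 0)
    (htrial : ∀ (k : Fin n) (c : Fin n → ℂ), c ≠ 0 → (∀ i, k < i → c i = 0) →
      ∑ i, c i • w i ≠ 0 ∧
      (h (∑ i, c i • w i) (∑ i, c i • w i)).re ≤ l k * ‖∑ i, c i • w i‖ ^ 2) :
    ∑ i, ENNReal.ofReal (|l i| ^ γ) ≤ negTrace D h γ := by
  obtain ⟨u, μ, huo, hμl, hμ⟩ := exists_eigensystem hf hm n l hl fun k u => by
    have hkn : (k : ℕ) + 1 ≤ n := k.2
    set ext : (Fin (k + 1) → ℂ) →ₗ[ℂ] (Fin n → ℂ) :=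
      Function.ExtendByZero.linearMap ℂ (Fin.castLE hkn)
    set T : (Fin (k + 1) → ℂ) →ₗ[ℂ] (Fin k → ℂ) :=
      LinearMap.pi fun i => (innerₛₗ ℂ (u i)) ∘ₗ (Fintype.linearCombination ℂ w) ∘ₗ ext
    -- With k counted from zero, there are k + 1 free coefficients against k orthogonality
    -- conditions, so a nonzero solution exists.
    have hker : LinearMap.ker T ≠ ⊥ := LinearMap.ker_ne_bot_of_finrank_lt (by simp)
    obtain ⟨c, hc, hc0⟩ := Submodule.exists_mem_ne_zero_of_ne_bot hker
    have hinj : Function.Injective (Fin.castLE hkn) := Fin.castLE_injective hkn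
    have hext0 : ext c ≠ 0 := by
      intro h0
      refine hc0 (funext fun i => ?_)
      have := congrFun h0 (Fin.castLE hkn i)
      simpa [ext, hinj.extend_apply] using this
    have hsupp : ∀ i, k < i → ext c i = 0 := by
      intro i hi
      simp only [ext, Function.ExtendByZero.linearMap_apply]
      rw [Function.extend_apply']
      · rfl
      · rintro ⟨j, rfl⟩
        have : (k : ℕ) < j := hi
        omega
    obtain ⟨h1, h2⟩ := htrial k (ext c) hext0 hsupp
    refine ⟨∑ i, ext c i • w i, hf.sum_mem _ fun i => hf.smul_mem _ (hw i), h1, fun i => ?_, h2⟩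
    have := congrFun (LinearMap.mem_ker.1 hc) i
    exact this
  refine le_trans (Finset.sum_le_sum fun i _ => ?_)
    (sum_le_negTrace hf huo (fun i => (hμl i).trans_lt (hl i)) hμ γ)
  refine ENNReal.ofReal_le_ofReal (Real.rpow_le_rpow (abs_nonneg _) ?_ hγ)
  rw [abs_of_neg (hl i), abs_of_neg ((hμl i).trans_lt (hl i))]
  linarith [hμl i]

theorem form_eigensystem {n : ℕ} {u : Fin n → E}
    (hu : Orthonormal ℂ u) {t : Fin n → ℝ}
    (ht : ∀ i, OperatorRel D h (u i) ((t i : ℂ) • u i)) (i j : Fin n) :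
    h (u i) (u j) = if i = j then (t i : ℂ) else 0 := by
  rw [(ht j).2 _ (ht i).1, inner_smul_right, orthonormal_iff_ite.1 hu i j]
  split_ifs with hij
  · rw [hij, mul_one]
  · rw [mul_zero]

theorem sum_sum_diagonal {n : ℕ} (t : Fin n → ℝ) (c : Fin n → ℂ) :
    (∑ i, ∑ j, starRingEnd ℂ (c i) * c j * (if i = j then (t i : ℂ) else 0)).re
      = ∑ i, t i * ‖c i‖ ^ 2 := by
  rw [Complex.re_sum]
  refine Finset.sum_congr rfl fun i _ => ?_
  simp only [mul_ite, mul_zero, Finset.sum_ite_eq, Finset.mem_univ, if_true]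
  rw [Complex.conj_mul', mul_comm, ← Complex.ofReal_pow, ← Complex.ofReal_mul, Complex.ofReal_re]

/-- If one form is a restriction of another one up to an isometry, then its trace is smaller. -/
theorem negTrace_le_of_isometry {E' : Type*} [NormedAddCommGroup E'] [InnerProductSpace ℂ E']
    {D' : Set E'} {h' : E' → E' → ℂ} (hf : IsHermitianForm D h) (hf' : IsHermitianForm D' h')
    (hm' : HasMinimizers D' h') (J : E →ₗ[ℂ] E') (hJ : ∀ u ∈ D, J u ∈ D')
    (hJn : ∀ u ∈ D, ‖J u‖ = ‖u‖) (hJh : ∀ u ∈ D, (h' (J u) (J u)).re = (h u u).re) {γ : ℝ}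
    (hγ : 0 ≤ γ) : negTrace D h γ ≤ negTrace D' h' γ := by
  refine negTrace_le hf fun n u t huo hmono hneg ht => ?_
  have huD : ∀ i, u i ∈ D := fun i => (ht i).1
  refine sum_le_negTrace_of_trial hf' hm' hγ (w := fun i => J (u i))
    (fun i => hJ _ (huD i)) hneg fun k c hc0 hck => ?_
  have hsum : ∑ i, c i • J (u i) = J (∑ i, c i • u i) := by simp
  have hD : ∑ i, c i • u i ∈ D := hf.sum_mem _ fun i => hf.smul_mem _ (huD i)
  have hnorm : ‖∑ i, c i • u i‖ ^ 2 = ∑ i, ‖c i‖ ^ 2 := by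
    rw [← inner_self_eq_norm_sq (𝕜 := ℂ), huo.inner_sum, map_sum]
    refine Finset.sum_congr rfl fun i _ => ?_
    rw [RCLike.conj_mul, ← RCLike.ofReal_pow, RCLike.ofReal_re]
  have hform : (h (∑ i, c i • u i) (∑ i, c i • u i)).re = ∑ i, t i * ‖c i‖ ^ 2 := by
    simp only [hf.apply_sum_smul huD, form_eigensystem huo ht, sum_sum_diagonal]
  rw [hsum]
  constructor
  · intro h0
    have h1 := hJn _ hD
    rw [h0, norm_zero] at h1
    rw [← h1] at hnorm
    refine hc0 (funext fun i => ?_)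
    have h2 : ∑ i, ‖c i‖ ^ 2 = 0 := by rw [← hnorm]; simp
    have := (Finset.sum_eq_zero_iff_of_nonneg fun i _ => by positivity).1 h2 i (Finset.mem_univ _)
    simpa using this
  · rw [hJh _ hD, hJn _ hD, hform, hnorm, Finset.mul_sum]
    refine Finset.sum_le_sum fun i _ => ?_
    -- Only eigenvalues with index at most k contribute, and by monotonicity each of them is at most
    -- `t k`.
    by_cases hik : k < i
    · simp [hck i hik]
    · exact mul_le_mul_of_nonneg_right (hmono (not_lt.1 hik)) (by positivity)

theorem norm_sum_sum_le {n : ℕ} (A : Fin n → Fin n → ℂ) (c : Fin n → ℂ) :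
    ‖∑ i, ∑ j, starRingEnd ℂ (c i) * c j * A i j‖
      ≤ (∑ i, ∑ j, ‖A i j‖) * ∑ i, ‖c i‖ ^ 2 := by
  rw [Finset.sum_mul]
  refine (norm_sum_le _ _).trans (Finset.sum_le_sum fun i _ => ?_)
  rw [Finset.sum_mul]
  refine (norm_sum_le _ _).trans (Finset.sum_le_sum fun j _ => ?_)
  rw [norm_mul, norm_mul, RCLike.norm_conj, mul_comm]
  refine mul_le_mul_of_nonneg_left ?_ (norm_nonneg _)
  have hi := Finset.single_le_sum (f := fun i => ‖c i‖ ^ 2) (fun i _ => by positivity)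
    (Finset.mem_univ i)
  have hj := Finset.single_le_sum (f := fun i => ‖c i‖ ^ 2) (fun i _ => by positivity)
    (Finset.mem_univ j)
  nlinarith [sq_nonneg (‖c i‖ - ‖c j‖)]

/-- If the Gram matrices tend to the identity and the form matrices tend to a diagonal matrix,
then the Rayleigh quotients are asymptotically controlled by the diagonal entries. -/
theorem eventually_rayleigh_le {n : ℕ} {t : Fin n → ℝ} (hmono : Monotone t)
    {G H : ℕ → Fin n → Fin n → ℂ}
    (hG : ∀ i j, Tendsto (fun R => G R i j) atTop (𝓝 (if i = j then 1 else 0)))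
    (hH : ∀ i j, Tendsto (fun R => H R i j) atTop (𝓝 (if i = j then (t i : ℂ) else 0)))
    {ε : ℝ} (hε : 0 < ε) (hlt : ∀ k, t k + ε < 0) :
    ∀ᶠ R in atTop, ∀ (k : Fin n) (c : Fin n → ℂ), c ≠ 0 → (∀ i, k < i → c i = 0) →
      0 < (∑ i, ∑ j, starRingEnd ℂ (c i) * c j * G R i j).re ∧
      (∑ i, ∑ j, starRingEnd ℂ (c i) * c j * H R i j).re
        ≤ (t k + ε) * (∑ i, ∑ j, starRingEnd ℂ (c i) * c j * G R i j).re := by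
  set T := ∑ k, |t k| with hT
  have hT0 : 0 ≤ T := Finset.sum_nonneg fun i _ => abs_nonneg _
  -- The final comparison requires κ(1 − t k − ε) ≤ ε; since −t k ≤ T, this κ satisfies it for all k
  -- at once.
  set κ := ε / (1 + T + ε) with hκ
  have hden : 0 < 1 + T + ε := by positivity
  have hκ0 : 0 < κ := by positivity
  have hκ1 : κ < 1 := by rw [hκ, div_lt_one hden]; linarith
  have hκe : κ * (1 + T + ε) = ε := div_mul_cancel₀ _ hden.ne'
  have hlim : ∀ {A : ℕ → Fin n → Fin n → ℂ} {a : Fin n → Fin n → ℂ},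
      (∀ i j, Tendsto (fun R => A R i j) atTop (𝓝 (a i j))) →
      ∀ᶠ R in atTop, ∑ i, ∑ j, ‖A R i j - a i j‖ < κ := by
    intro A a hA
    have : Tendsto (fun R => ∑ i, ∑ j, ‖A R i j - a i j‖) atTop
        (𝓝 (∑ i : Fin n, ∑ j : Fin n, ‖a i j - a i j‖)) :=
      tendsto_finsetSum _ fun i _ => tendsto_finsetSum _ fun j _ =>
        ((hA i j).sub tendsto_const_nhds).norm
    simp only [sub_self, norm_zero, Finset.sum_const_zero] at this
    exact this.eventually (gt_mem_nhds hκ0)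
  filter_upwards [hlim hG, hlim hH] with R hGR hHR k c hc0 hck
  set S := ∑ i, ‖c i‖ ^ 2 with hS
  have hSpos : 0 < S := by
    obtain ⟨i, hi⟩ := Function.ne_iff.1 hc0
    exact Finset.sum_pos' (fun i _ => by positivity)
      ⟨i, Finset.mem_univ _, by have : 0 < ‖c i‖ := norm_pos_iff.2 hi
                                positivity⟩
  have hdiff : ∀ (A a : Fin n → Fin n → ℂ), ∑ i, ∑ j, ‖A i j - a i j‖ < κ →
      |(∑ i, ∑ j, starRingEnd ℂ (c i) * c j * A i j).re
        - (∑ i, ∑ j, starRingEnd ℂ (c i) * c j * a i j).re| ≤ κ * S := by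
    intro A a hAa
    have h1 := norm_sum_sum_le (fun i j => A i j - a i j) c
    simp only [mul_sub, Finset.sum_sub_distrib] at h1
    rw [← Complex.sub_re]
    exact (Complex.abs_re_le_norm _).trans (h1.trans (by gcongr))
  have hg := hdiff _ _ hGR
  have hh := hdiff _ _ hHR
  have hg1 : (∑ i, ∑ j, starRingEnd ℂ (c i) * c j * (if i = j then (1 : ℂ) else 0)).re = S := by
    simpa using sum_sum_diagonal (fun _ : Fin n => (1 : ℝ)) c
  rw [hg1] at hg
  rw [sum_sum_diagonal] at hh
  have hle : ∑ i, t i * ‖c i‖ ^ 2 ≤ t k * S := by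
    rw [hS, Finset.mul_sum]
    refine Finset.sum_le_sum fun i _ => ?_
    by_cases hik : k < i
    · simp [hck i hik]
    · exact mul_le_mul_of_nonneg_right (hmono (not_lt.1 hik)) (by positivity)
  have htk : -t k ≤ T := (neg_le_abs _).trans
    (Finset.single_le_sum (f := fun k => |t k|) (fun i _ => abs_nonneg _) (Finset.mem_univ k))
  rw [abs_le] at hg hh
  refine ⟨by nlinarith, ?_⟩
  -- The factor t k + ε is negative, so it is the upper bound on the Gram value that is needed here.
  have h2 : (t k + ε) * ((1 + κ) * S)
      ≤ (t k + ε) * (∑ i, ∑ j, starRingEnd ℂ (c i) * c j * G R i j).re :=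
    mul_le_mul_of_nonpos_left (by linarith) (hlt k).le
  refine le_trans ?_ h2
  have h3 : κ * (1 - t k - ε) ≤ ε := by nlinarith
  nlinarith

end NegTrace

/-! ### Integration by parts for primitives of locally integrable functions -/

section Primitive

theorem intervalIntegrable_of_locallyIntegrable {F : Type*} [NormedAddCommGroup F] {G : ℝ → F}
    (hG : LocallyIntegrable G) (a b : ℝ) : IntervalIntegrable G volume a b :=
  intervalIntegrable_iff.2
    ((hG.integrableOn_isCompact isCompact_uIcc).mono_set Set.uIoc_subset_uIcc)

/-- The primitive is absolutely continuous, so integration by parts applies, and by Lebesgue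
differentiation its derivative is `G` almost everywhere. -/
theorem integral_deriv_mul_primitive_real {G w : ℝ → ℝ} (hG : LocallyIntegrable G)
    (hw : ∀ a b, w b - w a = ∫ s in a..b, G s) {φ : ℝ → ℝ} (hφ : ContDiff ℝ 1 φ) (a b : ℝ) :
    ∫ x in a..b, deriv φ x * w x = φ b * w b - φ a * w a - ∫ x in a..b, φ x * G x := by
  have hwa : w = fun x => w a + ∫ s in a..x, G s := funext fun x => by rw [← hw a x]; ring
  have hac : AbsolutelyContinuousOnInterval w a b := by
    rw [hwa]
    refine AbsolutelyContinuousOnInterval.add (f := fun _ => w a) ?_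
      ((intervalIntegrable_of_locallyIntegrable hG a b).absolutelyContinuousOnInterval_intervalIntegral
        (by simp))
    exact (contDiff_const (c := w a) (n := 1)).contDiffOn.absolutelyContinuousOnInterval
  have h1 := (hφ.contDiffOn (s := Set.uIcc a b)).absolutelyContinuousOnInterval
    |>.integral_mul_deriv_eq_deriv_mul hac
  have h2 : ∫ x in a..b, φ x * deriv w x = ∫ x in a..b, φ x * G x := by
    refine intervalIntegral.integral_congr_ae ?_
    filter_upwards [_root_.LocallyIntegrable.ae_hasDerivAt_integral hG] with x hx _
    have : HasDerivAt w (G x) x := by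
      rw [hwa]
      exact (hx a).const_add _
    rw [this.deriv]
  linarith

theorem integral_deriv_mul_primitive {G w : ℝ → ℂ} (hG : LocallyIntegrable G)
    (hw : ∀ a b, w b - w a = ∫ s in a..b, G s) {φ : ℝ → ℝ} (hφ : ContDiff ℝ 1 φ) (a b : ℝ) :
    ∫ x in a..b, ((deriv φ x : ℝ) : ℂ) * w x
      = φ b * w b - φ a * w a - ∫ x in a..b, (φ x : ℂ) * G x := by
  have hGi := intervalIntegrable_of_locallyIntegrable hG
  have hwc : Continuous w := by
    have : w = fun x => w 0 + ∫ s in (0 : ℝ)..x, G s := funext fun x => by rw [← hw 0 x]; ring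
    rw [this]
    exact continuous_const.add (intervalIntegral.continuous_primitive hGi 0)
  have hi1 : IntervalIntegrable (fun x => ((deriv φ x : ℝ) : ℂ) * w x) volume a b :=
    ((Complex.continuous_ofReal.comp (hφ.continuous_deriv le_rfl)).mul hwc).intervalIntegrable a b
  have hi2 : IntervalIntegrable (fun x => (φ x : ℂ) * G x) volume a b :=
    (hGi a b).continuousOn_mul (Complex.continuous_ofReal.comp hφ.continuous).continuousOn
  have hre : ∀ {f : ℝ → ℂ}, IntervalIntegrable f volume a b →
      (∫ x in a..b, f x).re = ∫ x in a..b, (f x).re := fun hf =>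
    (intervalIntegral.intervalIntegral_re hf).symm
  have him : ∀ {f : ℝ → ℂ}, IntervalIntegrable f volume a b →
      (∫ x in a..b, f x).im = ∫ x in a..b, (f x).im := fun hf =>
    (intervalIntegral.intervalIntegral_im hf).symm
  have h1 := integral_deriv_mul_primitive_real (G := fun x => (G x).re) (w := fun x => (w x).re)
    (fun x => let ⟨s, hs, h⟩ := hG x; ⟨s, hs, h.re⟩) (fun a b => by
      rw [← Complex.sub_re, hw a b]; exact (intervalIntegral.intervalIntegral_re (hGi a b)).symm)
    hφ a b
  have h2 := integral_deriv_mul_primitive_real (G := fun x => (G x).im) (w := fun x => (w x).im)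
    (fun x => let ⟨s, hs, h⟩ := hG x; ⟨s, hs, h.im⟩) (fun a b => by
      rw [← Complex.sub_im, hw a b]; exact (intervalIntegral.intervalIntegral_im (hGi a b)).symm)
    hφ a b
  apply Complex.ext
  · rw [hre hi1, Complex.sub_re, Complex.sub_re, hre hi2]
    simpa only [Complex.re_ofReal_mul] using h1
  · rw [him hi1, Complex.sub_im, Complex.sub_im, him hi2]
    simpa only [Complex.im_ofReal_mul] using h2

end Primitive

/-! ### Sobolev functions -/

section Sobolev

variable {Ω : Set ℝ}

theorem HasWeakDeriv.congr {u u' g g' : ℝ → ℂ} (h : HasWeakDeriv Ω u g)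
    (hu : u =ᵐ[volume.restrict Ω] u') (hg : g =ᵐ[volume.restrict Ω] g') :
    HasWeakDeriv Ω u' g' := by
  intro φ hφ hc hs
  have h1 : ∫ x in Ω, ((deriv φ x : ℝ) : ℂ) * u x = ∫ x in Ω, ((deriv φ x : ℝ) : ℂ) * u' x :=
    integral_congr_ae (hu.mono fun x hx => by simp only [hx])
  have h2 : ∫ x in Ω, ((φ x : ℝ) : ℂ) * g x = ∫ x in Ω, ((φ x : ℝ) : ℂ) * g' x :=
    integral_congr_ae (hg.mono fun x hx => by simp only [hx])
  rw [← h1, ← h2]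
  exact h φ hφ hc hs

theorem integrable_ofReal_mul {μ : Measure ℝ} [IsLocallyFiniteMeasure μ] {u : ℝ → ℂ}
    (hu : MemLp u 2 μ) {φ : ℝ → ℝ} (hφ : Continuous φ) (hc : HasCompactSupport φ) :
    Integrable (fun x => (φ x : ℂ) * u x) μ := by
  have h := (hu.locallyIntegrable (by norm_num)).integrable_smul_left_of_hasCompactSupport hφ hc
  simpa only [Complex.real_smul] using h

theorem HasWeakDeriv.add {u u' g g' : ℝ → ℂ} (h : HasWeakDeriv Ω u g)
    (h' : HasWeakDeriv Ω u' g') (hu : MemLp u 2 (volume.restrict Ω))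
    (hu' : MemLp u' 2 (volume.restrict Ω)) (hg : MemLp g 2 (volume.restrict Ω))
    (hg' : MemLp g' 2 (volume.restrict Ω)) : HasWeakDeriv Ω (u + u') (g + g') := by
  intro φ hφ hc hs
  have hd : Continuous (deriv φ) := hφ.continuous_deriv (by simp)
  simp only [Pi.add_apply, mul_add]
  rw [integral_add (integrable_ofReal_mul hu hd hc.deriv)
      (integrable_ofReal_mul hu' hd hc.deriv),
    integral_add (integrable_ofReal_mul hg hφ.continuous hc)
      (integrable_ofReal_mul hg' hφ.continuous hc), h φ hφ hc hs, h' φ hφ hc hs]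
  ring

theorem HasWeakDeriv.const_smul {u g : ℝ → ℂ} (h : HasWeakDeriv Ω u g) (c : ℂ) :
    HasWeakDeriv Ω (c • u) (c • g) := by
  intro φ hφ hc hs
  simp only [Pi.smul_apply, smul_eq_mul, mul_left_comm _ c]
  rw [integral_const_mul, integral_const_mul, h φ hφ hc hs]
  ring

theorem setIntegral_eq_of_tsupport_subset {φ : ℝ → ℝ} (hs : tsupport φ ⊆ Ω) (f : ℝ → ℂ) :
    ∫ x in Ω, (φ x : ℂ) * f x = ∫ x, (φ x : ℂ) * f x :=
  setIntegral_eq_integral_of_forall_compl_eq_zero fun x hx => by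
    rw [image_eq_zero_of_notMem_tsupport fun h => hx (hs h)]; simp

theorem locallyIntegrableOn_of_memLp {f : ℝ → ℂ}
    (hf : MemLp f 2 (volume.restrict Ω)) : LocallyIntegrableOn f Ω :=
  locallyIntegrableOn_of_locallyIntegrable_restrict (hf.locallyIntegrable (by norm_num))

theorem locallyIntegrable_indicator (hΩ : IsOpen Ω) {f : ℝ → ℂ}
    (hf : MemLp f 2 (volume.restrict Ω)) : LocallyIntegrable (Ω.indicator f) :=
  ((memLp_indicator_iff_restrict hΩ.measurableSet).2 hf).locallyIntegrable (by norm_num)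

theorem ae_eq_zero_of_forall_test (hΩ : IsOpen Ω) {f : ℝ → ℂ} (hf : LocallyIntegrableOn f Ω)
    (h : ∀ φ : ℝ → ℝ, ContDiff ℝ (⊤ : ℕ∞) φ → HasCompactSupport φ → tsupport φ ⊆ Ω →
      ∫ x in Ω, (φ x : ℂ) * f x = 0) : f =ᵐ[volume.restrict Ω] 0 := by
  refine (ae_restrict_iff' hΩ.measurableSet).2
    (hΩ.ae_eq_zero_of_integral_contDiff_smul_eq_zero hf fun φ hφ hc hs => ?_)
  simp only [Complex.real_smul]
  rw [← setIntegral_eq_of_tsupport_subset hs]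
  exact h φ hφ hc hs

theorem HasWeakDeriv.unique (hΩ : IsOpen Ω) {u g g' : ℝ → ℂ} (h : HasWeakDeriv Ω u g)
    (h' : HasWeakDeriv Ω u g') (hg : MemLp g 2 (volume.restrict Ω))
    (hg' : MemLp g' 2 (volume.restrict Ω)) : g =ᵐ[volume.restrict Ω] g' := by
  have h0 := ae_eq_zero_of_forall_test hΩ (locallyIntegrableOn_of_memLp (hg.sub hg'))
    fun φ hφ hc hs => by
      simp only [Pi.sub_apply, mul_sub]
      rw [integral_sub (integrable_ofReal_mul hg hφ.continuous hc)
        (integrable_ofReal_mul hg' hφ.continuous hc), sub_eq_zero]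
      exact neg_injective ((h φ hφ hc hs).symm.trans (h' φ hφ hc hs))
  filter_upwards [h0] with x hx
  exact sub_eq_zero.1 hx

theorem memLp_weakDeriv (u : ℝ → ℂ) : MemLp (weakDeriv Ω u) 2 (volume.restrict Ω) := by
  unfold weakDeriv
  split_ifs with h
  · exact h.choose_spec.1
  · exact MemLp.zero

theorem MemH1.hasWeakDeriv {u : ℝ → ℂ} (h : MemH1 Ω u) : HasWeakDeriv Ω u (weakDeriv Ω u) := by
  unfold weakDeriv
  rw [dif_pos h.2]
  exact h.2.choose_spec.2

theorem weakDeriv_ae_eq (hΩ : IsOpen Ω) {u g : ℝ → ℂ} (hg : MemLp g 2 (volume.restrict Ω))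
    (h : HasWeakDeriv Ω u g) : weakDeriv Ω u =ᵐ[volume.restrict Ω] g := by
  have h2 : HasL2WeakDeriv Ω u := ⟨g, hg, h⟩
  refine HasWeakDeriv.unique hΩ (u := u) ?_ h (memLp_weakDeriv u) hg
  unfold weakDeriv
  rw [dif_pos h2]
  exact h2.choose_spec.2

theorem MemH1.congr {u u' : ℝ → ℂ} (h : MemH1 Ω u) (hu : u =ᵐ[volume.restrict Ω] u') :
    MemH1 Ω u' :=
  ⟨h.1.ae_eq hu, weakDeriv Ω u, memLp_weakDeriv u, h.hasWeakDeriv.congr hu ae_eq_rfl⟩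

theorem MemH1.add {u u' : ℝ → ℂ} (h : MemH1 Ω u) (h' : MemH1 Ω u') : MemH1 Ω (u + u') :=
  ⟨h.1.add h'.1, _, (memLp_weakDeriv u).add (memLp_weakDeriv u'),
    h.hasWeakDeriv.add h'.hasWeakDeriv h.1 h'.1 (memLp_weakDeriv u) (memLp_weakDeriv u')⟩

theorem MemH1.const_smul {u : ℝ → ℂ} (h : MemH1 Ω u) (c : ℂ) : MemH1 Ω (c • u) :=
  ⟨h.1.const_smul c, _, (memLp_weakDeriv u).const_smul c, h.hasWeakDeriv.const_smul c⟩

theorem hasWeakDeriv_zero : HasWeakDeriv Ω 0 0 := by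
  intro φ _ _ _
  simp

theorem memH1_zero : MemH1 Ω 0 := ⟨MemLp.zero, 0, MemLp.zero, hasWeakDeriv_zero⟩

/-- A compactly supported smooth function with vanishing integral is the derivative of a test
function. -/
theorem exists_test_deriv_eq (hU : IsUpperSet Ω) {θ : ℝ → ℝ} (hθ : ContDiff ℝ (⊤ : ℕ∞) θ)
    (hc : HasCompactSupport θ) (hs : tsupport θ ⊆ Ω) (h0 : ∫ x, θ x = 0) :
    ∃ ψ : ℝ → ℝ, ContDiff ℝ (⊤ : ℕ∞) ψ ∧ HasCompactSupport ψ ∧ tsupport ψ ⊆ Ω ∧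
      deriv ψ = θ := by
  rcases (tsupport θ).eq_empty_or_nonempty with hemp | hne
  · have hz : θ = 0 := tsupport_eq_empty_iff.1 hemp
    refine ⟨0, contDiff_const, HasCompactSupport.zero, by simp, ?_⟩
    rw [hz]
    exact deriv_const' 0
  have hK : IsCompact (tsupport θ) := hc
  set m := sInf (tsupport θ) with hm
  set M := sSup (tsupport θ) with hM
  have hmK : m ∈ tsupport θ := hK.sInf_mem hne
  have hsub : tsupport θ ⊆ Set.Icc m M := fun x hx =>
    ⟨csInf_le hK.bddBelow hx, le_csSup hK.bddAbove hx⟩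
  have hcont : Continuous θ := hθ.continuous
  set ψ : ℝ → ℝ := fun x => ∫ s in m..x, θ s with hψ
  have hderiv : ∀ x, HasDerivAt ψ (θ x) x := fun x => hcont.integral_hasStrictDerivAt m x |>.hasDerivAt
  have hd : deriv ψ = θ := funext fun x => (hderiv x).deriv
  have hz : ∀ x, x ∉ Set.Icc m M → θ x = 0 := fun x hx =>
    image_eq_zero_of_notMem_tsupport fun h => hx (hsub h)
  have hsupp : Function.support ψ ⊆ Set.Icc m M := by
    intro x hx
    by_contra hxI
    refine hx ?_
    rcases lt_or_ge x m with hxm | hxm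
    · change ∫ s in m..x, θ s = 0
      rw [intervalIntegral.integral_symm, neg_eq_zero]
      refine intervalIntegral.integral_zero_ae ?_
      have : ∀ᵐ y : ℝ, y ≠ m := by simp [ae_iff, measure_singleton]
      filter_upwards [this] with y hym hy
      rw [Set.uIoc_of_le hxm.le] at hy
      exact hz y fun hh => hym (le_antisymm hy.2 hh.1)
    · have hxM : M < x := by
        by_contra hh
        exact hxI ⟨hxm, not_lt.1 hh⟩
      change ∫ s in m..x, θ s = 0
      rw [← h0, intervalIntegral.integral_of_le hxm, ← integral_Icc_eq_integral_Ioc]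
      refine setIntegral_eq_integral_of_forall_compl_eq_zero fun y hy => hz y fun hh => hy ?_
      exact ⟨hh.1, hh.2.trans hxM.le⟩
  have htsupp : tsupport ψ ⊆ Set.Icc m M := closure_minimal hsupp isClosed_Icc
  -- The primitive lives on the whole interval [m, M], which may be larger than the support of θ. It
  -- stays in Ω because m ∈ Ω and Ω is an upper set; both the half-line and the line are of this
  -- type.
  refine ⟨ψ, ?_, HasCompactSupport.of_support_subset_isCompact isCompact_Icc hsupp,
    fun x hx => hU (htsupp hx).1 (hs hmK), hd⟩
  exact contDiff_infty_iff_deriv.2 ⟨fun x => (hderiv x).differentiableAt, by rw [hd]; exact hθ⟩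

/-- The du Bois-Reymond lemma. -/
theorem exists_ae_eq_const (hΩ : IsOpen Ω) (hU : IsUpperSet Ω) {f : ℝ → ℂ}
    (hf : LocallyIntegrableOn f Ω)
    (h : ∀ φ : ℝ → ℝ, ContDiff ℝ (⊤ : ℕ∞) φ → HasCompactSupport φ → tsupport φ ⊆ Ω →
      ∫ x in Ω, ((deriv φ x : ℝ) : ℂ) * f x = 0) :
    ∃ c : ℂ, f =ᵐ[volume.restrict Ω] fun _ => c := by
  rcases Ω.eq_empty_or_nonempty with rfl | ⟨x₀, hx₀⟩
  · exact ⟨0, by simp [EventuallyEq]⟩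
  have hint : ∀ φ : ℝ → ℝ, Continuous φ → HasCompactSupport φ → tsupport φ ⊆ Ω →
      ∀ f : ℝ → ℂ, LocallyIntegrableOn f Ω →
      Integrable (fun x => (φ x : ℂ) * f x) (volume.restrict Ω) := by
    intro φ hφ hc hs f hf
    have h1 : IntegrableOn (fun x => (φ x : ℂ) * f x) (tsupport φ) := by
      have := (hf.integrableOn_compact_subset hs hc).continuousOn_smul
        (g := f) hφ.continuousOn hc
      simpa only [Complex.real_smul] using this
    rw [← integrableOn_iff_integrable_of_support_subset (s := tsupport φ)] at *
    · exact h1.mono_measure Measure.restrict_le_self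
    · intro x hx
      exact subset_tsupport φ fun h0 => hx (by simp [h0])
  obtain ⟨r, hr, hball⟩ := Metric.isOpen_iff.1 hΩ x₀ hx₀
  let b : ContDiffBump x₀ := ⟨r / 4, r / 2, by positivity, by linarith⟩
  set η : ℝ → ℝ := b.normed volume with hη
  have hη1 : ContDiff ℝ (⊤ : ℕ∞) η := b.contDiff_normed
  have hηc : HasCompactSupport η := b.hasCompactSupport_normed
  have hηs : tsupport η ⊆ Ω := by
    rw [hη, b.tsupport_normed_eq]
    refine (Metric.closedBall_subset_ball ?_).trans hball
    change r / 2 < r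
    linarith
  have hηi : ∫ x, η x = 1 := b.integral_normed
  refine ⟨∫ x in Ω, (η x : ℂ) * f x, ?_⟩
  set c := ∫ x in Ω, (η x : ℂ) * f x with hcdef
  have hcl : LocallyIntegrableOn (fun _ : ℝ => c) Ω :=
    (locallyIntegrable_const c).locallyIntegrableOn Ω
  have h0 := ae_eq_zero_of_forall_test hΩ (f := fun x => f x - c) (hf.sub hcl)
    fun φ hφ hφc hφs => by
      set I := ∫ x, φ x with hI
      -- Subtracting a multiple of the unit-mass bump removes the integral, so θ is the derivative
      -- of a test function and ∫ θ f = 0. Hence ∫ φ f = I ∫ η f = I c.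
      set θ : ℝ → ℝ := fun x => φ x - I * η x with hθ
      have hsupp : Function.support θ ⊆ tsupport φ ∪ tsupport η := by
        intro x hx
        by_contra hh
        rw [Set.mem_union, not_or] at hh
        exact hx (by simp [hθ, image_eq_zero_of_notMem_tsupport hh.1,
          image_eq_zero_of_notMem_tsupport hh.2])
      have hcl' : IsCompact (tsupport φ ∪ tsupport η) := IsCompact.union hφc hηc
      obtain ⟨ψ, hψ, hψc, hψs, hψd⟩ := exists_test_deriv_eq hU (θ := θ)
        (hφ.sub (contDiff_const.mul hη1))
        (HasCompactSupport.of_support_subset_isCompact hcl' hsupp)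
        ((closure_minimal hsupp hcl'.isClosed).trans (Set.union_subset hφs hηs))
        (by
          rw [integral_sub (hφ.continuous.integrable_of_hasCompactSupport hφc)
            ((hη1.continuous.integrable_of_hasCompactSupport hηc).const_mul I),
            integral_const_mul, hηi, mul_one, sub_self])
      have h1 := h ψ hψ hψc hψs
      rw [hψd] at h1
      simp only [hθ, Complex.ofReal_sub, Complex.ofReal_mul, sub_mul, mul_assoc] at h1
      rw [integral_sub (hint φ hφ.continuous hφc hφs f hf)
        ((hint η hη1.continuous hηc hηs f hf).const_mul _), integral_const_mul, ← hcdef] at h1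
      simp only [mul_sub]
      rw [integral_sub (hint φ hφ.continuous hφc hφs f hf)
        (hint φ hφ.continuous hφc hφs _ hcl), integral_mul_const]
      have h2 : ∫ x in Ω, (φ x : ℂ) = I := by
        have := setIntegral_eq_of_tsupport_subset hφs (fun _ => (1 : ℂ))
        simp only [mul_one] at this
        rw [this]
        exact integral_ofReal
      rw [h2]
      exact h1
  filter_upwards [h0] with x hx
  exact sub_eq_zero.1 hx

end Sobolev

/-! ### Continuous representatives, Sobolev inequality and boundary values -/

section Representative

variable {Ω : Set ℝ}

/-- The right end is moved beyond the support of φ, so only the boundary term at `a` survives. For a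
= 0 this is the vertex term that later has to cancel. -/
theorem integral_Ioi_deriv_mul_primitive {G w : ℝ → ℂ} (hG : LocallyIntegrable G)
    (hw : ∀ a b, w b - w a = ∫ s in a..b, G s) {φ : ℝ → ℝ} (hφ : ContDiff ℝ 1 φ)
    (hc : HasCompactSupport φ) (a : ℝ) :
    ∫ x in Set.Ioi a, ((deriv φ x : ℝ) : ℂ) * w x
      = -(φ a * w a) - ∫ x in Set.Ioi a, (φ x : ℂ) * G x := by
  obtain ⟨b₀, hb₀⟩ := IsCompact.bddAbove hc
  set b := max a b₀ + 1 with hb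
  have hab : a ≤ b := by linarith [le_max_left a b₀]
  have hb0 : b₀ < b := by linarith [le_max_right a b₀]
  have hout : ∀ x, b ≤ x → x ∉ tsupport φ := fun x hx h => by linarith [hb₀ h]
  have hset : ∀ (ψ : ℝ → ℝ) (f : ℝ → ℂ), (∀ x, x ∉ tsupport φ → ψ x = 0) →
      ∫ x in Set.Ioi a, (ψ x : ℂ) * f x = ∫ x in a..b, (ψ x : ℂ) * f x := by
    intro ψ f hψ
    rw [intervalIntegral.integral_of_le hab]
    refine setIntegral_eq_of_subset_of_forall_sdiff_eq_zero measurableSet_Ioi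
      (fun x hx => hx.1) fun x hx => ?_
    have : b ≤ x := by
      by_contra hh
      exact hx.2 ⟨hx.1, (not_le.1 hh).le⟩
    rw [hψ x (hout x this)]
    simp
  rw [hset _ _ fun x hx => image_eq_zero_of_notMem_tsupport fun h => hx (tsupport_deriv_subset h),
    hset _ _ fun x hx => image_eq_zero_of_notMem_tsupport hx,
    integral_deriv_mul_primitive hG hw hφ, image_eq_zero_of_notMem_tsupport (hout b le_rfl)]
  simp

theorem integral_deriv_mul_primitive_of_hasCompactSupport {G w : ℝ → ℂ}
    (hG : LocallyIntegrable G) (hw : ∀ a b, w b - w a = ∫ s in a..b, G s) {φ : ℝ → ℝ}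
    (hφ : ContDiff ℝ 1 φ) (hc : HasCompactSupport φ) :
    ∫ x, ((deriv φ x : ℝ) : ℂ) * w x = -∫ x, (φ x : ℂ) * G x := by
  obtain ⟨a₀, ha₀⟩ := IsCompact.bddBelow hc
  have hout : ∀ x, x ≤ a₀ - 1 → x ∉ tsupport φ := fun x hx h => by linarith [ha₀ h]
  have hset : ∀ (ψ : ℝ → ℝ) (f : ℝ → ℂ), (∀ x, x ∉ tsupport φ → ψ x = 0) →
      ∫ x in Set.Ioi (a₀ - 1), (ψ x : ℂ) * f x = ∫ x, (ψ x : ℂ) * f x := fun ψ f hψ =>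
    setIntegral_eq_integral_of_forall_compl_eq_zero fun x hx => by
      rw [hψ x (hout x (not_lt.1 hx))]; simp
  have h := integral_Ioi_deriv_mul_primitive hG hw hφ hc (a₀ - 1)
  rw [hset _ _ fun x hx => image_eq_zero_of_notMem_tsupport fun h => hx (tsupport_deriv_subset h),
    hset _ _ fun x hx => image_eq_zero_of_notMem_tsupport hx,
    image_eq_zero_of_notMem_tsupport (hout _ le_rfl)] at h
  simpa using h

/-- `w` is the continuous representative on `Ω` of the function `u` with weak derivative `g`. -/
structure IsRep (Ω : Set ℝ) (u g w : ℝ → ℂ) : Prop where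
  ae_eq : w =ᵐ[volume.restrict Ω] u
  sub_eq : ∀ a b, w b - w a = ∫ s in a..b, Ω.indicator g s

/-- The difference of u and a primitive of g has vanishing weak derivative, hence is constant by the
du Bois-Reymond lemma. Extending g by zero makes the primitive continuous on all of ℝ, so that it
has a value at the boundary point. -/
theorem exists_isRep (hΩ : IsOpen Ω) (hU : IsUpperSet Ω) {u g : ℝ → ℂ}
    (hu : MemLp u 2 (volume.restrict Ω)) (hg : MemLp g 2 (volume.restrict Ω))
    (h : HasWeakDeriv Ω u g) : ∃ w, IsRep Ω u g w := by
  have hG := locallyIntegrable_indicator hΩ hg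
  have hGi := intervalIntegrable_of_locallyIntegrable hG
  set P : ℝ → ℂ := fun x => ∫ s in (0 : ℝ)..x, Ω.indicator g s with hP
  have hPsub : ∀ a b, P b - P a = ∫ s in a..b, Ω.indicator g s := fun a b =>
    intervalIntegral.integral_interval_sub_left (hGi 0 b) (hGi 0 a)
  have hPc : Continuous P := intervalIntegral.continuous_primitive hGi 0
  obtain ⟨c, hc⟩ := exists_ae_eq_const hΩ hU (f := fun x => u x - P x)
    ((locallyIntegrableOn_of_memLp hu).sub (hPc.locallyIntegrable.locallyIntegrableOn Ω))
    fun φ hφ hφc hφs => by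
      have hd : Continuous (deriv φ) := hφ.continuous_deriv (by simp)
      simp only [mul_sub]
      rw [integral_sub (integrable_ofReal_mul hu hd hφc.deriv), h φ hφ hφc hφs,
        setIntegral_eq_of_tsupport_subset (tsupport_deriv_subset.trans hφs),
        integral_deriv_mul_primitive_of_hasCompactSupport hG hPsub (hφ.of_le (by simp)) hφc,
        ← setIntegral_eq_of_tsupport_subset hφs, sub_neg_eq_add, neg_add_eq_zero]
      · refine setIntegral_congr_fun hΩ.measurableSet fun x hx => ?_
        simp only [Set.indicator_of_mem hx]
      · exact ((Complex.continuous_ofReal.comp hd).mul hPc).integrable_of_hasCompactSupport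
          (HasCompactSupport.mul_right (hφc.deriv.comp_left (g := fun r : ℝ => (r : ℂ)) rfl))
          |>.restrict
  refine ⟨fun x => P x + c, ?_, fun a b => ?_⟩
  · filter_upwards [hc] with x hx
    rw [← hx]
    ring
  · rw [← hPsub a b]
    ring

theorem MemH1.exists_isRep (hΩ : IsOpen Ω) (hU : IsUpperSet Ω) {u : ℝ → ℂ} (h : MemH1 Ω u) :
    ∃ w, IsRep Ω u (weakDeriv Ω u) w :=
  StarLT.exists_isRep hΩ hU h.1 (memLp_weakDeriv u) h.hasWeakDeriv

namespace IsRep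

variable {u g w : ℝ → ℂ}

theorem continuous (hΩ : IsOpen Ω) (hg : MemLp g 2 (volume.restrict Ω)) (h : IsRep Ω u g w) :
    Continuous w := by
  have : w = fun x => w 0 + ∫ s in (0 : ℝ)..x, Ω.indicator g s :=
    funext fun x => by rw [← h.sub_eq 0 x]; ring
  rw [this]
  exact continuous_const.add (intervalIntegral.continuous_primitive
    (intervalIntegrable_of_locallyIntegrable (locallyIntegrable_indicator hΩ hg)) 0)

end IsRep

/-- The kernel that averages over an interval of length `ℓ` to the right of `x`. -/
def averageKernel (x ℓ : ℝ) : ℝ → ℝ := (Set.Ioc x (x + ℓ)).indicator fun _ => ℓ⁻¹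

/-- The kernel that recovers, from the derivative, the difference between the value at `x` and
the average. -/
def slopeKernel (x ℓ : ℝ) : ℝ → ℝ := (Set.Ioc x (x + ℓ)).indicator fun s => ℓ⁻¹ * (s - (x + ℓ))

theorem memLp_averageKernel (x ℓ : ℝ) (μ : Measure ℝ) [IsLocallyFiniteMeasure μ] :
    MemLp (fun s => (averageKernel x ℓ s : ℂ)) 2 μ := by
  have h : MemLp (averageKernel x ℓ) 2 μ :=
    memLp_indicator_const 2 measurableSet_Ioc _ (Or.inr measure_Ioc_lt_top.ne)
  exact h.ofReal

theorem abs_slopeKernel_le {ℓ : ℝ} (hℓ : 0 < ℓ) (x s : ℝ) :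
    |slopeKernel x ℓ s| ≤ (Set.Ioc x (x + ℓ)).indicator (fun _ => (1 : ℝ)) s := by
  unfold slopeKernel
  by_cases hs : s ∈ Set.Ioc x (x + ℓ)
  · rw [Set.indicator_of_mem hs, Set.indicator_of_mem hs, abs_mul, abs_of_pos (inv_pos.2 hℓ),
      inv_mul_le_iff₀ hℓ, mul_one, abs_le]
    constructor <;> linarith [hs.1, hs.2]
  · rw [Set.indicator_of_notMem hs, Set.indicator_of_notMem hs, abs_zero]

theorem memLp_slopeKernel {ℓ : ℝ} (hℓ : 0 < ℓ) (x : ℝ) (μ : Measure ℝ)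
    [IsLocallyFiniteMeasure μ] : MemLp (fun s => (slopeKernel x ℓ s : ℂ)) 2 μ := by
  have h : MemLp ((Set.Ioc x (x + ℓ)).indicator fun _ => (1 : ℝ)) 2 μ :=
    memLp_indicator_const 2 measurableSet_Ioc _ (Or.inr measure_Ioc_lt_top.ne)
  have h2 : MemLp (slopeKernel x ℓ) 2 μ := by
    refine h.mono' ?_ (ae_of_all _ fun s => abs_slopeKernel_le hℓ x s)
    have : Measurable (slopeKernel x ℓ) :=
      Measurable.indicator (by fun_prop) measurableSet_Ioc
    exact this.aestronglyMeasurable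
  exact h2.ofReal

namespace IsRep

variable {u g w : ℝ → ℂ}

theorem setIntegral_indicator_mul {I : Set ℝ} (hI : MeasurableSet I) (hIΩ : I ⊆ Ω)
    (k : ℝ → ℝ) (f : ℝ → ℂ) :
    ∫ s in Ω, ((I.indicator k s : ℝ) : ℂ) * f s = ∫ s in I, (k s : ℂ) * f s := by
  have : (fun s => ((I.indicator k s : ℝ) : ℂ) * f s) = I.indicator fun s => (k s : ℂ) * f s := by
    funext s
    by_cases hs : s ∈ I <;> simp [hs]
  rw [this, setIntegral_indicator hI, Set.inter_eq_self_of_subset_right hIΩ]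

/-- A value of the continuous representative, in terms of integrals. -/
theorem eq_integral (hΩ : IsOpen Ω) (hg : MemLp g 2 (volume.restrict Ω)) (h : IsRep Ω u g w)
    {x : ℝ} (hx : Set.Ioi x ⊆ Ω) {ℓ : ℝ} (hℓ : 0 < ℓ) :
    w x = (∫ s in Ω, (averageKernel x ℓ s : ℂ) * u s)
      + ∫ s in Ω, (slopeKernel x ℓ s : ℂ) * g s := by
  have hI : Set.Ioc x (x + ℓ) ⊆ Ω := fun s hs => hx hs.1
  -- This weight has slope ℓ⁻¹, vanishes at x + ℓ and equals −1 at x, so integration by parts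
  -- isolates w(x).
  have h1 := integral_deriv_mul_primitive (locallyIntegrable_indicator hΩ hg) h.sub_eq
    (φ := fun s => ℓ⁻¹ * (s - (x + ℓ))) (by fun_prop) x (x + ℓ)
  have hd : ∀ s, deriv (fun s => ℓ⁻¹ * (s - (x + ℓ))) s = ℓ⁻¹ := fun s => by simp
  simp only [hd] at h1
  rw [intervalIntegral.integral_of_le (by linarith), intervalIntegral.integral_of_le (by linarith)]
    at h1
  have h2 : ∫ s in Set.Ioc x (x + ℓ), ((ℓ⁻¹ : ℝ) : ℂ) * w s
      = ∫ s in Set.Ioc x (x + ℓ), ((ℓ⁻¹ : ℝ) : ℂ) * u s :=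
    integral_congr_ae ((ae_restrict_of_ae_restrict_of_subset hI h.ae_eq).mono fun s hs => by
      simp only [hs])
  have h3 : ∫ s in Set.Ioc x (x + ℓ), ((ℓ⁻¹ * (s - (x + ℓ)) : ℝ) : ℂ) * Ω.indicator g s
      = ∫ s in Set.Ioc x (x + ℓ), ((ℓ⁻¹ * (s - (x + ℓ)) : ℝ) : ℂ) * g s :=
    setIntegral_congr_fun measurableSet_Ioc fun s hs => by
      simp only [Set.indicator_of_mem (hI hs)]
  unfold averageKernel slopeKernel
  rw [setIntegral_indicator_mul measurableSet_Ioc hI,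
    setIntegral_indicator_mul measurableSet_Ioc hI, ← h2, ← h3, h1]
  have : ℓ⁻¹ * (x - (x + ℓ)) = -1 := by field_simp; ring
  rw [this]
  simp

/-- Cauchy–Schwarz on an interval of length ℓ, read off from the nonnegativity of ∫ (‖f‖ − A/ℓ)²,
where A/ℓ is the mean of ‖f‖. -/
theorem integral_norm_sq_le {f : ℝ → ℂ} (hf : MemLp f 2 (volume.restrict Ω)) {x ℓ : ℝ}
    (hℓ : 0 < ℓ) (hI : Set.Ioc x (x + ℓ) ⊆ Ω) :
    (∫ s in Set.Ioc x (x + ℓ), ‖f s‖) ^ 2 ≤ ℓ * ∫ s in Ω, ‖f s‖ ^ 2 := by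
  have hf2 : Integrable (fun s => ‖f s‖ ^ 2) (volume.restrict Ω) := hf.integrable_norm_pow (by simp)
  have hfI : MemLp f 2 (volume.restrict (Set.Ioc x (x + ℓ))) :=
    hf.mono_measure (Measure.restrict_mono hI le_rfl)
  have hf2I : Integrable (fun s => ‖f s‖ ^ 2) (volume.restrict (Set.Ioc x (x + ℓ))) :=
    hfI.integrable_norm_pow (by simp)
  have hf1I : Integrable (fun s => ‖f s‖) (volume.restrict (Set.Ioc x (x + ℓ))) :=
    (hfI.integrable (by norm_num)).norm
  set A := ∫ s in Set.Ioc x (x + ℓ), ‖f s‖ with hA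
  set B := ∫ s in Set.Ioc x (x + ℓ), ‖f s‖ ^ 2 with hB
  have hBle : B ≤ ∫ s in Ω, ‖f s‖ ^ 2 :=
    setIntegral_mono_set hf2 (ae_of_all _ fun s => by positivity) (ae_of_all _ hI)
  have h0 : 0 ≤ ∫ s in Set.Ioc x (x + ℓ), (‖f s‖ - A / ℓ) ^ 2 :=
    integral_nonneg fun s => sq_nonneg _
  have h1 : ∫ s in Set.Ioc x (x + ℓ), (‖f s‖ - A / ℓ) ^ 2
      = B - 2 * (A / ℓ) * A + (A / ℓ) ^ 2 * ℓ := by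
    have : ∀ s, (‖f s‖ - A / ℓ) ^ 2 = ‖f s‖ ^ 2 - 2 * (A / ℓ) * ‖f s‖ + (A / ℓ) ^ 2 :=
      fun s => by ring
    simp only [this]
    rw [integral_add (f := fun s => ‖f s‖ ^ 2 - 2 * (A / ℓ) * ‖f s‖)
      (hf2I.sub (hf1I.const_mul _)) (integrable_const _), integral_sub hf2I (hf1I.const_mul _), integral_const_mul]
    simp [hℓ.le]
    ring
  rw [h1] at h0
  have h2 : B - 2 * (A / ℓ) * A + (A / ℓ) ^ 2 * ℓ = B - A ^ 2 / ℓ := by field_simp; ring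
  rw [h2, sub_nonneg, div_le_iff₀ hℓ] at h0
  nlinarith

/-- The Sobolev inequality. -/
theorem norm_sq_le (hΩ : IsOpen Ω) (hu : MemLp u 2 (volume.restrict Ω))
    (hg : MemLp g 2 (volume.restrict Ω)) (h : IsRep Ω u g w)
    {x : ℝ} (hx : Set.Ioi x ⊆ Ω) {ℓ : ℝ} (hℓ : 0 < ℓ) :
    ‖w x‖ ^ 2 ≤ 2 / ℓ * (∫ s in Ω, ‖u s‖ ^ 2) + 2 * ℓ * ∫ s in Ω, ‖g s‖ ^ 2 := by
  have hI : Set.Ioc x (x + ℓ) ⊆ Ω := fun s hs => hx hs.1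
  have hiu := integral_norm_sq_le hu hℓ hI
  have hig := integral_norm_sq_le hg hℓ hI
  set A := ∫ s in Set.Ioc x (x + ℓ), ‖u s‖ with hA
  set B := ∫ s in Set.Ioc x (x + ℓ), ‖g s‖ with hB
  have hA0 : 0 ≤ A := integral_nonneg fun s => norm_nonneg _
  have hB0 : 0 ≤ B := integral_nonneg fun s => norm_nonneg _
  have hgI : MemLp g 2 (volume.restrict (Set.Ioc x (x + ℓ))) :=
    hg.mono_measure (Measure.restrict_mono hI le_rfl)
  have h1 : ‖w x‖ ≤ ℓ⁻¹ * A + B := by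
    rw [h.eq_integral hΩ hg hx hℓ]
    refine (norm_add_le _ _).trans (add_le_add ?_ ?_)
    · unfold averageKernel
      rw [setIntegral_indicator_mul measurableSet_Ioc hI, integral_const_mul, norm_mul,
        Complex.norm_real, Real.norm_of_nonneg (inv_nonneg.2 hℓ.le)]
      exact mul_le_mul_of_nonneg_left (norm_integral_le_integral_norm _) (inv_nonneg.2 hℓ.le)
    · unfold slopeKernel
      rw [setIntegral_indicator_mul measurableSet_Ioc hI]
      refine norm_integral_le_of_norm_le ((hgI.integrable (by norm_num)).norm) ?_
      refine (ae_restrict_iff' measurableSet_Ioc).2 (ae_of_all _ fun s hs => ?_)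
      rw [norm_mul, Complex.norm_real, Real.norm_eq_abs]
      refine mul_le_of_le_one_left (norm_nonneg _) ?_
      have := abs_slopeKernel_le hℓ x s
      simpa [slopeKernel, Set.indicator_of_mem hs] using this
  have h2 : ‖w x‖ ^ 2 ≤ (ℓ⁻¹ * A + B) ^ 2 := pow_le_pow_left₀ (norm_nonneg _) h1 2
  have h3 : (ℓ⁻¹ * A + B) ^ 2 ≤ 2 * (ℓ⁻¹ ^ 2 * A ^ 2) + 2 * B ^ 2 := by
    nlinarith [sq_nonneg (ℓ⁻¹ * A - B)]
  have h4 : ℓ⁻¹ ^ 2 * A ^ 2 ≤ ℓ⁻¹ * ∫ s in Ω, ‖u s‖ ^ 2 := by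
    calc ℓ⁻¹ ^ 2 * A ^ 2 ≤ ℓ⁻¹ ^ 2 * (ℓ * ∫ s in Ω, ‖u s‖ ^ 2) := by gcongr
      _ = ℓ⁻¹ * ∫ s in Ω, ‖u s‖ ^ 2 := by field_simp
  calc ‖w x‖ ^ 2 ≤ 2 * (ℓ⁻¹ ^ 2 * A ^ 2) + 2 * B ^ 2 := h2.trans h3
    _ ≤ 2 * (ℓ⁻¹ * ∫ s in Ω, ‖u s‖ ^ 2) + 2 * (ℓ * ∫ s in Ω, ‖g s‖ ^ 2) := by gcongr
    _ = _ := by rw [div_eq_mul_inv]; ring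

theorem hasBoundaryValue (hg : MemLp g 2 (volume.restrict (Set.Ioi (0 : ℝ))))
    (h : IsRep (Set.Ioi 0) u g w) : HasBoundaryValue u (w 0) :=
  ⟨w, (h.continuous isOpen_Ioi hg).continuousOn, h.ae_eq, rfl⟩

/-- Two continuous functions on [0,∞) that agree almost everywhere agree at 0. This makes the
boundary value unique and computable from any representative. -/
theorem eq_of_hasBoundaryValue (hg : MemLp g 2 (volume.restrict (Set.Ioi (0 : ℝ))))
    (h : IsRep (Set.Ioi 0) u g w) {c : ℂ} (hc : HasBoundaryValue u c) : w 0 = c := by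
  obtain ⟨w', hw', hae, rfl⟩ := hc
  have h1 : w =ᵐ[volume.restrict (Set.Ici 0)] w' := by
    rw [← Measure.restrict_congr_set Ioi_ae_eq_Ici]
    exact h.ae_eq.trans hae.symm
  exact Measure.eqOn_of_ae_eq h1 (h.continuous isOpen_Ioi hg).continuousOn hw'
    (by simp) Set.self_mem_Ici

end IsRep

end Representative

/-! ### Weak compactness -/

/-- Sequential Banach–Alaoglu in the dual, carried over by the Riesz isomorphism. Riesz puts the
sequence in the antilinear slot, hence the final conjugation. -/
theorem exists_subseq_tendsto_inner {E : Type*} [NormedAddCommGroup E] [InnerProductSpace ℂ E]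
    [CompleteSpace E] [TopologicalSpace.SeparableSpace E] {v : ℕ → E} {r : ℝ}
    (hv : ∀ n, ‖v n‖ ≤ r) :
    ∃ (u : E) (ns : ℕ → ℕ), StrictMono ns ∧
      ∀ e : E, Tendsto (fun n => inner ℂ e (v (ns n))) atTop (𝓝 (inner ℂ e u)) := by
  have hcomp := WeakDual.isSeqCompact_closedBall ℂ E (0 : StrongDual ℂ E) r
  obtain ⟨F, -, ns, hns, hF⟩ := hcomp
    (x := fun n => StrongDual.toWeakDual (InnerProductSpace.toDual ℂ E (v n))) (fun n => by
      rw [Set.mem_preimage, mem_closedBall_zero_iff]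
      exact ((InnerProductSpace.toDual ℂ E).norm_map (v n)).trans_le (hv n))
  refine ⟨(InnerProductSpace.toDual ℂ E).symm (WeakDual.toStrongDual F), ns, hns, fun e => ?_⟩
  have h1 : Tendsto (fun n => inner ℂ (v (ns n)) e) atTop (𝓝 (F e)) :=
    ((WeakDual.eval_continuous e).tendsto F).comp hF
  have h2 : inner ℂ ((InnerProductSpace.toDual ℂ E).symm (WeakDual.toStrongDual F)) e = F e := by
    rw [InnerProductSpace.toDual_symm_apply]
    rfl
  rw [← h2] at h1
  have h3 := (Complex.continuous_conj.tendsto _).comp h1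
  rw [inner_conj_symm] at h3
  exact h3.congr fun n => inner_conj_symm _ _

/-! ### Schrödinger forms on one edge -/

section Edge

/-- The form domain on one edge `Ω`, without a boundary condition. -/
def edgeDomain (Ω : Set ℝ) (μ : Measure ℝ) (V : ℝ → ℝ) : Set (Lp ℂ 2 μ) :=
  {u | MemH1 Ω u ∧ Integrable (fun x => max (V x) 0 * ‖u x‖ ^ 2) μ}

/-- The Schrödinger form on one edge. -/
def edgeForm (Ω : Set ℝ) (μ : Measure ℝ) (V : ℝ → ℝ) (v u : Lp ℂ 2 μ) : ℂ :=
  ∫ x, (starRingEnd ℂ (weakDeriv Ω v x) * weakDeriv Ω u x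
    + (V x : ℂ) * (starRingEnd ℂ (v x) * u x)) ∂μ

/-- The potential is measurable, and its negative part is, up to arbitrarily small bounded
errors, integrable. -/
structure IsEdgePotential (μ : Measure ℝ) (V : ℝ → ℝ) : Prop where
  aestronglyMeasurable : AEStronglyMeasurable V μ
  exists_le : ∀ δ > 0, ∃ W : ℝ → ℝ, Integrable W μ ∧ (∀ x, 0 ≤ W x) ∧
    (∀ x, W x ≤ max (-V x) 0) ∧ ∀ x, max (-V x) 0 ≤ δ + W x

/-- Keep V₋ only where it exceeds δ. There V₋ ≤ δ^(1−p) V₋^p because p ≥ 1, so the kept part is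
integrable. With p = γ + 1/2 this is the role of γ ≥ 1/2. -/
theorem isEdgePotential_of_memLp {μ : Measure ℝ} {V : ℝ → ℝ} {p : ℝ} (hp : 1 ≤ p)
    (hV : AEStronglyMeasurable (fun x => max (V x) 0) μ)
    (hV' : MemLp (fun x => max (-V x) 0) (ENNReal.ofReal p) μ) : IsEdgePotential μ V := by
  refine ⟨?_, fun δ hδ => ?_⟩
  · have h := hV.sub hV'.1
    refine h.congr (ae_of_all _ fun x => ?_)
    simp only [Pi.sub_apply]
    rcases le_total 0 (V x) with h0 | h0
    · rw [max_eq_left h0, max_eq_right (by linarith), sub_zero]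
    · rw [max_eq_right h0, max_eq_left (by linarith)]; ring
  · obtain ⟨f, hf⟩ : ∃ f : ℝ → ℝ, f = fun x => max (-V x) 0 := ⟨_, rfl⟩
    have hf0 : ∀ x, 0 ≤ f x := fun x => by rw [hf]; exact le_max_right _ _
    change MemLp (fun x => max (-V x) 0) _ _ at hV'
    rw [← hf] at hV'
    have hp0 : 0 < p := by linarith
    have hint : Integrable (fun x => f x ^ p) μ := by
      have := hV'.integrable_norm_rpow (by simpa using hp0) (by simp)
      rw [ENNReal.toReal_ofReal hp0.le] at this
      refine this.congr (ae_of_all _ fun x => ?_)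
      simp only [Real.norm_of_nonneg (hf0 x)]
    set W : ℝ → ℝ := fun x => if δ < f x then f x else 0 with hW
    have hWm : AEStronglyMeasurable W μ := by
      have hm : Measurable fun y : ℝ => if δ < y then y else 0 :=
        Measurable.ite measurableSet_Ioi measurable_id measurable_const
      exact (hm.comp_aemeasurable hV'.1.aemeasurable).aestronglyMeasurable
    refine ⟨W, ?_, fun x => ?_, fun x => ?_, fun x => ?_⟩
    · refine (hint.const_mul (δ ^ (1 - p))).mono' hWm (ae_of_all _ fun x => ?_)
      by_cases hx : δ < f x
      · have hfx : 0 < f x := hδ.trans hx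
        simp only [hW, hx, if_true]
        rw [Real.norm_of_nonneg hfx.le]
        have h1 : f x ^ (1 - p) ≤ δ ^ (1 - p) :=
          Real.rpow_le_rpow_of_nonpos hδ hx.le (by linarith)
        calc f x = f x ^ (1 - p) * f x ^ p := by
              rw [← Real.rpow_add hfx]; simp
          _ ≤ _ := mul_le_mul_of_nonneg_right h1 (Real.rpow_nonneg hfx.le _)
      · simp only [hW, hx, if_false, norm_zero]
        exact mul_nonneg (Real.rpow_nonneg hδ.le _) (Real.rpow_nonneg (hf0 x) _)
    · simp only [hW]
      split_ifs
      · exact hf0 x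
      · exact le_rfl
    · rw [show max (-V x) 0 = f x by rw [hf]]
      simp only [hW]
      split_ifs
      · exact le_rfl
      · exact hf0 x
    · rw [show max (-V x) 0 = f x by rw [hf]]
      simp only [hW]
      split_ifs with h
      · linarith
      · linarith

theorem norm_sq_eq_integral {μ : Measure ℝ} (f : Lp ℂ 2 μ) : ‖f‖ ^ 2 = ∫ x, ‖f x‖ ^ 2 ∂μ := by
  have h1 : ((‖f‖ ^ 2 : ℝ) : ℂ) = ∫ x, ((‖f x‖ ^ 2 : ℝ) : ℂ) ∂μ := by
    rw [Complex.ofReal_pow]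
    refine (inner_self_eq_norm_sq_to_K (𝕜 := ℂ) f).symm.trans ?_
    rw [L2.inner_def]
    refine integral_congr_ae (ae_of_all _ fun x => ?_)
    simp only [Complex.ofReal_pow]
    exact inner_self_eq_norm_sq_to_K (𝕜 := ℂ) (f x)
  rw [integral_complex_ofReal] at h1
  exact_mod_cast h1

variable {Ω : Set ℝ} {μ : Measure ℝ}

/-- The measure is a variable with an equation so that on the line it can be `volume` itself, as in
the definition of `LineL2`, and not `volume.restrict Set.univ`. -/
theorem memLp_weakDeriv_of_eq (hμ : μ = volume.restrict Ω) (u : ℝ → ℂ) :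
    MemLp (weakDeriv Ω u) 2 μ := by
  subst hμ
  exact memLp_weakDeriv u

/-- The weak derivative as an element of `L²`. -/
def derivLp (hμ : μ = volume.restrict Ω) (u : Lp ℂ 2 μ) : Lp ℂ 2 μ :=
  MemLp.toLp (weakDeriv Ω u) (memLp_weakDeriv_of_eq hμ u)

theorem coeFn_derivLp (hμ : μ = volume.restrict Ω) (u : Lp ℂ 2 μ) :
    derivLp hμ u =ᵐ[μ] weakDeriv Ω u :=
  MemLp.coeFn_toLp _

theorem norm_derivLp_sq (hμ : μ = volume.restrict Ω) (u : Lp ℂ 2 μ) :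
    ‖derivLp hμ u‖ ^ 2 = ∫ x, ‖weakDeriv Ω u x‖ ^ 2 ∂μ := by
  rw [norm_sq_eq_integral]
  exact integral_congr_ae ((coeFn_derivLp hμ u).mono fun x hx => by simp only [hx])

theorem norm_sq_le_ae (hΩ : IsOpen Ω) (hU : IsUpperSet Ω) (hμ : μ = volume.restrict Ω)
    {u : Lp ℂ 2 μ} (hu : MemH1 Ω u) {ℓ : ℝ} (hℓ : 0 < ℓ) :
    ∀ᵐ x ∂μ, ‖u x‖ ^ 2 ≤ 2 / ℓ * ‖u‖ ^ 2 + 2 * ℓ * ‖derivLp hμ u‖ ^ 2 := by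
  obtain ⟨w, hw⟩ := hu.exists_isRep hΩ hU
  rw [norm_derivLp_sq, norm_sq_eq_integral u]
  subst hμ
  filter_upwards [hw.ae_eq, ae_restrict_mem hΩ.measurableSet] with x hx hxΩ
  rw [← hx]
  exact hw.norm_sq_le hΩ hu.1 (memLp_weakDeriv _) (fun y hy => hU (le_of_lt hy) hxΩ) hℓ

theorem integrable_norm_sq (f : Lp ℂ 2 μ) : Integrable (fun x => ‖f x‖ ^ 2) μ :=
  (Lp.memLp f).integrable_norm_pow (by simp)

/-- Products of an integrable function with the square of a Sobolev function. -/
theorem integrable_mul_norm_sq (hΩ : IsOpen Ω) (hU : IsUpperSet Ω) (hμ : μ = volume.restrict Ω)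
    {u : Lp ℂ 2 μ} (hu : MemH1 Ω u) {W : ℝ → ℝ} (hW : Integrable W μ) :
    Integrable (fun x => W x * ‖u x‖ ^ 2) μ := by
  refine hW.mul_bdd (c := 2 / 1 * ‖u‖ ^ 2 + 2 * 1 * ‖derivLp hμ u‖ ^ 2)
    ((Lp.aestronglyMeasurable u).norm.pow 2) ?_
  filter_upwards [norm_sq_le_ae hΩ hU hμ hu one_pos] with x hx
  rwa [Real.norm_of_nonneg (by positivity)]

theorem integral_mul_norm_sq_le (hΩ : IsOpen Ω) (hU : IsUpperSet Ω)
    (hμ : μ = volume.restrict Ω) {u : Lp ℂ 2 μ} (hu : MemH1 Ω u) {W : ℝ → ℝ}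
    (hW : Integrable W μ) (hW0 : ∀ x, 0 ≤ W x) {ℓ : ℝ} (hℓ : 0 < ℓ) :
    ∫ x, W x * ‖u x‖ ^ 2 ∂μ
      ≤ (∫ x, W x ∂μ) * (2 / ℓ * ‖u‖ ^ 2 + 2 * ℓ * ‖derivLp hμ u‖ ^ 2) := by
  rw [← integral_mul_const]
  refine integral_mono_ae (integrable_mul_norm_sq hΩ hU hμ hu hW) (hW.mul_const _) ?_
  filter_upwards [norm_sq_le_ae hΩ hU hμ hu hℓ] with x hx
  exact mul_le_mul_of_nonneg_left hx (hW0 x)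

theorem aestronglyMeasurable_negPart {V : ℝ → ℝ} (hV : IsEdgePotential μ V) :
    AEStronglyMeasurable (fun x => max (-V x) 0) μ :=
  hV.aestronglyMeasurable.neg.sup aestronglyMeasurable_const

theorem integrable_negPart_mul (hΩ : IsOpen Ω) (hU : IsUpperSet Ω) (hμ : μ = volume.restrict Ω)
    {V : ℝ → ℝ} (hV : IsEdgePotential μ V) {u : Lp ℂ 2 μ} (hu : MemH1 Ω u) :
    Integrable (fun x => max (-V x) 0 * ‖u x‖ ^ 2) μ := by
  obtain ⟨W, hW, -, -, hle⟩ := hV.exists_le 1 one_pos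
  refine ((integrable_norm_sq u).add (integrable_mul_norm_sq hΩ hU hμ hu hW)).mono'
    ((aestronglyMeasurable_negPart hV).mul ((Lp.aestronglyMeasurable u).norm.pow 2))
    (ae_of_all _ fun x => ?_)
  rw [Real.norm_of_nonneg (mul_nonneg (le_max_right _ _) (by positivity))]
  simp only [Pi.add_apply]
  nlinarith [hle x, sq_nonneg ‖u x‖]

theorem integral_negPart_mul_le (hΩ : IsOpen Ω) (hU : IsUpperSet Ω)
    (hμ : μ = volume.restrict Ω) {V : ℝ → ℝ} (hV : IsEdgePotential μ V) {u : Lp ℂ 2 μ}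
    (hu : MemH1 Ω u) {δ : ℝ} {W : ℝ → ℝ} (hW : Integrable W μ)
    (hle : ∀ x, max (-V x) 0 ≤ δ + W x) :
    ∫ x, max (-V x) 0 * ‖u x‖ ^ 2 ∂μ ≤ δ * ‖u‖ ^ 2 + ∫ x, W x * ‖u x‖ ^ 2 ∂μ := by
  rw [norm_sq_eq_integral, ← integral_const_mul, ← integral_add
    ((integrable_norm_sq u).const_mul δ) (integrable_mul_norm_sq hΩ hU hμ hu hW)]
  refine integral_mono (integrable_negPart_mul hΩ hU hμ hV hu)
    (((integrable_norm_sq u).const_mul δ).add (integrable_mul_norm_sq hΩ hU hμ hu hW))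
    fun x => ?_
  nlinarith [hle x, sq_nonneg ‖u x‖]

/-- The negative part of the potential is form bounded with respect to the kinetic energy. -/
theorem exists_integral_negPart_le (hΩ : IsOpen Ω) (hU : IsUpperSet Ω)
    (hμ : μ = volume.restrict Ω) {V : ℝ → ℝ} (hV : IsEdgePotential μ V) :
    ∃ C : ℝ, 0 ≤ C ∧ ∀ u : Lp ℂ 2 μ, MemH1 Ω u →
      ∫ x, max (-V x) 0 * ‖u x‖ ^ 2 ∂μ ≤ 1 / 2 * ‖derivLp hμ u‖ ^ 2 + C * ‖u‖ ^ 2 := by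
  obtain ⟨W, hW, hW0, -, hle⟩ := hV.exists_le 1 one_pos
  set A := ∫ x, W x ∂μ with hA
  have hA0 : 0 ≤ A := integral_nonneg hW0
  -- A short averaging length makes the derivative coefficient A · 2ℓ at most 1/2, at the price of a
  -- large constant in front of ‖u‖².
  set ℓ := 1 / (4 * (A + 1)) with hℓ
  have hℓ0 : 0 < ℓ := by positivity
  refine ⟨1 + A * (2 / ℓ), by positivity, fun u hu => ?_⟩
  have h1 := integral_negPart_mul_le hΩ hU hμ hV hu hW hle
  have h2 := integral_mul_norm_sq_le hΩ hU hμ hu hW hW0 hℓ0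
  have h3 : A * (2 * ℓ) ≤ 1 / 2 := by
    rw [hℓ]
    field_simp
    linarith
  have h4 : A * (2 * ℓ) * ‖derivLp hμ u‖ ^ 2 ≤ 1 / 2 * ‖derivLp hμ u‖ ^ 2 := by gcongr
  rw [← hA] at h2
  nlinarith

/-- The product is dominated by |V|(|v|² + |u|²). The positive part of V is covered by the form
domain, the negative part by the Sobolev bound. -/
theorem integrable_potential_mul (hΩ : IsOpen Ω) (hU : IsUpperSet Ω)
    (hμ : μ = volume.restrict Ω) {V : ℝ → ℝ} (hV : IsEdgePotential μ V) {v u : Lp ℂ 2 μ}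
    (hv : v ∈ edgeDomain Ω μ V) (hu : u ∈ edgeDomain Ω μ V) :
    Integrable (fun x => (V x : ℂ) * (starRingEnd ℂ (v x) * u x)) μ := by
  have h := ((hv.2.add (integrable_negPart_mul hΩ hU hμ hV hv.1)).add
    (hu.2.add (integrable_negPart_mul hΩ hU hμ hV hu.1)))
  refine h.mono' ?_ (ae_of_all _ fun x => ?_)
  · exact (Complex.continuous_ofReal.comp_aestronglyMeasurable hV.aestronglyMeasurable).mul
      ((Complex.continuous_conj.comp_aestronglyMeasurable (Lp.aestronglyMeasurable v)).mul
        (Lp.aestronglyMeasurable u))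
  · rw [norm_mul, norm_mul, RCLike.norm_conj, Complex.norm_real, Real.norm_eq_abs]
    have hV' : |V x| = max (V x) 0 + max (-V x) 0 := by
      rcases le_total 0 (V x) with h0 | h0
      · rw [abs_of_nonneg h0, max_eq_left h0, max_eq_right (by linarith), add_zero]
      · rw [abs_of_nonpos h0, max_eq_right h0, max_eq_left (by linarith), zero_add]
    simp only [Pi.add_apply]
    have h0 := abs_nonneg (V x)
    have h1 : ‖v x‖ * ‖u x‖ ≤ ‖v x‖ ^ 2 + ‖u x‖ ^ 2 := by
      nlinarith [sq_nonneg (‖v x‖ - ‖u x‖), sq_nonneg ‖v x‖, sq_nonneg ‖u x‖]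
    calc |V x| * (‖v x‖ * ‖u x‖) ≤ |V x| * (‖v x‖ ^ 2 + ‖u x‖ ^ 2) := by gcongr
      _ = _ := by rw [hV']; ring

theorem integrable_conj_mul {f g : ℝ → ℂ} (hf : MemLp f 2 μ) (hg : MemLp g 2 μ) :
    Integrable (fun x => starRingEnd ℂ (f x) * g x) μ := by
  have := hf.star.integrable_mul hg
  exact this

theorem integrable_deriv_mul (hμ : μ = volume.restrict Ω) (v u : ℝ → ℂ) :
    Integrable (fun x => starRingEnd ℂ (weakDeriv Ω v x) * weakDeriv Ω u x) μ :=
  integrable_conj_mul (memLp_weakDeriv_of_eq hμ v) (memLp_weakDeriv_of_eq hμ u)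

theorem integrable_edgeForm (hΩ : IsOpen Ω) (hU : IsUpperSet Ω) (hμ : μ = volume.restrict Ω)
    {V : ℝ → ℝ} (hV : IsEdgePotential μ V) {v u : Lp ℂ 2 μ}
    (hv : v ∈ edgeDomain Ω μ V) (hu : u ∈ edgeDomain Ω μ V) :
    Integrable (fun x => starRingEnd ℂ (weakDeriv Ω v x) * weakDeriv Ω u x
      + (V x : ℂ) * (starRingEnd ℂ (v x) * u x)) μ :=
  (integrable_deriv_mul hμ _ _).add (integrable_potential_mul hΩ hU hμ hV hv hu)

theorem weakDeriv_coeFn_add (hΩ : IsOpen Ω) (hμ : μ = volume.restrict Ω) {u v : Lp ℂ 2 μ}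
    (hu : MemH1 Ω u) (hv : MemH1 Ω v) :
    MemH1 Ω (u + v : Lp ℂ 2 μ) ∧
      weakDeriv Ω (u + v : Lp ℂ 2 μ) =ᵐ[μ] weakDeriv Ω u + weakDeriv Ω v := by
  subst hμ
  refine ⟨(hu.add hv).congr (Lp.coeFn_add u v).symm, ?_⟩
  exact weakDeriv_ae_eq hΩ ((memLp_weakDeriv _).add (memLp_weakDeriv _))
    ((hu.hasWeakDeriv.add hv.hasWeakDeriv hu.1 hv.1 (memLp_weakDeriv _)
      (memLp_weakDeriv _)).congr (Lp.coeFn_add u v).symm ae_eq_rfl)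

theorem weakDeriv_coeFn_smul (hΩ : IsOpen Ω) (hμ : μ = volume.restrict Ω) (c : ℂ)
    {u : Lp ℂ 2 μ} (hu : MemH1 Ω u) :
    MemH1 Ω (c • u : Lp ℂ 2 μ) ∧ weakDeriv Ω (c • u : Lp ℂ 2 μ) =ᵐ[μ] c • weakDeriv Ω u := by
  subst hμ
  refine ⟨(hu.const_smul c).congr (Lp.coeFn_smul c u).symm, ?_⟩
  exact weakDeriv_ae_eq hΩ ((memLp_weakDeriv _).const_smul c)
    ((hu.hasWeakDeriv.const_smul c).congr (Lp.coeFn_smul c u).symm ae_eq_rfl)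

theorem isHermitianForm_edge (hΩ : IsOpen Ω) (hU : IsUpperSet Ω) (hμ : μ = volume.restrict Ω)
    {V : ℝ → ℝ} (hV : IsEdgePotential μ V) :
    IsHermitianForm (edgeDomain Ω μ V) (edgeForm Ω μ V) where
  zero_mem := by
    have h0 : ((0 : Lp ℂ 2 μ) : ℝ → ℂ) =ᵐ[μ] 0 := Lp.coeFn_zero ℂ 2 μ
    refine ⟨?_, ?_⟩
    · subst hμ
      exact memH1_zero.congr h0.symm
    · exact (integrable_zero ℝ ℝ μ).congr (h0.mono fun x hx => by
        change (0 : ℝ) = max (V x) 0 * ‖_‖ ^ 2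
        rw [hx]
        simp)
  add_mem := by
    intro u v hu hv
    refine ⟨(weakDeriv_coeFn_add hΩ hμ hu.1 hv.1).1, ?_⟩
    have hVp : AEStronglyMeasurable (fun x => max (V x) 0) μ :=
      hV.aestronglyMeasurable.sup aestronglyMeasurable_const
    refine ((hu.2.add hv.2).const_mul 2).mono'
      (hVp.mul ((Lp.aestronglyMeasurable _).norm.pow 2)) ?_
    filter_upwards [Lp.coeFn_add u v] with x hx
    rw [hx, Real.norm_of_nonneg (mul_nonneg (le_max_right _ _) (by positivity))]
    simp only [Pi.add_apply]
    have h1 : ‖u x + v x‖ ^ 2 ≤ 2 * (‖u x‖ ^ 2 + ‖v x‖ ^ 2) := by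
      have := pow_le_pow_left₀ (norm_nonneg _) (norm_add_le (u x) (v x)) 2
      nlinarith [sq_nonneg (‖u x‖ - ‖v x‖)]
    calc max (V x) 0 * ‖u x + v x‖ ^ 2 ≤ max (V x) 0 * (2 * (‖u x‖ ^ 2 + ‖v x‖ ^ 2)) :=
          mul_le_mul_of_nonneg_left h1 (le_max_right _ _)
      _ = _ := by ring
  smul_mem := by
    intro c u hu
    refine ⟨(weakDeriv_coeFn_smul hΩ hμ c hu.1).1, ?_⟩
    refine (hu.2.const_mul (‖c‖ ^ 2)).congr ?_
    filter_upwards [Lp.coeFn_smul c u] with x hx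
    rw [hx, Pi.smul_apply, norm_smul]
    ring
  add_right := by
    intro v u u' hv hu hu'
    unfold edgeForm
    rw [← integral_add (integrable_edgeForm hΩ hU hμ hV hv hu)
      (integrable_edgeForm hΩ hU hμ hV hv hu')]
    refine integral_congr_ae ?_
    filter_upwards [Lp.coeFn_add u u', (weakDeriv_coeFn_add hΩ hμ hu.1 hu'.1).2] with x h1 h2
    rw [h1, h2, Pi.add_apply, Pi.add_apply]
    ring
  smul_right := by
    intro c v u hv hu
    unfold edgeForm
    rw [← integral_const_mul]
    refine integral_congr_ae ?_
    filter_upwards [Lp.coeFn_smul c u, (weakDeriv_coeFn_smul hΩ hμ c hu.1).2] with x h1 h2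
    rw [h1, h2, Pi.smul_apply, Pi.smul_apply, smul_eq_mul, smul_eq_mul]
    ring
  conj_symm := by
    intro u v hu hv
    unfold edgeForm
    rw [← integral_conj]
    refine integral_congr_ae (ae_of_all _ fun x => ?_)
    simp only [map_add, map_mul, Complex.conj_conj, Complex.conj_ofReal]
    ring

/-- The three terms behave differently under weak limits and are treated separately in the
semicontinuity argument. -/
theorem re_edgeForm (hΩ : IsOpen Ω) (hU : IsUpperSet Ω) (hμ : μ = volume.restrict Ω)
    {V : ℝ → ℝ} (hV : IsEdgePotential μ V) {u : Lp ℂ 2 μ} (hu : u ∈ edgeDomain Ω μ V) :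
    (edgeForm Ω μ V u u).re = ‖derivLp hμ u‖ ^ 2 + (∫ x, max (V x) 0 * ‖u x‖ ^ 2 ∂μ)
      - ∫ x, max (-V x) 0 * ‖u x‖ ^ 2 ∂μ := by
  have hD : Integrable (fun x => ‖weakDeriv Ω u x‖ ^ 2) μ :=
    (memLp_weakDeriv_of_eq hμ u).integrable_norm_pow (by simp)
  have hN := integrable_negPart_mul hΩ hU hμ hV hu.1
  rw [norm_derivLp_sq, ← integral_add hD hu.2,
    ← integral_sub (f := fun x => ‖weakDeriv Ω u x‖ ^ 2 + max (V x) 0 * ‖u x‖ ^ 2)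
      (hD.add hu.2) hN]
  have h1 : edgeForm Ω μ V u u = ((∫ x, (‖weakDeriv Ω u x‖ ^ 2 + max (V x) 0 * ‖u x‖ ^ 2
      - max (-V x) 0 * ‖u x‖ ^ 2) ∂μ : ℝ) : ℂ) := by
    rw [← integral_complex_ofReal]
    refine integral_congr_ae (ae_of_all _ fun x => ?_)
    simp only [Complex.conj_mul']
    have hV' : V x = max (V x) 0 - max (-V x) 0 := by
      rcases le_total 0 (V x) with h0 | h0
      · rw [max_eq_left h0, max_eq_right (by linarith), sub_zero]
      · rw [max_eq_right h0, max_eq_left (by linarith)]; ring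
    conv_lhs => rw [hV']
    push_cast
    ring
  rw [h1, Complex.ofReal_re]

end Edge

/-! ### Weak limits and lower semicontinuity on one edge -/

section EdgeLimit

variable {Ω : Set ℝ} {μ : Measure ℝ}

theorem inner_toLp_ofReal {k : ℝ → ℝ} (hk : MemLp (fun s => (k s : ℂ)) 2 μ) (f : Lp ℂ 2 μ) :
    inner ℂ (hk.toLp _) f = ∫ s, (k s : ℂ) * f s ∂μ := by
  rw [L2.inner_def]
  refine integral_congr_ae ?_
  filter_upwards [hk.coeFn_toLp] with s hs
  rw [hs, RCLike.inner_apply, Complex.conj_ofReal, mul_comm]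

theorem memLp_ofReal_of_hasCompactSupport [IsLocallyFiniteMeasure μ] {φ : ℝ → ℝ}
    (hφ : Continuous φ) (hc : HasCompactSupport φ) : MemLp (fun s => (φ s : ℂ)) 2 μ :=
  (hφ.memLp_of_hasCompactSupport hc).ofReal

/-- Weak limits of bounded sequences in the form domain of one edge. -/
theorem edge_weak_limit (hΩ : IsOpen Ω) (hμ : μ = volume.restrict Ω)
    {u : ℕ → Lp ℂ 2 μ} (hu : ∀ n, MemH1 Ω (u n)) {u₀ g₀ : Lp ℂ 2 μ}
    (hlim : ∀ e, Tendsto (fun n => inner ℂ e (u n)) atTop (𝓝 (inner ℂ e u₀)))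
    (hlim' : ∀ e, Tendsto (fun n => inner ℂ e (derivLp hμ (u n))) atTop (𝓝 (inner ℂ e g₀))) :
    MemH1 Ω u₀ ∧ derivLp hμ u₀ = g₀ ∧
      ∀ (w : ℕ → ℝ → ℂ) (w₀ : ℝ → ℂ), (∀ n, IsRep Ω (u n) (weakDeriv Ω (u n)) (w n)) →
        IsRep Ω u₀ (weakDeriv Ω u₀) w₀ → ∀ x, Set.Ioi x ⊆ Ω →
        Tendsto (fun n => w n x) atTop (𝓝 (w₀ x)) := by
  have hDeq : ∀ (k : ℝ → ℝ) (f : Lp ℂ 2 μ),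
      ∫ s, (k s : ℂ) * derivLp hμ f s ∂μ = ∫ s, (k s : ℂ) * weakDeriv Ω f s ∂μ := fun k f =>
    integral_congr_ae ((coeFn_derivLp hμ f).mono fun s hs => by simp only [hs])
  have hlf : IsLocallyFiniteMeasure μ := by rw [hμ]; infer_instance
  have hweak : HasWeakDeriv Ω u₀ g₀ := by
    intro φ hφ hc hs
    rw [← hμ]
    have hd : Continuous (deriv φ) := hφ.continuous_deriv (by simp)
    -- A test function and its derivative are themselves in L², so the identity defining the weak
    -- derivative passes to the weak limit.
    have h1 := hlim ((memLp_ofReal_of_hasCompactSupport hd hc.deriv).toLp _)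
    have h2 := hlim' ((memLp_ofReal_of_hasCompactSupport hφ.continuous hc).toLp _)
    simp only [inner_toLp_ofReal, hDeq] at h1 h2
    have h3 := h2.neg
    refine tendsto_nhds_unique h1 (h3.congr fun n => ?_)
    have := (hu n).hasWeakDeriv φ hφ hc hs
    rw [← hμ] at this
    exact this.symm
  have hmem : MemH1 Ω u₀ := by
    subst hμ
    exact ⟨Lp.memLp u₀, g₀, Lp.memLp g₀, hweak⟩
  have hae : weakDeriv Ω u₀ =ᵐ[μ] g₀ := by
    subst hμ
    exact weakDeriv_ae_eq hΩ (Lp.memLp g₀) hweak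
  have hder : derivLp hμ u₀ = g₀ := Lp.ext ((coeFn_derivLp hμ u₀).trans hae)
  refine ⟨hmem, hder, fun w w₀ hw hw₀ x hx => ?_⟩
  -- A point value is a sum of L² pairings with u and u′ (`IsRep.eq_integral`), so weak convergence
  -- of both yields pointwise convergence.
  have h1 := hlim ((memLp_averageKernel x 1 μ).toLp _)
  have h2 := hlim' ((memLp_slopeKernel one_pos x μ).toLp _)
  rw [← hder] at h2
  simp only [inner_toLp_ofReal, hDeq] at h1 h2
  have h3 := h1.add h2
  have heq : ∀ {f : Lp ℂ 2 μ} {v : ℝ → ℂ}, IsRep Ω f (weakDeriv Ω f) v →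
      v x = (∫ s, (averageKernel x 1 s : ℂ) * f s ∂μ)
        + ∫ s, (slopeKernel x 1 s : ℂ) * weakDeriv Ω f s ∂μ := by
    intro f v hv
    rw [hv.eq_integral hΩ (memLp_weakDeriv _) hx one_pos, ← hμ]
  rw [← heq hw₀] at h3
  exact h3.congr fun n => (heq (hw n)).symm

/-- The form on one edge is weakly lower semicontinuous along sequences with bounded energy. -/
theorem edge_lowerSemicontinuous (hΩ : IsOpen Ω) (hU : IsUpperSet Ω)
    (hμ : μ = volume.restrict Ω) {V : ℝ → ℝ} (hV : IsEdgePotential μ V) {u : ℕ → Lp ℂ 2 μ}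
    (hu : ∀ n, u n ∈ edgeDomain Ω μ V) {u₀ g₀ : Lp ℂ 2 μ} (hu1 : ∀ n, ‖u n‖ ≤ 1) {K : ℝ}
    (huK : ∀ n, ‖derivLp hμ (u n)‖ ^ 2 ≤ K)
    (huP : ∀ n, ∫ x, max (V x) 0 * ‖u n x‖ ^ 2 ∂μ ≤ K)
    (hlim : ∀ e, Tendsto (fun n => inner ℂ e (u n)) atTop (𝓝 (inner ℂ e u₀)))
    (hlim' : ∀ e, Tendsto (fun n => inner ℂ e (derivLp hμ (u n))) atTop (𝓝 (inner ℂ e g₀)))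
    {m : ℝ} (hm : Tendsto (fun n => (edgeForm Ω μ V (u n) (u n)).re) atTop (𝓝 m)) :
    u₀ ∈ edgeDomain Ω μ V ∧ (edgeForm Ω μ V u₀ u₀).re ≤ m := by
  obtain ⟨hmem, hder, hrep⟩ := edge_weak_limit hΩ hμ (fun n => (hu n).1) hlim hlim'
  have hVp : AEStronglyMeasurable (fun x => max (V x) 0) μ :=
    hV.aestronglyMeasurable.sup aestronglyMeasurable_const
  have hpt : ∀ᵐ x ∂μ, Tendsto (fun n => u n x) atTop (𝓝 (u₀ x)) := by
    choose w hw using fun n => (hu n).1.exists_isRep hΩ hU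
    obtain ⟨w₀, hw₀⟩ := hmem.exists_isRep hΩ hU
    have h1 : ∀ᵐ x ∂μ, ∀ n, w n x = u n x :=
      ae_all_iff.2 fun n => by have := (hw n).ae_eq; rwa [← hμ] at this
    have h2 : ∀ᵐ x ∂μ, w₀ x = u₀ x := by have := hw₀.ae_eq; rwa [← hμ] at this
    have h3 : ∀ᵐ x ∂μ, x ∈ Ω := by rw [hμ]; exact ae_restrict_mem hΩ.measurableSet
    filter_upwards [h1, h2, h3] with x hx1 hx2 hx3
    have := hrep w w₀ hw hw₀ x fun y hy => hU (le_of_lt hy) hx3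
    simpa only [hx1, hx2] using this
  have hbd : ∀ n, ∀ᵐ x ∂μ, ‖u n x‖ ^ 2 ≤ 2 + 2 * K := by
    intro n
    filter_upwards [norm_sq_le_ae hΩ hU hμ (hu n).1 one_pos] with x hx
    have h1 : ‖u n‖ ^ 2 ≤ 1 := pow_le_one₀ (norm_nonneg _) (hu1 n)
    have h2 := huK n
    linarith
  set p : ℕ → ℝ := fun n => ∫ x, max (V x) 0 * ‖u n x‖ ^ 2 ∂μ with hp
  have hp0 : ∀ n, 0 ≤ p n := fun n =>
    integral_nonneg fun x => mul_nonneg (le_max_right _ _) (by positivity)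
  -- Fatou is applied along a subsequence whose positive potential energies converge, so that the
  -- bound involves their actual limit P.
  obtain ⟨P, hPmem, ns, hns, hP⟩ := (isCompact_Icc (a := (0 : ℝ)) (b := K)).tendsto_subseq
    (x := p) fun n => ⟨hp0 n, huP n⟩
  have hlin : ∀ n, ∫⁻ x, ENNReal.ofReal (max (V x) 0 * ‖u n x‖ ^ 2) ∂μ = ENNReal.ofReal (p n) :=
    fun n => (ofReal_integral_eq_lintegral_ofReal (hu n).2
      (ae_of_all _ fun x => mul_nonneg (le_max_right _ _) (by positivity))).symm
  have hfatou : ∫⁻ x, ENNReal.ofReal (max (V x) 0 * ‖u₀ x‖ ^ 2) ∂μ ≤ ENNReal.ofReal P := by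
    have h1 : ∫⁻ x, ENNReal.ofReal (max (V x) 0 * ‖u₀ x‖ ^ 2) ∂μ
        = ∫⁻ x, liminf (fun n => ENNReal.ofReal (max (V x) 0 * ‖u (ns n) x‖ ^ 2)) atTop ∂μ := by
      refine lintegral_congr_ae ?_
      filter_upwards [hpt] with x hx
      refine (Tendsto.liminf_eq ?_).symm
      exact (ENNReal.continuous_ofReal.tendsto _).comp
        (((hx.comp hns.tendsto_atTop).norm.pow 2).const_mul _)
    rw [h1]
    refine (lintegral_liminf_le' fun n => ?_).trans (le_of_eq ?_)
    · exact (hu (ns n)).2.aestronglyMeasurable.aemeasurable.ennreal_ofReal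
    · simp only [hlin]
      exact ((ENNReal.continuous_ofReal.tendsto _).comp hP).liminf_eq
  have hint : Integrable (fun x => max (V x) 0 * ‖u₀ x‖ ^ 2) μ := by
    refine ⟨hVp.mul ((Lp.aestronglyMeasurable _).norm.pow 2), ?_⟩
    rw [hasFiniteIntegral_iff_ofReal
      (ae_of_all _ fun x => mul_nonneg (le_max_right _ _) (by positivity))]
    exact hfatou.trans_lt ENNReal.ofReal_lt_top
  have hu₀ : u₀ ∈ edgeDomain Ω μ V := ⟨hmem, hint⟩
  refine ⟨hu₀, ?_⟩
  have hle : ∫ x, max (V x) 0 * ‖u₀ x‖ ^ 2 ∂μ ≤ P := by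
    rw [← ENNReal.ofReal_le_ofReal_iff hPmem.1, ofReal_integral_eq_lintegral_ofReal hint
      (ae_of_all _ fun x => mul_nonneg (le_max_right _ _) (by positivity))]
    exact hfatou
  refine le_of_forall_pos_le_add fun δ hδ => ?_
  -- The integrable part W passes to the limit by dominated convergence, since the functions are
  -- uniformly bounded. The remaining part of V₋ costs at most δ.
  obtain ⟨W, hW, hW0, hWle, hleW⟩ := hV.exists_le δ hδ
  have hWlim : Tendsto (fun n => ∫ x, W x * ‖u n x‖ ^ 2 ∂μ) atTop
      (𝓝 (∫ x, W x * ‖u₀ x‖ ^ 2 ∂μ)) := by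
    refine tendsto_integral_of_dominated_convergence (fun x => W x * (2 + 2 * K))
      (fun n => hW.aestronglyMeasurable.mul ((Lp.aestronglyMeasurable _).norm.pow 2))
      (hW.mul_const _) (fun n => ?_) ?_
    · filter_upwards [hbd n] with x hx
      rw [Real.norm_of_nonneg (mul_nonneg (hW0 x) (by positivity))]
      exact mul_le_mul_of_nonneg_left hx (hW0 x)
    · filter_upwards [hpt] with x hx
      exact (hx.norm.pow 2).const_mul _
  -- The kinetic energy is bounded below by the affine expression 2 Re⟨g₀, g⟩ − ‖g₀‖², which is
  -- weakly continuous and equals ‖g₀‖² at g = g₀.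
  have hDlim : Tendsto (fun n => 2 * (inner ℂ g₀ (derivLp hμ (u n))).re - ‖g₀‖ ^ 2) atTop
      (𝓝 (2 * (inner ℂ g₀ g₀).re - ‖g₀‖ ^ 2)) :=
    (((Complex.continuous_re.tendsto _).comp (hlim' g₀)).const_mul 2).sub_const _
  have hg₀ : (inner ℂ g₀ g₀).re = ‖g₀‖ ^ 2 := inner_self_eq_norm_sq (𝕜 := ℂ) g₀
  have hlow : ∀ n, 2 * (inner ℂ g₀ (derivLp hμ (u n))).re - ‖g₀‖ ^ 2 + p n
      - (δ + ∫ x, W x * ‖u n x‖ ^ 2 ∂μ) ≤ (edgeForm Ω μ V (u n) (u n)).re := by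
    intro n
    rw [re_edgeForm hΩ hU hμ hV (hu n)]
    have h1 := integral_negPart_mul_le hΩ hU hμ hV (hu n).1 hW hleW
    have h2 : δ * ‖u n‖ ^ 2 ≤ δ :=
      mul_le_of_le_one_right hδ.le (pow_le_one₀ (norm_nonneg _) (hu1 n))
    have h3 : 2 * (inner ℂ g₀ (derivLp hμ (u n))).re - ‖g₀‖ ^ 2 ≤ ‖derivLp hμ (u n)‖ ^ 2 := by
      have h4 := norm_sub_sq (𝕜 := ℂ) g₀ (derivLp hμ (u n))
      have h5 := sq_nonneg ‖g₀ - derivLp hμ (u n)‖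
      rw [h4] at h5
      change 0 ≤ ‖g₀‖ ^ 2 - 2 * (inner ℂ g₀ (derivLp hμ (u n))).re + ‖derivLp hμ (u n)‖ ^ 2 at h5
      linarith
    linarith
  have htend := ((hDlim.comp hns.tendsto_atTop).add hP).sub
    ((hWlim.comp hns.tendsto_atTop).const_add δ)
  have hfin := le_of_tendsto_of_tendsto' htend (hm.comp hns.tendsto_atTop)
    (fun n => hlow (ns n))
  rw [re_edgeForm hΩ hU hμ hV hu₀, hder]
  have hWn : ∫ x, W x * ‖u₀ x‖ ^ 2 ∂μ ≤ ∫ x, max (-V x) 0 * ‖u₀ x‖ ^ 2 ∂μ :=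
    integral_mono (integrable_mul_norm_sq hΩ hU hμ hmem hW)
      (integrable_negPart_mul hΩ hU hμ hV hmem)
      fun x => mul_le_mul_of_nonneg_right (hWle x) (by positivity)
  rw [hg₀] at hfin
  linarith

end EdgeLimit

/-! ### Schrödinger forms on a finite family of edges -/

section Graph

variable {Ω : Set ℝ} {μ : Measure ℝ} {ι : Type} [Fintype ι]

/-- The form domain on a family of edges, without conditions at the ends of the edges. -/
def graphDomain (Ω : Set ℝ) (μ : Measure ℝ) (V : ι → ℝ → ℝ) :
    Set (PiLp 2 fun _ : ι => Lp ℂ 2 μ) :=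
  {u | ∀ j, u j ∈ edgeDomain Ω μ (V j)}

/-- The sum of the Schrödinger forms over all edges. -/
def graphForm (Ω : Set ℝ) (μ : Measure ℝ) (V : ι → ℝ → ℝ)
    (v u : PiLp 2 fun _ : ι => Lp ℂ 2 μ) : ℂ :=
  ∑ j, edgeForm Ω μ (V j) (v j) (u j)

theorem isHermitianForm_graph (hΩ : IsOpen Ω) (hU : IsUpperSet Ω) (hμ : μ = volume.restrict Ω)
    {V : ι → ℝ → ℝ} (hV : ∀ j, IsEdgePotential μ (V j)) :
    IsHermitianForm (graphDomain Ω μ V) (graphForm Ω μ V) where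
  zero_mem j := (isHermitianForm_edge hΩ hU hμ (hV j)).zero_mem
  add_mem hu hv j := (isHermitianForm_edge hΩ hU hμ (hV j)).add_mem (hu j) (hv j)
  smul_mem c _ hu j := (isHermitianForm_edge hΩ hU hμ (hV j)).smul_mem c (hu j)
  add_right := by
    intro v u u' hv hu hu'
    unfold graphForm
    rw [← Finset.sum_add_distrib]
    exact Finset.sum_congr rfl fun j _ =>
      (isHermitianForm_edge hΩ hU hμ (hV j)).add_right (hv j) (hu j) (hu' j)
  smul_right := by
    intro c v u hv hu
    unfold graphForm
    rw [Finset.mul_sum]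
    exact Finset.sum_congr rfl fun j _ =>
      (isHermitianForm_edge hΩ hU hμ (hV j)).smul_right c (hv j) (hu j)
  conj_symm := by
    intro u v hu hv
    unfold graphForm
    rw [map_sum]
    exact Finset.sum_congr rfl fun j _ =>
      (isHermitianForm_edge hΩ hU hμ (hV j)).conj_symm (hu j) (hv j)

/-- Restricting a Hermitian form to a subspace. -/
theorem IsHermitianForm.mono {E : Type*} [NormedAddCommGroup E] [InnerProductSpace ℂ E]
    {D D' : Set E} {h : E → E → ℂ} (hf : IsHermitianForm D h) (hDD : D' ⊆ D) (h0 : 0 ∈ D')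
    (hadd : ∀ {u v}, u ∈ D' → v ∈ D' → u + v ∈ D')
    (hsmul : ∀ (c : ℂ) {u}, u ∈ D' → c • u ∈ D') : IsHermitianForm D' h where
  zero_mem := h0
  add_mem := hadd
  smul_mem := hsmul
  add_right hv hu hu' := hf.add_right (hDD hv) (hDD hu) (hDD hu')
  smul_right c _ _ hv hu := hf.smul_right c (hDD hv) (hDD hu)
  conj_symm hu hv := hf.conj_symm (hDD hu) (hDD hv)

theorem norm_apply_le (u : PiLp 2 fun _ : ι => Lp ℂ 2 μ) (j : ι) : ‖u j‖ ≤ ‖u‖ :=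
  PiLp.norm_apply_le u j

/-- A Schrödinger form on a family of edges, restricted by conditions that are preserved under
convergence of the values of the continuous representatives, has minimizers. -/
theorem hasMinimizers_graph (hΩ : IsOpen Ω) (hU : IsUpperSet Ω) (hμ : μ = volume.restrict Ω)
    {V : ι → ℝ → ℝ} (hV : ∀ j, IsEdgePotential μ (V j))
    {D : Set (PiLp 2 fun _ : ι => Lp ℂ 2 μ)} (hD : D ⊆ graphDomain Ω μ V)
    (hclosed : ∀ (u : ℕ → PiLp 2 fun _ : ι => Lp ℂ 2 μ) (u₀ : PiLp 2 fun _ : ι => Lp ℂ 2 μ),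
      (∀ n, u n ∈ D) → u₀ ∈ graphDomain Ω μ V →
      (∀ j, ∀ (w : ℕ → ℝ → ℂ) (w₀ : ℝ → ℂ),
        (∀ n, IsRep Ω (u n j) (weakDeriv Ω (u n j)) (w n)) →
        IsRep Ω (u₀ j) (weakDeriv Ω (u₀ j)) w₀ → ∀ x, Set.Ioi x ⊆ Ω →
        Tendsto (fun n => w n x) atTop (𝓝 (w₀ x))) → u₀ ∈ D) :
    HasMinimizers D (graphForm Ω μ V) := by
  choose C hC0 hC using fun j => exists_integral_negPart_le hΩ hU hμ (hV j)
  have hlow : ∀ j, ∀ u ∈ edgeDomain Ω μ (V j),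
      1 / 2 * ‖derivLp hμ u‖ ^ 2 + (∫ x, max (V j x) 0 * ‖u x‖ ^ 2 ∂μ) - C j * ‖u‖ ^ 2
        ≤ (edgeForm Ω μ (V j) u u).re := by
    intro j u hu
    rw [re_edgeForm hΩ hU hμ (hV j) hu]
    linarith [hC j u hu.1]
  have hpos : ∀ j (u : Lp ℂ 2 μ), 0 ≤ ∫ x, max (V j x) 0 * ‖u x‖ ^ 2 ∂μ := fun j u =>
    integral_nonneg fun x => mul_nonneg (le_max_right _ _) (by positivity)
  have hre : ∀ u, (graphForm Ω μ V u u).re = ∑ j, (edgeForm Ω μ (V j) (u j) (u j)).re := fun u =>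
    Complex.re_sum _ _
  refine ⟨⟨∑ j, C j, fun u hu => ?_⟩, fun v hvD hv1 m hm => ?_⟩
  · rw [hre, ← Finset.sum_neg_distrib, Finset.sum_mul]
    refine Finset.sum_le_sum fun j _ => ?_
    have h1 := hlow j _ (hD hu j)
    have h2 : ‖u j‖ ^ 2 ≤ ‖u‖ ^ 2 := pow_le_pow_left₀ (norm_nonneg _) (norm_apply_le u j) 2
    have h3 : C j * ‖u j‖ ^ 2 ≤ C j * ‖u‖ ^ 2 := mul_le_mul_of_nonneg_left h2 (hC0 j)
    have h4 := hpos j (u j)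
    have h5 := sq_nonneg ‖derivLp hμ (u j)‖
    linarith
  have hv1j : ∀ n j, ‖v n j‖ ≤ 1 := fun n j => (norm_apply_le _ j).trans (hv1 n)
  have hlowj : ∀ n j, -C j ≤ (edgeForm Ω μ (V j) (v n j) (v n j)).re := by
    intro n j
    have h1 := hlow j _ (hD (hvD n) j)
    have h2 : ‖v n j‖ ^ 2 ≤ 1 := pow_le_one₀ (norm_nonneg _) (hv1j n j)
    have h3 : C j * ‖v n j‖ ^ 2 ≤ C j := mul_le_of_le_one_right (hC0 j) h2
    have h4 := hpos j (v n j)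
    have h5 := sq_nonneg ‖derivLp hμ (v n j)‖
    linarith
  obtain ⟨B, hB⟩ := hm.bddAbove_range
  have hB' : ∀ n, ∑ j, (edgeForm Ω μ (V j) (v n j) (v n j)).re ≤ B := fun n => by
    rw [← hre]; exact hB ⟨n, rfl⟩
  set A := |B| + ∑ j, C j with hA
  have hup : ∀ n j, (edgeForm Ω μ (V j) (v n j) (v n j)).re ≤ A := by
    intro n j
    classical
    have h1 : ∑ i, ((edgeForm Ω μ (V i) (v n i) (v n i)).re + C i) ≤ A := by
      rw [Finset.sum_add_distrib]
      linarith [hB' n, le_abs_self B]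
    have h2 := Finset.single_le_sum
      (f := fun i => (edgeForm Ω μ (V i) (v n i) (v n i)).re + C i)
      (fun i _ => by linarith [hlowj n i]) (Finset.mem_univ j)
    simp only at h2
    linarith [hC0 j]
  set K := 2 * (A + ∑ j, C j) with hK
  have hCsum : ∀ j, C j ≤ ∑ j, C j := fun j =>
    Finset.single_le_sum (f := C) (fun i _ => hC0 i) (Finset.mem_univ j)
  have hA0 : 0 ≤ A := add_nonneg (abs_nonneg _) (Finset.sum_nonneg fun i _ => hC0 i)
  have hboth : ∀ n j, ‖derivLp hμ (v n j)‖ ^ 2 ≤ K ∧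
      ∫ x, max (V j x) 0 * ‖v n j x‖ ^ 2 ∂μ ≤ K := by
    intro n j
    have h1 := hlow j _ (hD (hvD n) j)
    have h2 : ‖v n j‖ ^ 2 ≤ 1 := pow_le_one₀ (norm_nonneg _) (hv1j n j)
    have h3 : C j * ‖v n j‖ ^ 2 ≤ C j := mul_le_of_le_one_right (hC0 j) h2
    have h4 := hpos j (v n j)
    have h5 := sq_nonneg ‖derivLp hμ (v n j)‖
    have h6 := hup n j
    have h7 := hCsum j
    have h8 := hC0 j
    constructor <;> linarith
  have hsep : TopologicalSpace.SeparableSpace (Lp ℂ 2 μ) := by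
    have : Fact ((2 : ENNReal) ≠ ⊤) := ⟨by simp⟩
    subst hμ
    infer_instance
  -- Three successive subsequences: weak convergence of the functions, weak convergence of the
  -- derivatives, and convergence of the form value on each edge. The last allows semicontinuity to
  -- be used edge by edge and then summed.
  obtain ⟨u₀, n₁, hn₁, hu₀⟩ := exists_subseq_tendsto_inner hv1
  set Dv : ℕ → PiLp 2 fun _ : ι => Lp ℂ 2 μ :=
    fun n => WithLp.toLp 2 fun j => derivLp hμ (v n j) with hDv
  have hDvb : ∀ n, ‖Dv n‖ ≤ Real.sqrt (∑ _j : ι, K) := by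
    intro n
    rw [PiLp.norm_eq_of_L2]
    exact Real.sqrt_le_sqrt (Finset.sum_le_sum fun j _ => (hboth n j).1)
  obtain ⟨g₀, n₂, hn₂, hg₀⟩ := exists_subseq_tendsto_inner fun n => hDvb (n₁ n)
  obtain ⟨q, -, n₃, hn₃, hq⟩ := (isCompact_univ_pi fun j : ι =>
      (isCompact_Icc (a := -C j) (b := A))).tendsto_subseq
    (x := fun n j => (edgeForm Ω μ (V j) (v (n₁ (n₂ n)) j) (v (n₁ (n₂ n)) j)).re)
    fun n j _ => ⟨hlowj _ j, hup _ j⟩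
  set ns : ℕ → ℕ := fun n => n₁ (n₂ (n₃ n)) with hns
  have hnsm : StrictMono ns := hn₁.comp (hn₂.comp hn₃)
  classical
  have hcomp : ∀ (a : ℕ → PiLp 2 fun _ : ι => Lp ℂ 2 μ) (a₀ : PiLp 2 fun _ : ι => Lp ℂ 2 μ),
      (∀ e, Tendsto (fun n => inner ℂ e (a n)) atTop (𝓝 (inner ℂ e a₀))) →
      ∀ j e, Tendsto (fun n => inner ℂ e (a n j)) atTop (𝓝 (inner ℂ e (a₀ j))) := by
    intro a a₀ ha j e
    have hin : ∀ b : PiLp 2 fun _ : ι => Lp ℂ 2 μ,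
        inner ℂ (PiLp.single 2 j e : PiLp 2 fun _ : ι => Lp ℂ 2 μ) b = inner ℂ e (b j) := by
      intro b
      rw [PiLp.inner_apply, Finset.sum_eq_single j]
      · simp
      · intro i _ hij
        simp [hij]
      · simp
    simpa only [hin] using ha (PiLp.single 2 j e)
  have hwu := hcomp (fun n => v (ns n)) u₀ fun e => (hu₀ e).comp (hn₂.comp hn₃).tendsto_atTop
  have hwd := hcomp (fun n => Dv (ns n)) g₀ fun e => (hg₀ e).comp hn₃.tendsto_atTop
  have hedge : ∀ j, u₀ j ∈ edgeDomain Ω μ (V j) ∧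
      (edgeForm Ω μ (V j) (u₀ j) (u₀ j)).re ≤ q j := fun j =>
    edge_lowerSemicontinuous hΩ hU hμ (hV j) (u := fun n => v (ns n) j)
      (fun n => hD (hvD _) j) (fun n => hv1j _ j) (fun n => (hboth _ j).1)
      (fun n => (hboth _ j).2) (hwu j) (hwd j) ((tendsto_pi_nhds.1 hq) j)
  refine ⟨u₀, ?_, ?_, ?_, fun e he => ?_⟩
  · exact hclosed (fun n => v (ns n)) u₀ (fun n => hvD _) (fun j => (hedge j).1) fun j =>
      (edge_weak_limit hΩ hμ (u := fun n => v (ns n) j) (fun n => (hD (hvD _) j).1)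
        (hwu j) (hwd j)).2.2
  · have h1 : Tendsto (fun n => ‖inner ℂ u₀ (v (n₁ n))‖) atTop (𝓝 ‖inner ℂ u₀ u₀‖) :=
      (hu₀ u₀).norm
    have h2 : ‖inner ℂ u₀ u₀‖ ≤ ‖u₀‖ := le_of_tendsto' h1 fun n =>
      (norm_inner_le_norm _ _).trans (mul_le_of_le_one_right (norm_nonneg _) (hv1 _))
    rw [inner_self_eq_norm_sq_to_K, norm_pow, RCLike.norm_ofReal, abs_norm] at h2
    by_contra hh
    nlinarith [not_le.1 hh]
  · rw [hre]
    have hsum : Tendsto (fun n => (graphForm Ω μ V (v (ns n)) (v (ns n))).re) atTop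
        (𝓝 (∑ j, q j)) := by
      simp only [hre]
      exact tendsto_finsetSum _ fun j _ => (tendsto_pi_nhds.1 hq) j
    have heq : m = ∑ j, q j := tendsto_nhds_unique (hm.comp hnsm.tendsto_atTop) hsum
    rw [heq]
    exact Finset.sum_le_sum fun j _ => (hedge j).2
  · refine tendsto_nhds_unique (hu₀ e) ?_
    simp only [he]
    exact tendsto_const_nhds

end Graph

/-! ### Direct sums of Schrödinger forms -/

section DirectSum

variable {Ω : Set ℝ} {μ : Measure ℝ} {ι : Type} [Fintype ι]

theorem hasMinimizers_graphDomain (hΩ : IsOpen Ω) (hU : IsUpperSet Ω)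
    (hμ : μ = volume.restrict Ω) {V : ι → ℝ → ℝ} (hV : ∀ j, IsEdgePotential μ (V j)) :
    HasMinimizers (graphDomain Ω μ V) (graphForm Ω μ V) :=
  hasMinimizers_graph hΩ hU hμ hV subset_rfl fun _ _ _ h _ => h

/-- Test with vectors supported on the single edge `j`; without vertex conditions these belong to
the form domain. -/
theorem operatorRel_apply (hΩ : IsOpen Ω) (hU : IsUpperSet Ω) (hμ : μ = volume.restrict Ω)
    {V : ι → ℝ → ℝ} (hV : ∀ j, IsEdgePotential μ (V j)) {t : ℂ}
    {u : PiLp 2 fun _ : ι => Lp ℂ 2 μ}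
    (hu : OperatorRel (graphDomain Ω μ V) (graphForm Ω μ V) u (t • u)) (j : ι) :
    OperatorRel (edgeDomain Ω μ (V j)) (edgeForm Ω μ (V j)) (u j) (t • u j) := by
  classical
  refine ⟨hu.1 j, fun v hv => ?_⟩
  have hv' : (PiLp.single 2 j v : PiLp 2 fun _ : ι => Lp ℂ 2 μ) ∈ graphDomain Ω μ V := by
    intro i
    by_cases hij : i = j
    · subst hij
      simpa using hv
    · simpa [hij] using (isHermitianForm_edge hΩ hU hμ (hV i)).zero_mem
  have h := hu.2 _ hv'
  rw [graphForm, Finset.sum_eq_single j, PiLp.inner_apply, Finset.sum_eq_single j] at h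
  · simp only [PiLp.single_apply, if_true] at h
    exact h
  · intro i _ hij
    simp [hij]
  · simp
  · intro i _ hij
    simpa [hij] using (isHermitianForm_edge hΩ hU hμ (hV i)).zero_left (hu.1 i)
  · simp

/-- Taking components embeds the eigenspace of the sum into the product of the edge eigenspaces.
Equality also holds but is not needed for the upper bound. -/
theorem multiplicity_graph_le (hΩ : IsOpen Ω) (hU : IsUpperSet Ω) (hμ : μ = volume.restrict Ω)
    {V : ι → ℝ → ℝ} (hV : ∀ j, IsEdgePotential μ (V j)) (t : ℝ) :
    multiplicity (graphDomain Ω μ V) (graphForm Ω μ V) t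
      ≤ ∑ j, multiplicity (edgeDomain Ω μ (V j)) (edgeForm Ω μ (V j)) t := by
  have hf := isHermitianForm_graph hΩ hU hμ hV
  have hfj := fun j => isHermitianForm_edge hΩ hU hμ (hV j)
  by_cases htop : ∃ j, multiplicity (edgeDomain Ω μ (V j)) (edgeForm Ω μ (V j)) t = ⊤
  · obtain ⟨j, hj⟩ := htop
    refine le_top.trans (le_trans (le_of_eq hj.symm) ?_)
    exact Finset.single_le_sum
      (f := fun j => multiplicity (edgeDomain Ω μ (V j)) (edgeForm Ω μ (V j)) t)
      (fun i _ => zero_le) (Finset.mem_univ j)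
  push Not at htop
  have hfin : ∀ j, FiniteDimensional ℂ ((hfj j).eigenspace t) := by
    intro j
    have h1 := htop j
    rw [(hfj j).multiplicity_eq, Cardinal.toENat_ne_top] at h1
    exact Module.rank_lt_aleph0_iff.1 h1
  let F : hf.eigenspace t →ₗ[ℂ] (∀ j, (hfj j).eigenspace t) :=
    { toFun := fun u j => ⟨(u : PiLp 2 fun _ : ι => Lp ℂ 2 μ) j,
        operatorRel_apply hΩ hU hμ hV u.2 j⟩
      map_add' := fun u v => rfl
      map_smul' := fun c u => rfl }
  have hinj : Function.Injective F := by
    intro u v huv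
    refine Subtype.ext (PiLp.ext fun j => ?_)
    exact congrArg Subtype.val (congrFun huv j)
  have hle := LinearMap.rank_le_of_injective F hinj
  rw [← Module.finrank_eq_rank ℂ (∀ j, (hfj j).eigenspace t), Module.finrank_pi_fintype] at hle
  rw [hf.multiplicity_eq]
  refine (Cardinal.toENat_le_natCast.2 hle).trans (le_of_eq ?_)
  rw [Nat.cast_sum]
  refine Finset.sum_congr rfl fun j _ => ?_
  rw [(hfj j).multiplicity_eq, ← Module.finrank_eq_rank, map_natCast]

theorem negTrace_graph_le (hΩ : IsOpen Ω) (hU : IsUpperSet Ω) (hμ : μ = volume.restrict Ω)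
    {V : ι → ℝ → ℝ} (hV : ∀ j, IsEdgePotential μ (V j)) (γ : ℝ) :
    negTrace (graphDomain Ω μ V) (graphForm Ω μ V) γ
      ≤ ∑ j, negTrace (edgeDomain Ω μ (V j)) (edgeForm Ω μ (V j)) γ := by
  unfold negTrace
  rw [← Summable.tsum_finsetSum fun j _ => ENNReal.summable]
  refine ENNReal.tsum_le_tsum fun t => ?_
  rw [← Finset.sum_mul]
  gcongr
  have h := ENat.toENNReal_le.2 (multiplicity_graph_le hΩ hU hμ hV (t : ℝ))
  refine h.trans (le_of_eq ?_)
  exact map_sum ENat.toENNRealRingHom _ _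

end DirectSum

/-! ### The star graph -/

section Star

theorem isUpperSet_Ioi_zero : IsUpperSet (Set.Ioi (0 : ℝ)) := isUpperSet_Ioi 0

variable {N : ℕ}

theorem HasBoundaryValue.add {u v : Lp ℂ 2 (volume.restrict (Set.Ioi (0 : ℝ)))} {c d : ℂ}
    (hu : HasBoundaryValue u c) (hv : HasBoundaryValue v d) :
    HasBoundaryValue (u + v : Lp ℂ 2 (volume.restrict (Set.Ioi (0 : ℝ)))) (c + d) := by
  obtain ⟨w, hw, hwu, rfl⟩ := hu
  obtain ⟨w', hw', hwv, rfl⟩ := hv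
  exact ⟨w + w', hw.add hw', (hwu.add hwv).trans (Lp.coeFn_add u v).symm, rfl⟩

theorem HasBoundaryValue.smul {u : Lp ℂ 2 (volume.restrict (Set.Ioi (0 : ℝ)))} {c : ℂ} (a : ℂ)
    (hu : HasBoundaryValue u c) :
    HasBoundaryValue (a • u : Lp ℂ 2 (volume.restrict (Set.Ioi (0 : ℝ)))) (a * c) := by
  obtain ⟨w, hw, hwu, rfl⟩ := hu
  exact ⟨a • w, hw.const_smul a, (hwu.const_smul a).trans (Lp.coeFn_smul a u).symm, rfl⟩

theorem hasBoundaryValue_zero :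
    HasBoundaryValue (0 : Lp ℂ 2 (volume.restrict (Set.Ioi (0 : ℝ)))) 0 :=
  ⟨0, continuousOn_const, (Lp.coeFn_zero ℂ 2 _).symm, rfl⟩

theorem mem_starDomain {V : Fin N → ℝ → ℝ} {u : StarL2 N} :
    u ∈ starDomain V ↔ u ∈ graphDomain (Set.Ioi 0) (volume.restrict (Set.Ioi 0)) V ∧
      ∃ c : ℂ, ∀ j, HasBoundaryValue (u j) c := by
  constructor
  · rintro ⟨⟨h1, h2⟩, h3⟩
    exact ⟨fun j => ⟨h1 j, h3 j⟩, h2⟩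
  · rintro ⟨h1, h2⟩
    exact ⟨⟨fun j => (h1 j).1, h2⟩, fun j => (h1 j).2⟩

theorem starForm_eq (V : Fin N → ℝ → ℝ) :
    starForm V = graphForm (Set.Ioi 0) (volume.restrict (Set.Ioi 0)) V := rfl

theorem StarPotential.isEdgePotential {p : ℝ} (hp : 1 ≤ p) {V : Fin N → ℝ → ℝ}
    (hV : StarPotential p V) (j : Fin N) :
    IsEdgePotential (volume.restrict (Set.Ioi 0)) (V j) :=
  isEdgePotential_of_memLp hp
    ((hV j).1.aestronglyMeasurable.mono_measure
      (Measure.restrict_mono Set.Ioi_subset_Ici_self le_rfl)) (hV j).2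

theorem isHermitianForm_star {V : Fin N → ℝ → ℝ}
    (hV : ∀ j, IsEdgePotential (volume.restrict (Set.Ioi 0)) (V j)) :
    IsHermitianForm (starDomain V) (starForm V) := by
  have hf := isHermitianForm_graph isOpen_Ioi isUpperSet_Ioi_zero rfl hV
  refine hf.mono (fun u hu => (mem_starDomain.1 hu).1) ?_ ?_ ?_
  · exact mem_starDomain.2 ⟨hf.zero_mem, 0, fun j => hasBoundaryValue_zero⟩
  · intro u v hu hv
    obtain ⟨h1, c, hc⟩ := mem_starDomain.1 hu
    obtain ⟨h2, d, hd⟩ := mem_starDomain.1 hv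
    exact mem_starDomain.2 ⟨hf.add_mem h1 h2, c + d, fun j => (hc j).add (hd j)⟩
  · intro a u hu
    obtain ⟨h1, c, hc⟩ := mem_starDomain.1 hu
    exact mem_starDomain.2 ⟨hf.smul_mem a h1, a * c, fun j => (hc j).smul a⟩

/-- The values at the vertex are limits of the values of the representatives, so their equality
survives the weak limit. -/
theorem hasMinimizers_star {V : Fin N → ℝ → ℝ}
    (hV : ∀ j, IsEdgePotential (volume.restrict (Set.Ioi 0)) (V j)) :
    HasMinimizers (starDomain V) (starForm V) := by
  refine hasMinimizers_graph isOpen_Ioi isUpperSet_Ioi_zero rfl hV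
    (fun u hu => (mem_starDomain.1 hu).1) fun u u₀ hu hu₀ hlim => ?_
  refine mem_starDomain.2 ⟨hu₀, ?_⟩
  choose w hw using fun n j =>
    ((mem_starDomain.1 (hu n)).1 j).1.exists_isRep isOpen_Ioi isUpperSet_Ioi_zero
  choose w₀ hw₀ using fun j => (hu₀ j).1.exists_isRep isOpen_Ioi isUpperSet_Ioi_zero
  have hlim0 : ∀ j, Tendsto (fun n => w n j 0) atTop (𝓝 (w₀ j 0)) := fun j =>
    hlim j (fun n => w n j) (w₀ j) (fun n => hw n j) (hw₀ j) 0 subset_rfl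
  have heq : ∀ i j, w₀ i 0 = w₀ j 0 := by
    intro i j
    refine tendsto_nhds_unique (hlim0 i) ((hlim0 j).congr fun n => ?_)
    obtain ⟨-, c, hc⟩ := mem_starDomain.1 (hu n)
    rw [(hw n j).eq_of_hasBoundaryValue (memLp_weakDeriv _) (hc j),
      (hw n i).eq_of_hasBoundaryValue (memLp_weakDeriv _) (hc i)]
  rcases isEmpty_or_nonempty (Fin N) with hN | ⟨⟨i⟩⟩
  · exact ⟨0, fun j => isEmptyElim j⟩
  · refine ⟨w₀ i 0, fun j => ?_⟩
    rw [heq i j]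
    exact (hw₀ j).hasBoundaryValue (memLp_weakDeriv _)

end Star

/-! ### Gluing two half-lines to a line -/

section Glue

open Classical in
/-- The function on the line that consists of `f` on the positive and of the reflection of `g` on
the negative half-line. -/
def glue {α : Type*} (f g : ℝ → α) : ℝ → α :=
  (Set.Ioi (0 : ℝ)).piecewise f fun x => g (-x)

theorem glue_apply {α : Type*} (f g : ℝ → α) (x : ℝ) :
    glue f g x = if 0 < x then f x else g (-x) := by
  unfold glue Set.piecewise
  congr

theorem glue_comp {α β : Type*} (F : α → β) (f g : ℝ → α) :
    (fun x => F (glue f g x)) = glue (fun x => F (f x)) fun x => F (g x) := by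
  funext x
  simp only [glue_apply]
  split_ifs <;> rfl

theorem glue_comp₂ {α β δ : Type*} (F : α → β → δ) (f g : ℝ → α) (f' g' : ℝ → β) :
    (fun x => F (glue f g x) (glue f' g' x))
      = glue (fun x => F (f x) (f' x)) fun x => F (g x) (g' x) := by
  funext x
  simp only [glue_apply]
  split_ifs <;> rfl

theorem measurePreserving_neg_compl : MeasurePreserving (fun x : ℝ => -x)
    (volume.restrict (Set.Ioi (0 : ℝ))ᶜ) (volume.restrict (Set.Ioi (0 : ℝ))) := by
  have h := (Measure.measurePreserving_neg (volume : Measure ℝ)).restrict_preimage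
    (measurableSet_Ici (a := (0 : ℝ)))
  rw [← Measure.restrict_congr_set (Ioi_ae_eq_Ici (a := (0 : ℝ)))] at h
  have hs : (Neg.neg ⁻¹' Set.Ici (0 : ℝ)) = (Set.Ioi (0 : ℝ))ᶜ := by
    ext x
    simp
  rw [hs] at h
  exact h

theorem measurableEmbedding_neg_real : MeasurableEmbedding (fun x : ℝ => -x) :=
  (Homeomorph.neg ℝ).measurableEmbedding

theorem glue_ae_eq {α : Type*} {f g f' g' : ℝ → α}
    (hf : f =ᵐ[volume.restrict (Set.Ioi (0 : ℝ))] f')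
    (hg : g =ᵐ[volume.restrict (Set.Ioi (0 : ℝ))] g') : glue f g =ᵐ[volume] glue f' g' := by
  have h1 := (ae_restrict_iff' measurableSet_Ioi).1 hf
  have h2 := (ae_restrict_iff' measurableSet_Ioi.compl).1
    (measurePreserving_neg_compl.quasiMeasurePreserving.ae_eq_comp hg)
  filter_upwards [h1, h2] with x hx1 hx2
  rw [glue_apply, glue_apply]
  split_ifs with h
  · exact hx1 h
  · exact hx2 h

theorem memLp_glue {F : Type*} [NormedAddCommGroup F] {p : ENNReal} {f g : ℝ → F}
    (hf : MemLp f p (volume.restrict (Set.Ioi (0 : ℝ))))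
    (hg : MemLp g p (volume.restrict (Set.Ioi (0 : ℝ)))) : MemLp (glue f g) p volume := by
  unfold glue
  exact MemLp.piecewise (g := fun x => g (-x)) measurableSet_Ioi hf
    (hg.comp_measurePreserving measurePreserving_neg_compl)

theorem integrable_glue {F : Type*} [NormedAddCommGroup F] {f g : ℝ → F}
    (hf : IntegrableOn f (Set.Ioi (0 : ℝ))) (hg : IntegrableOn g (Set.Ioi (0 : ℝ))) :
    Integrable (glue f g) := by
  rw [← memLp_one_iff_integrable]
  exact memLp_glue (memLp_one_iff_integrable.2 hf) (memLp_one_iff_integrable.2 hg)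

theorem integral_glue {F : Type*} [NormedAddCommGroup F] [NormedSpace ℝ F] {f g : ℝ → F}
    (hf : IntegrableOn f (Set.Ioi (0 : ℝ))) (hg : IntegrableOn g (Set.Ioi (0 : ℝ))) :
    ∫ x, glue f g x = (∫ x in Set.Ioi (0 : ℝ), f x) + ∫ x in Set.Ioi (0 : ℝ), g x := by
  unfold glue
  rw [integral_piecewise (g := fun x => g (-x)) measurableSet_Ioi hf
    ((measurePreserving_neg_compl.integrable_comp_emb measurableEmbedding_neg_real).2 hg),
    measurePreserving_neg_compl.integral_comp measurableEmbedding_neg_real]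

theorem lintegral_glue (f g : ℝ → ENNReal) :
    ∫⁻ x, glue f g x = (∫⁻ x in Set.Ioi (0 : ℝ), f x) + ∫⁻ x in Set.Ioi (0 : ℝ), g x := by
  unfold glue
  rw [lintegral_piecewise measurableSet_Ioi,
    measurePreserving_neg_compl.lintegral_comp_emb measurableEmbedding_neg_real]

/-- Local integrability up to and including the vertex is essential: the joint is an interior point
of the line. -/
theorem locallyIntegrable_glue {f g : ℝ → ℝ} (hf : LocallyIntegrableOn f (Set.Ici 0))
    (hg : LocallyIntegrableOn g (Set.Ici 0)) : LocallyIntegrable (glue f g) := by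
  rw [locallyIntegrable_iff]
  intro K hK
  obtain ⟨R, hR⟩ := hK.isBounded.subset_closedBall 0
  rw [Real.closedBall_eq_Icc, zero_sub, zero_add] at hR
  refine IntegrableOn.mono_set ?_ hR
  rw [← integrable_indicator_iff measurableSet_Icc]
  have hloc : ∀ {f : ℝ → ℝ}, LocallyIntegrableOn f (Set.Ici 0) →
      IntegrableOn ((Set.Icc 0 R).indicator f) (Set.Ioi 0) := by
    intro f hf
    have h1 : IntegrableOn f (Set.Icc 0 R) :=
      hf.integrableOn_compact_subset (fun x hx => hx.1) isCompact_Icc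
    exact ((integrable_indicator_iff measurableSet_Icc).2 h1).integrableOn
  refine (integrable_glue (hloc hf) (hloc hg)).congr (ae_of_all _ fun x => ?_)
  rw [glue_apply]
  simp only [Set.indicator_apply, Set.mem_Icc, glue_apply]
  split_ifs with h0 h1 h2 h3 h4 h5 <;> first | rfl | grind

/-- The function on the line glued from two functions on the half-line, as an element of `L²`. -/
def glueLp (u v : Lp ℂ 2 (volume.restrict (Set.Ioi (0 : ℝ)))) : LineL2 :=
  (memLp_glue (Lp.memLp u) (Lp.memLp v)).toLp _

theorem coeFn_glueLp (u v : Lp ℂ 2 (volume.restrict (Set.Ioi (0 : ℝ)))) :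
    glueLp u v =ᵐ[volume] glue u v :=
  MemLp.coeFn_toLp _

theorem glueLp_add (u v u' v' : Lp ℂ 2 (volume.restrict (Set.Ioi (0 : ℝ)))) :
    glueLp (u + u') (v + v') = glueLp u v + glueLp u' v' := by
  refine Lp.ext ?_
  filter_upwards [coeFn_glueLp (u + u') (v + v'), Lp.coeFn_add (glueLp u v) (glueLp u' v'),
    coeFn_glueLp u v, coeFn_glueLp u' v',
    glue_ae_eq (Lp.coeFn_add u u') (Lp.coeFn_add v v')] with x h1 h2 h3 h4 h5
  rw [h1, h2, Pi.add_apply, h3, h4, h5]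
  simp only [glue_apply, Pi.add_apply]
  split_ifs <;> rfl

theorem glueLp_smul (c : ℂ) (u v : Lp ℂ 2 (volume.restrict (Set.Ioi (0 : ℝ)))) :
    glueLp (c • u) (c • v) = c • glueLp u v := by
  refine Lp.ext ?_
  filter_upwards [coeFn_glueLp (c • u) (c • v), Lp.coeFn_smul c (glueLp u v),
    coeFn_glueLp u v, glue_ae_eq (Lp.coeFn_smul c u) (Lp.coeFn_smul c v)] with x h1 h2 h3 h4
  rw [h1, h2, Pi.smul_apply, h3, h4]
  simp only [glue_apply, Pi.smul_apply]
  split_ifs <;> rfl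

theorem norm_glueLp_sq (u v : Lp ℂ 2 (volume.restrict (Set.Ioi (0 : ℝ)))) :
    ‖glueLp u v‖ ^ 2 = ‖u‖ ^ 2 + ‖v‖ ^ 2 := by
  rw [norm_sq_eq_integral, norm_sq_eq_integral u, norm_sq_eq_integral v,
    ← integral_glue (integrable_norm_sq u) (integrable_norm_sq v)]
  refine integral_congr_ae ((coeFn_glueLp u v).mono fun x hx => ?_)
  simp only [hx]
  exact congrFun (glue_comp (fun z : ℂ => ‖z‖ ^ 2) u v) x

theorem IsRep.integral_Ioi {u g w : ℝ → ℂ} (h : IsRep (Set.Ioi 0) u g w)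
    (hg : MemLp g 2 (volume.restrict (Set.Ioi (0 : ℝ)))) {φ : ℝ → ℝ} (hφ : ContDiff ℝ 1 φ)
    (hc : HasCompactSupport φ) :
    ∫ x in Set.Ioi (0 : ℝ), ((deriv φ x : ℝ) : ℂ) * u x
      = -(φ 0 * w 0) - ∫ x in Set.Ioi (0 : ℝ), (φ x : ℂ) * g x := by
  have h1 := integral_Ioi_deriv_mul_primitive (locallyIntegrable_indicator isOpen_Ioi hg)
    h.sub_eq hφ hc 0
  have h2 : ∫ x in Set.Ioi (0 : ℝ), ((deriv φ x : ℝ) : ℂ) * w x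
      = ∫ x in Set.Ioi (0 : ℝ), ((deriv φ x : ℝ) : ℂ) * u x :=
    integral_congr_ae (h.ae_eq.mono fun x hx => by simp only [hx])
  have h3 : ∫ x in Set.Ioi (0 : ℝ), (φ x : ℂ) * (Set.Ioi (0 : ℝ)).indicator g x
      = ∫ x in Set.Ioi (0 : ℝ), (φ x : ℂ) * g x :=
    setIntegral_congr_fun measurableSet_Ioi fun x hx => by simp only [Set.indicator_of_mem hx]
  rw [← h2, h1, h3]

/-- The two halves leave boundary terms −φ(0)c and +φ(0)c, which cancel because both functions have
the same value at the vertex. The minus sign in the derivative comes from the reflection. -/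
theorem hasWeakDeriv_glue {u v : ℝ → ℂ} (hu : MemH1 (Set.Ioi 0) u) (hv : MemH1 (Set.Ioi 0) v)
    {c : ℂ} (huc : HasBoundaryValue u c) (hvc : HasBoundaryValue v c) :
    HasWeakDeriv Set.univ (glue u v)
      (glue (weakDeriv (Set.Ioi 0) u) (-weakDeriv (Set.Ioi 0) v)) := by
  intro φ hφ hc _
  obtain ⟨w, hw⟩ := hu.exists_isRep isOpen_Ioi isUpperSet_Ioi_zero
  obtain ⟨w', hw'⟩ := hv.exists_isRep isOpen_Ioi isUpperSet_Ioi_zero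
  have hw0 := hw.eq_of_hasBoundaryValue (memLp_weakDeriv _) huc
  have hw0' := hw'.eq_of_hasBoundaryValue (memLp_weakDeriv _) hvc
  set ψ : ℝ → ℝ := fun x => φ (-x) with hψ
  have hψ1 : ContDiff ℝ 1 ψ := (hφ.of_le (by simp)).comp contDiff_neg
  have hψc : HasCompactSupport ψ := hc.comp_homeomorph (Homeomorph.neg ℝ)
  have hψd : ∀ x, deriv φ (-x) = -deriv ψ x := fun x => by
    rw [hψ, deriv_comp_neg, neg_neg]
  have hd : Continuous (deriv φ) := hφ.continuous_deriv (by simp)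
  have hψd' : Continuous (deriv ψ) := hψ1.continuous_deriv le_rfl
  have h1 := hw.integral_Ioi (memLp_weakDeriv _) (hφ.of_le (by simp)) hc
  have h2 := hw'.integral_Ioi (memLp_weakDeriv _) hψ1 hψc
  have hL : (fun x => ((deriv φ x : ℝ) : ℂ) * glue u v x)
      = glue (fun x => ((deriv φ x : ℝ) : ℂ) * u x)
        (fun x => -(((deriv ψ x : ℝ) : ℂ) * v x)) := by
    funext x
    simp only [glue_apply]
    split_ifs
    · rfl
    · have := hψd (-x)
      rw [neg_neg] at this
      rw [this]
      push_cast
      ring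
  have hR : (fun x => (φ x : ℂ) * glue (weakDeriv (Set.Ioi 0) u) (-weakDeriv (Set.Ioi 0) v) x)
      = glue (fun x => (φ x : ℂ) * weakDeriv (Set.Ioi 0) u x)
        (fun x => -((ψ x : ℂ) * weakDeriv (Set.Ioi 0) v x)) := by
    funext x
    simp only [glue_apply, hψ, neg_neg, Pi.neg_apply]
    split_ifs
    · rfl
    · ring
  rw [Measure.restrict_univ, hL, hR,
    integral_glue (g := fun x => -(((deriv ψ x : ℝ) : ℂ) * v x))
      (integrable_ofReal_mul hu.1 hd hc.deriv)
      (integrable_ofReal_mul hv.1 hψd' hψc.deriv).neg,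
    integral_glue (g := fun x => -((ψ x : ℂ) * weakDeriv (Set.Ioi 0) v x))
      (integrable_ofReal_mul (memLp_weakDeriv _) hφ.continuous hc)
      (integrable_ofReal_mul (memLp_weakDeriv _) hψ1.continuous hψc).neg,
    integral_neg, integral_neg, h1, h2, hw0, hw0']
  simp only [hψ, neg_zero]
  ring

theorem volume_eq_restrict_univ : (volume : Measure ℝ) = volume.restrict Set.univ :=
  Measure.restrict_univ.symm

theorem glueLp_memH1 {u v : Lp ℂ 2 (volume.restrict (Set.Ioi (0 : ℝ)))}
    (hu : MemH1 (Set.Ioi 0) u) (hv : MemH1 (Set.Ioi 0) v)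
    {c : ℂ} (huc : HasBoundaryValue u c) (hvc : HasBoundaryValue v c) :
    MemH1 Set.univ (glueLp u v) ∧ weakDeriv Set.univ (glueLp u v) =ᵐ[volume]
      glue (weakDeriv (Set.Ioi 0) u) (-weakDeriv (Set.Ioi 0) v) := by
  have hg : MemLp (glue (weakDeriv (Set.Ioi 0) u) (-weakDeriv (Set.Ioi 0) v)) 2
      (volume.restrict Set.univ) := by
    rw [Measure.restrict_univ]
    exact memLp_glue (memLp_weakDeriv _) (memLp_weakDeriv _).neg
  have hw : HasWeakDeriv Set.univ (glueLp u v)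
      (glue (weakDeriv (Set.Ioi 0) u) (-weakDeriv (Set.Ioi 0) v)) :=
    (hasWeakDeriv_glue hu hv huc hvc).congr
      (by rw [Measure.restrict_univ]; exact (coeFn_glueLp u v).symm) ae_eq_rfl
  refine ⟨⟨by rw [Measure.restrict_univ]; exact Lp.memLp _, _, hg, hw⟩, ?_⟩
  have := weakDeriv_ae_eq isOpen_univ hg hw
  rwa [Measure.restrict_univ] at this

theorem glueLp_mem_edgeDomain {V V' : ℝ → ℝ}
    {u v : Lp ℂ 2 (volume.restrict (Set.Ioi (0 : ℝ)))}
    (hu : u ∈ edgeDomain (Set.Ioi 0) (volume.restrict (Set.Ioi 0)) V)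
    (hv : v ∈ edgeDomain (Set.Ioi 0) (volume.restrict (Set.Ioi 0)) V')
    {c : ℂ} (huc : HasBoundaryValue u c) (hvc : HasBoundaryValue v c) :
    glueLp u v ∈ edgeDomain Set.univ volume (glue V V') := by
  refine ⟨(glueLp_memH1 hu.1 hv.1 huc hvc).1, (integrable_glue hu.2 hv.2).congr ?_⟩
  filter_upwards [coeFn_glueLp u v] with x hx
  rw [hx]
  exact (congrFun (glue_comp₂ (fun (a : ℝ) (z : ℂ) => max a 0 * ‖z‖ ^ 2) V V' u v) x).symm

theorem edgeForm_glueLp {V V' : ℝ → ℝ}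
    (hV : IsEdgePotential (volume.restrict (Set.Ioi 0)) V)
    (hV' : IsEdgePotential (volume.restrict (Set.Ioi 0)) V')
    {u v : Lp ℂ 2 (volume.restrict (Set.Ioi (0 : ℝ)))}
    (hu : u ∈ edgeDomain (Set.Ioi 0) (volume.restrict (Set.Ioi 0)) V)
    (hv : v ∈ edgeDomain (Set.Ioi 0) (volume.restrict (Set.Ioi 0)) V')
    {c : ℂ} (huc : HasBoundaryValue u c) (hvc : HasBoundaryValue v c) :
    edgeForm Set.univ volume (glue V V') (glueLp u v) (glueLp u v)
      = edgeForm (Set.Ioi 0) (volume.restrict (Set.Ioi 0)) V u u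
        + edgeForm (Set.Ioi 0) (volume.restrict (Set.Ioi 0)) V' v v := by
  unfold edgeForm
  rw [← integral_glue (integrable_edgeForm isOpen_Ioi isUpperSet_Ioi_zero rfl hV hu hu)
    (integrable_edgeForm isOpen_Ioi isUpperSet_Ioi_zero rfl hV' hv hv)]
  refine integral_congr_ae ?_
  filter_upwards [coeFn_glueLp u v, (glueLp_memH1 hu.1 hv.1 huc hvc).2] with x h1 h2
  rw [h1, h2]
  simp only [glue_apply]
  split_ifs <;> simp

end Glue

/-! ### From the line to the star graph -/

section UpperBound

theorem LinePotential.isEdgePotential {p : ℝ} (hp : 1 ≤ p) {V : ℝ → ℝ} (hV : LinePotential p V) :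
    IsEdgePotential volume V :=
  isEdgePotential_of_memLp hp hV.1.aestronglyMeasurable hV.2

theorem StarPotential.linePotential_glue {N : ℕ} {p : ℝ} {V : Fin N → ℝ → ℝ}
    (hV : StarPotential p V) (i j : Fin N) : LinePotential p (glue (V i) (V j)) := by
  refine ⟨?_, ?_⟩
  · rw [glue_comp (fun a : ℝ => max a 0)]
    exact locallyIntegrable_glue (hV i).1 (hV j).1
  · rw [glue_comp (fun a : ℝ => max (-a) 0)]
    exact memLp_glue (hV i).2 (hV j).2

/-- Relaxing the vertex condition of the star graph: the edges are joined in pairs to lines. An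
edge may be joined with its own mirror image if the weights are chosen accordingly. -/
theorem negTrace_star_le_sum {N : ℕ} {ι : Type} [Fintype ι] {p γ : ℝ} (hp : 1 ≤ p) (hγ : 0 ≤ γ)
    {V : Fin N → ℝ → ℝ} (hV : StarPotential p V) (r l : ι → Fin N) (a : ι → ℝ)
    (ha : ∀ f : Fin N → ℝ, ∑ i, a i ^ 2 * (f (r i) + f (l i)) = ∑ j, f j) :
    negTrace (starDomain V) (starForm V) γ
      ≤ ∑ i, negTrace (lineDomain (glue (V (r i)) (V (l i))))
        (lineForm (glue (V (r i)) (V (l i)))) γ := by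
  have hVe := fun j => hV.isEdgePotential hp j
  have hVl : ∀ i, IsEdgePotential volume (glue (V (r i)) (V (l i))) := fun i =>
    (hV.linePotential_glue (r i) (l i)).isEdgePotential hp
  have hfi := fun i => isHermitianForm_edge isOpen_univ isUpperSet_univ volume_eq_restrict_univ
    (hVl i)
  -- By `ha` the squared weights on each edge add up to one over all its occurrences, so J preserves
  -- both norm and form.
  let J : StarL2 N →ₗ[ℂ] PiLp 2 fun _ : ι => LineL2 :=
    { toFun := fun u => WithLp.toLp 2 fun i => (a i : ℂ) • glueLp (u (r i)) (u (l i))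
      map_add' := fun u v => by
        refine PiLp.ext fun i => ?_
        change (a i : ℂ) • glueLp (u (r i) + v (r i)) (u (l i) + v (l i))
          = (a i : ℂ) • glueLp (u (r i)) (u (l i)) + (a i : ℂ) • glueLp (v (r i)) (v (l i))
        rw [glueLp_add, smul_add]
      map_smul' := fun c u => by
        refine PiLp.ext fun i => ?_
        change (a i : ℂ) • glueLp (c • u (r i)) (c • u (l i))
          = c • (a i : ℂ) • glueLp (u (r i)) (u (l i))
        rw [glueLp_smul, smul_comm] }
  have hJ : ∀ u i, J u i = (a i : ℂ) • glueLp (u (r i)) (u (l i)) := fun u i => rfl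
  refine le_trans (negTrace_le_of_isometry (isHermitianForm_star hVe)
    (isHermitianForm_graph isOpen_univ isUpperSet_univ volume_eq_restrict_univ hVl)
    (hasMinimizers_graphDomain isOpen_univ isUpperSet_univ volume_eq_restrict_univ hVl)
    J ?_ ?_ ?_ hγ)
    (negTrace_graph_le isOpen_univ isUpperSet_univ volume_eq_restrict_univ hVl γ)
  · intro u hu i
    obtain ⟨h1, c, hc⟩ := mem_starDomain.1 hu
    rw [hJ]
    exact (hfi i).smul_mem _ (glueLp_mem_edgeDomain (h1 _) (h1 _) (hc _) (hc _))
  · intro u _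
    rw [PiLp.norm_eq_of_L2, PiLp.norm_eq_of_L2, ← ha]
    congr 1
    refine Finset.sum_congr rfl fun i _ => ?_
    rw [hJ, norm_smul, mul_pow, norm_glueLp_sq, Complex.norm_real, Real.norm_eq_abs, sq_abs]
  · intro u hu
    obtain ⟨h1, c, hc⟩ := mem_starDomain.1 hu
    rw [starForm_eq, graphForm, graphForm, Complex.re_sum, Complex.re_sum, ← ha]
    refine Finset.sum_congr rfl fun i _ => ?_
    rw [hJ, (hfi i).re_smul_smul _ (glueLp_mem_edgeDomain (h1 _) (h1 _) (hc _) (hc _)),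
      edgeForm_glueLp (hVe _) (hVe _) (h1 _) (h1 _) (hc _) (hc _), Complex.norm_real,
      Real.norm_eq_abs, sq_abs, Complex.add_re]

theorem lintegral_glue_potential (V V' : ℝ → ℝ) (p : ℝ) :
    ∫⁻ x, ENNReal.ofReal (max (-glue V V' x) 0 ^ p)
      = (∫⁻ x in Set.Ioi (0 : ℝ), ENNReal.ofReal (max (-V x) 0 ^ p))
        + ∫⁻ x in Set.Ioi (0 : ℝ), ENNReal.ofReal (max (-V' x) 0 ^ p) := by
  rw [← lintegral_glue, ← glue_comp (fun a : ℝ => ENNReal.ofReal (max (-a) 0 ^ p))]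

theorem negTrace_star_le_mul {N : ℕ} {ι : Type} [Fintype ι] {γ : ℝ} (hγ : 1 / 2 ≤ γ)
    {L : ENNReal} (hL : LineLiebThirring γ L) {V : Fin N → ℝ → ℝ}
    (hV : StarPotential (γ + 1 / 2) V) (r l : ι → Fin N) (a : ι → ℝ)
    (ha : ∀ f : Fin N → ℝ, ∑ i, a i ^ 2 * (f (r i) + f (l i)) = ∑ j, f j) :
    negTrace (starDomain V) (starForm V) γ
      ≤ L * ∑ i, ((∫⁻ x in Set.Ioi (0 : ℝ), ENNReal.ofReal (max (-V (r i) x) 0 ^ (γ + 1 / 2)))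
        + ∫⁻ x in Set.Ioi (0 : ℝ), ENNReal.ofReal (max (-V (l i) x) 0 ^ (γ + 1 / 2))) := by
  refine (negTrace_star_le_sum (by linarith) (by linarith) hV r l a ha).trans ?_
  rw [Finset.mul_sum]
  refine Finset.sum_le_sum fun i _ => ?_
  rw [← lintegral_glue_potential]
  exact hL _ (hV.linePotential_glue _ _)

/-- The edges split into N/2 disjoint pairs with weight 1; each integral is counted exactly once. -/
theorem starLiebThirring_of_even {γ : ℝ} (hγ : 1 / 2 ≤ γ) {N : ℕ} (hN : Even N) {L : ENNReal}
    (hL : LineLiebThirring γ L) : StarLiebThirring γ N L := by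
  intro V hV
  obtain ⟨M, hM⟩ := hN
  have e : Fin N ≃ Fin M × Bool := Fintype.equivOfCardEq (by simp; omega)
  have hsum : ∀ {A : Type} [AddCommMonoid A] (f : Fin N → A),
      ∑ m, (f (e.symm (m, true)) + f (e.symm (m, false))) = ∑ j, f j := by
    intro A _ f
    rw [← e.symm.sum_comp f, Fintype.sum_prod_type]
    exact Finset.sum_congr rfl fun m _ => by rw [Fintype.sum_bool]
  refine (negTrace_star_le_mul hγ hL hV (fun m => e.symm (m, true)) (fun m => e.symm (m, false))
    (fun _ => 1) fun f => ?_).trans (le_of_eq ?_)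
  · simp only [one_pow, one_mul, hsum]
  · rw [hsum fun j => ∫⁻ x in Set.Ioi (0 : ℝ), ENNReal.ofReal (max (-V j x) 0 ^ (γ + 1 / 2))]

/-- The edge whose potential contributes least is paired with itself and counted twice. The least of
N terms is at most their average, so the total grows by at most the factor 1 + 1/N. -/
theorem starLiebThirring_of_odd {γ : ℝ} (hγ : 1 / 2 ≤ γ) {N : ℕ} (hN : Odd N) {L : ENNReal}
    (hL : LineLiebThirring γ L) :
    StarLiebThirring γ N (((N : ENNReal) + 1) / (N : ENNReal) * L) := by
  intro V hV
  obtain ⟨M, hM⟩ := hN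
  have hN0 : N ≠ 0 := by omega
  have : Nonempty (Fin N) := ⟨⟨0, by omega⟩⟩
  set I : Fin N → ENNReal := fun j =>
    ∫⁻ x in Set.Ioi (0 : ℝ), ENNReal.ofReal (max (-V j x) 0 ^ (γ + 1 / 2)) with hI
  obtain ⟨j₀, hj₀⟩ := Finite.exists_min I
  have e₀ : Fin N ≃ Option (Fin M × Bool) := Fintype.equivOfCardEq (by simp; omega)
  -- A transposition turns an arbitrary labelling into one whose leftover edge is `j₀`.
  obtain ⟨e, he⟩ : ∃ e : Fin N ≃ Option (Fin M × Bool), e.symm none = j₀ :=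
    ⟨(Equiv.swap j₀ (e₀.symm none)).trans e₀, by simp⟩
  have hsum : ∀ {A : Type} [AddCommMonoid A] (f : Fin N → A),
      f j₀ + ∑ m, (f (e.symm (some (m, true))) + f (e.symm (some (m, false)))) = ∑ j, f j := by
    intro A _ f
    rw [← e.symm.sum_comp f, Fintype.sum_option, he, Fintype.sum_prod_type]
    congr 1
    exact Finset.sum_congr rfl fun m _ => by rw [Fintype.sum_bool]
  refine (negTrace_star_le_mul hγ hL hV
    (fun o : Option (Fin M) => o.elim j₀ fun m => e.symm (some (m, true)))
    (fun o => o.elim j₀ fun m => e.symm (some (m, false)))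
    -- The mirrored edge appears twice on its line, so its squared weight is 1/2.
    (fun o => o.elim (Real.sqrt 2)⁻¹ fun _ => 1) fun f => ?_).trans ?_
  · rw [Fintype.sum_option, ← hsum f]
    simp only [Option.elim_none, Option.elim_some, one_pow, one_mul, inv_pow]
    rw [Real.sq_sqrt (by norm_num)]
    ring
  · rw [Fintype.sum_option]
    simp only [Option.elim_none, Option.elim_some]
    change L * (I j₀ + I j₀ + ∑ m, (I (e.symm (some (m, true))) + I (e.symm (some (m, false)))))
      ≤ ((N : ENNReal) + 1) / (N : ENNReal) * L * ∑ j, I j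
    rw [add_assoc, hsum I, mul_comm _ L, mul_assoc]
    gcongr
    have hNt : (N : ENNReal) ≠ ⊤ := ENNReal.natCast_ne_top N
    have hNz : (N : ENNReal) ≠ 0 := by exact_mod_cast hN0
    have h1 : I j₀ ≤ (∑ j, I j) / N := by
      rw [ENNReal.le_div_iff_mul_le (Or.inl hNz) (Or.inl hNt), mul_comm, ← nsmul_eq_mul]
      simpa using Finset.card_nsmul_le_sum Finset.univ I (I j₀) fun j _ => hj₀ j
    calc I j₀ + ∑ j, I j ≤ (∑ j, I j) / N + ∑ j, I j := by gcongr
      _ = ((N : ENNReal) + 1) / (N : ENNReal) * ∑ j, I j := by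
        rw [ENNReal.add_div, ENNReal.div_self hNz hNt, add_mul, one_mul, add_comm, one_div,
          mul_comm, div_eq_mul_inv, mul_comm]

end UpperBound

/-! ### From the star graph to the line -/

section Cutoff

local notation "χ" => Real.smoothTransition

/-- Every such point is a global minimum of the cutoff, which also settles the endpoint 0. -/
theorem deriv_smoothTransition_of_nonpos {x : ℝ} (hx : x ≤ 0) : deriv χ x = 0 := by
  refine IsLocalMin.deriv_eq_zero (Eventually.of_forall fun y => ?_)
  rw [Real.smoothTransition.zero_of_nonpos hx]
  exact Real.smoothTransition.nonneg y

theorem deriv_smoothTransition_of_one_le {x : ℝ} (hx : 1 ≤ x) : deriv χ x = 0 := by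
  refine IsLocalMax.deriv_eq_zero (Eventually.of_forall fun y => ?_)
  rw [Real.smoothTransition.one_of_one_le hx]
  exact Real.smoothTransition.le_one y

theorem contDiff_smoothTransition : ContDiff ℝ (⊤ : ℕ∞) χ := Real.smoothTransition.contDiff

theorem continuous_deriv_smoothTransition : Continuous (deriv χ) :=
  contDiff_smoothTransition.continuous_deriv (by simp)

theorem exists_bound_deriv_smoothTransition : ∃ C : ℝ, 0 ≤ C ∧ ∀ x, |deriv χ x| ≤ C := by
  obtain ⟨C, hC⟩ := (isCompact_Icc (a := (0 : ℝ)) (b := 1)).exists_bound_of_continuousOn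
    continuous_deriv_smoothTransition.continuousOn
  have hC0 : 0 ≤ C := (norm_nonneg _).trans (hC 0 (by simp))
  refine ⟨C, hC0, fun x => ?_⟩
  by_cases hx : x ∈ Set.Icc (0 : ℝ) 1
  · exact hC x hx
  · have : deriv χ x = 0 := by
      rcases lt_or_ge x 0 with h | h
      · exact deriv_smoothTransition_of_nonpos h.le
      · refine deriv_smoothTransition_of_one_le ?_
        by_contra hh
        exact hx ⟨h, (not_le.1 hh).le⟩
    rw [this, abs_zero]
    exact hC0

theorem abs_smoothTransition_le (x : ℝ) : |χ x| ≤ 1 := by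
  rw [abs_of_nonneg (Real.smoothTransition.nonneg x)]
  exact Real.smoothTransition.le_one x

theorem memLp_ofReal_mul {μ : Measure ℝ} {f : ℝ → ℂ} (hf : MemLp f 2 μ) {k : ℝ → ℝ}
    (hk : Continuous k) {C : ℝ} (hC : ∀ x, |k x| ≤ C) :
    MemLp (fun x => (k x : ℂ) * f x) 2 μ := by
  refine (hf.const_mul (C : ℂ)).of_le
    ((Complex.continuous_ofReal.comp hk).aestronglyMeasurable.mul hf.1) (ae_of_all _ fun x => ?_)
  rw [norm_mul, norm_mul, Complex.norm_real, Complex.norm_real, Real.norm_eq_abs,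
    Real.norm_eq_abs]
  exact mul_le_mul_of_nonneg_right ((hC x).trans (le_abs_self C)) (norm_nonneg _)

theorem HasWeakDeriv.restrict {Ω : Set ℝ} {u g : ℝ → ℂ} (h : HasWeakDeriv Set.univ u g) :
    HasWeakDeriv Ω u g := by
  intro φ hφ hc hs
  rw [setIntegral_eq_of_tsupport_subset (tsupport_deriv_subset.trans hs),
    setIntegral_eq_of_tsupport_subset hs]
  simpa using h φ hφ hc (Set.subset_univ _)

theorem HasWeakDeriv.translate {u g : ℝ → ℂ} (h : HasWeakDeriv Set.univ u g) (R : ℝ) :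
    HasWeakDeriv Set.univ (fun x => u (x - R)) fun x => g (x - R) := by
  intro φ hφ hc _
  have h1 := h (fun x => φ (x + R)) (hφ.comp (contDiff_id.add contDiff_const))
    (hc.comp_homeomorph (Homeomorph.addRight R)) (Set.subset_univ _)
  simp only [Measure.restrict_univ, deriv_comp_add_const] at h1 ⊢
  rw [← integral_sub_right_eq_self (fun x => ((deriv φ (x + R) : ℝ) : ℂ) * u x) R,
    ← integral_sub_right_eq_self (fun x => (φ (x + R) : ℂ) * g x) R] at h1
  simpa using h1

/-- The Leibniz rule: use φk as a test function for u and move the term with k′ to the other side.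
-/
theorem HasWeakDeriv.smooth_mul {Ω : Set ℝ} {u g : ℝ → ℂ} (h : HasWeakDeriv Ω u g)
    (hu : MemLp u 2 (volume.restrict Ω)) (hg : MemLp g 2 (volume.restrict Ω)) {k : ℝ → ℝ}
    (hk : ContDiff ℝ (⊤ : ℕ∞) k) :
    HasWeakDeriv Ω (fun x => (k x : ℂ) * u x)
      fun x => ((deriv k x : ℝ) : ℂ) * u x + (k x : ℂ) * g x := by
  intro φ hφ hc hs
  have hd : Continuous (deriv φ) := hφ.continuous_deriv (by simp)
  have hkd : Continuous (deriv k) := hk.continuous_deriv (by simp)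
  have h1 := h (fun x => φ x * k x) (hφ.mul hk) hc.mul_right
    ((closure_mono (Function.support_mul_subset_left _ _)).trans hs)
  have hder : ∀ x, deriv (fun x => φ x * k x) x = deriv φ x * k x + φ x * deriv k x := fun x =>
    deriv_fun_mul (hφ.differentiable (by simp) x) (hk.differentiable (by simp) x)
  simp only [hder] at h1
  have i1 := integrable_ofReal_mul hu (φ := fun x => deriv φ x * k x)
    (hd.mul hk.continuous) hc.deriv.mul_right
  have i2 := integrable_ofReal_mul hu (φ := fun x => φ x * deriv k x)
    (hφ.continuous.mul hkd) hc.mul_right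
  have i3 := integrable_ofReal_mul hg (φ := fun x => φ x * k x)
    (hφ.continuous.mul hk.continuous) hc.mul_right
  have e1 : ∀ x, ((deriv φ x * k x + φ x * deriv k x : ℝ) : ℂ) * u x
      = ((deriv φ x * k x : ℝ) : ℂ) * u x + ((φ x * deriv k x : ℝ) : ℂ) * u x := fun x => by
    push_cast; ring
  simp only [e1] at h1
  rw [integral_add i1 i2] at h1
  have e2 : ∀ x, ((deriv φ x : ℝ) : ℂ) * ((k x : ℂ) * u x)
      = ((deriv φ x * k x : ℝ) : ℂ) * u x := fun x => by push_cast; ring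
  have e3 : ∀ x, (φ x : ℂ) * (((deriv k x : ℝ) : ℂ) * u x + (k x : ℂ) * g x)
      = ((φ x * deriv k x : ℝ) : ℂ) * u x + ((φ x * k x : ℝ) : ℂ) * g x := fun x => by
    push_cast; ring
  simp only [e2, e3]
  rw [integral_add i2 i3, neg_add, ← h1]
  ring

theorem memLp_translate {p : ENNReal} {F : Type*} [NormedAddCommGroup F] {f : ℝ → F}
    (hf : MemLp f p volume) (R : ℝ) : MemLp (fun x => f (x - R)) p volume :=
  hf.comp_measurePreserving (measurePreserving_sub_right volume R)

theorem memLp_cutoff (u : LineL2) (R : ℝ) :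
    MemLp (fun x => (χ x : ℂ) * u (x - R)) 2 (volume.restrict (Set.Ioi (0 : ℝ))) :=
  memLp_ofReal_mul ((memLp_translate (Lp.memLp u) R).restrict _) Real.smoothTransition.continuous
    abs_smoothTransition_le

/-- A function on the line, shifted to the right and cut off near the vertex. -/
def cutoffLp (R : ℝ) (u : LineL2) : Lp ℂ 2 (volume.restrict (Set.Ioi (0 : ℝ))) :=
  (memLp_cutoff u R).toLp _

theorem coeFn_cutoffLp (R : ℝ) (u : LineL2) :
    cutoffLp R u =ᵐ[volume.restrict (Set.Ioi (0 : ℝ))] fun x => (χ x : ℂ) * u (x - R) :=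
  MemLp.coeFn_toLp _

theorem memLp_weakDeriv_univ (u : ℝ → ℂ) : MemLp (weakDeriv Set.univ u) 2 volume :=
  memLp_weakDeriv_of_eq volume_eq_restrict_univ u

theorem cutoffLp_memH1 (R : ℝ) {u : LineL2} (hu : MemH1 Set.univ u) :
    MemH1 (Set.Ioi 0) (cutoffLp R u) ∧
      weakDeriv (Set.Ioi 0) (cutoffLp R u) =ᵐ[volume.restrict (Set.Ioi (0 : ℝ))]
        fun x => ((deriv χ x : ℝ) : ℂ) * u (x - R) + (χ x : ℂ) * weakDeriv Set.univ u (x - R) := by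
  obtain ⟨C, -, hC⟩ := exists_bound_deriv_smoothTransition
  have hu2 : MemLp (fun x => u (x - R)) 2 (volume.restrict (Set.Ioi (0 : ℝ))) :=
    (memLp_translate (Lp.memLp u) R).restrict _
  have hg2 : MemLp (fun x => weakDeriv Set.univ u (x - R)) 2
      (volume.restrict (Set.Ioi (0 : ℝ))) :=
    (memLp_translate (memLp_weakDeriv_univ u) R).restrict _
  have hg : MemLp (fun x => ((deriv χ x : ℝ) : ℂ) * u (x - R)
      + (χ x : ℂ) * weakDeriv Set.univ u (x - R)) 2 (volume.restrict (Set.Ioi (0 : ℝ))) :=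
    (memLp_ofReal_mul hu2 continuous_deriv_smoothTransition hC).add
      (memLp_ofReal_mul hg2 Real.smoothTransition.continuous abs_smoothTransition_le)
  have hw := ((hu.hasWeakDeriv.translate R).restrict (Ω := Set.Ioi 0)).smooth_mul hu2 hg2
    contDiff_smoothTransition
  have hw' := hw.congr (coeFn_cutoffLp R u).symm ae_eq_rfl
  exact ⟨⟨Lp.memLp _, _, hg, hw'⟩, weakDeriv_ae_eq isOpen_Ioi hg hw'⟩

/-- The cutoff vanishes at the vertex, so the function can be extended by zero to the other edges.
-/
theorem cutoffLp_hasBoundaryValue (R : ℝ) {u : LineL2} (hu : MemH1 Set.univ u) :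
    HasBoundaryValue (cutoffLp R u) 0 := by
  obtain ⟨w, hw⟩ := hu.exists_isRep isOpen_univ isUpperSet_univ
  have hwc := hw.continuous isOpen_univ (memLp_weakDeriv _)
  have hae := hw.ae_eq
  rw [Measure.restrict_univ] at hae
  refine ⟨fun x => (χ x : ℂ) * w (x - R), ?_, ?_, ?_⟩
  · exact ((Complex.continuous_ofReal.comp Real.smoothTransition.continuous).mul
      (hwc.comp (continuous_sub_right R))).continuousOn
  · refine EventuallyEq.trans ?_ (coeFn_cutoffLp R u).symm
    have := ((measurePreserving_sub_right volume R).quasiMeasurePreserving.ae_eq_comp hae)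
    filter_upwards [ae_restrict_of_ae this] with x hx
    simp only [Function.comp_apply] at hx
    rw [hx]
  · simp

theorem integrable_translate {F : Type*} [NormedAddCommGroup F] {f : ℝ → F}
    (hf : Integrable f) (R : ℝ) : Integrable fun x => f (x - R) := by
  rw [← memLp_one_iff_integrable] at hf ⊢
  exact memLp_translate hf R

theorem cutoffLp_mem_edgeDomain (R : ℝ) {V : ℝ → ℝ} {u : LineL2}
    (hu : u ∈ edgeDomain Set.univ volume V) :
    cutoffLp R u ∈ edgeDomain (Set.Ioi 0) (volume.restrict (Set.Ioi 0)) fun x => V (x - R) := by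
  refine ⟨(cutoffLp_memH1 R hu.1).1, ?_⟩
  have h1 : Integrable (fun x => (χ x ^ 2) * (max (V (x - R)) 0 * ‖u (x - R)‖ ^ 2))
      (volume.restrict (Set.Ioi (0 : ℝ))) := by
    refine (integrable_translate hu.2 R).restrict.bdd_mul (c := 1)
      (Real.smoothTransition.continuous.pow 2).aestronglyMeasurable (ae_of_all _ fun x => ?_)
    rw [norm_pow, Real.norm_eq_abs]
    exact pow_le_one₀ (abs_nonneg _) (abs_smoothTransition_le x)
  refine h1.congr ?_
  filter_upwards [coeFn_cutoffLp R u] with x hx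
  rw [hx, norm_mul, mul_pow, Complex.norm_real, Real.norm_eq_abs, sq_abs]
  ring

theorem setIntegral_Ioi_translate {F : ℝ → ℂ} {R : ℝ} (hF : ∀ x, x + R ≤ 0 → F x = 0) :
    ∫ x in Set.Ioi 0, F (x - R) = ∫ x, F x := by
  rw [← integral_sub_right_eq_self F R]
  refine setIntegral_eq_integral_of_forall_compl_eq_zero fun x hx => hF _ ?_
  rw [sub_add_cancel]
  exact not_lt.1 hx

theorem inner_cutoffLp (R : ℝ) (u v : LineL2) :
    inner ℂ (cutoffLp R u) (cutoffLp R v)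
      = ∫ x, ((χ (x + R) : ℂ) ^ 2) * (starRingEnd ℂ (u x) * v x) := by
  rw [L2.inner_def]
  refine Eq.trans (integral_congr_ae ?_) (setIntegral_Ioi_translate (R := R) fun x hx => ?_)
  · filter_upwards [coeFn_cutoffLp R u, coeFn_cutoffLp R v] with x h1 h2
    rw [h1, h2, RCLike.inner_apply, sub_add_cancel, map_mul, Complex.conj_ofReal]
    ring
  · rw [Real.smoothTransition.zero_of_nonpos hx]
    simp

/-- Moved back to the line's coordinates, the dependence on R sits only in the cutoff χ(x + R),
ready for dominated convergence. -/
theorem edgeForm_cutoffLp (R : ℝ) {V : ℝ → ℝ} {u v : LineL2} (hu : MemH1 Set.univ u)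
    (hv : MemH1 Set.univ v) :
    edgeForm (Set.Ioi 0) (volume.restrict (Set.Ioi 0)) (fun x => V (x - R))
        (cutoffLp R u) (cutoffLp R v)
      = ∫ x, (starRingEnd ℂ (((deriv χ (x + R) : ℝ) : ℂ) * u x
            + (χ (x + R) : ℂ) * weakDeriv Set.univ u x)
          * (((deriv χ (x + R) : ℝ) : ℂ) * v x + (χ (x + R) : ℂ) * weakDeriv Set.univ v x)
        + ((χ (x + R) : ℂ) ^ 2) * ((V x : ℂ) * (starRingEnd ℂ (u x) * v x))) := by
  unfold edgeForm
  refine Eq.trans (integral_congr_ae ?_) (setIntegral_Ioi_translate (R := R) fun x hx => ?_)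
  · filter_upwards [coeFn_cutoffLp R u, coeFn_cutoffLp R v, (cutoffLp_memH1 R hu).2,
      (cutoffLp_memH1 R hv).2] with x h1 h2 h3 h4
    rw [h1, h2, h3, h4]
    simp only [sub_add_cancel, map_mul, Complex.conj_ofReal]
    ring
  · rw [Real.smoothTransition.zero_of_nonpos hx, deriv_smoothTransition_of_nonpos hx]
    simp

theorem eventually_one_le_add (x : ℝ) : ∀ᶠ R : ℕ in atTop, 1 ≤ x + (R : ℝ) := by
  filter_upwards [tendsto_natCast_atTop_atTop.eventually_ge_atTop (1 - x)] with R hR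
  linarith

theorem tendsto_inner_cutoffLp (u v : LineL2) :
    Tendsto (fun R : ℕ => inner ℂ (cutoffLp R u) (cutoffLp R v)) atTop (𝓝 (inner ℂ u v)) := by
  simp only [inner_cutoffLp]
  have hlim : inner ℂ u v = ∫ x, starRingEnd ℂ (u x) * v x := by
    rw [L2.inner_def]
    exact integral_congr_ae (ae_of_all _ fun x => by simp only [RCLike.inner_apply]; ring)
  rw [hlim]
  have hint := integrable_conj_mul (Lp.memLp u) (Lp.memLp v)
  refine tendsto_integral_of_dominated_convergence (fun x => ‖starRingEnd ℂ (u x) * v x‖)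
    (fun R => ?_) hint.norm (fun R => ae_of_all _ fun x => ?_) (ae_of_all _ fun x => ?_)
  · have : Continuous fun x : ℝ => ((χ (x + R) : ℂ)) ^ 2 :=
      (Complex.continuous_ofReal.comp (Real.smoothTransition.continuous.comp
        (continuous_add_const (R : ℝ)))).pow 2
    exact this.aestronglyMeasurable.mul hint.1
  · rw [norm_mul]
    refine mul_le_of_le_one_left (norm_nonneg _) ?_
    rw [norm_pow, Complex.norm_real]
    exact pow_le_one₀ (norm_nonneg _) (abs_smoothTransition_le _)
  · refine tendsto_const_nhds.congr' ?_
    filter_upwards [eventually_one_le_add x] with R hR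
    rw [Real.smoothTransition.one_of_one_le hR]
    simp

/-- At each fixed x the integrand equals that of the line form as soon as x + R ≥ 1. The domination
is uniform in R because χ and χ′ are bounded. -/
theorem tendsto_edgeForm_cutoffLp {V : ℝ → ℝ} (hV : IsEdgePotential volume V) {u v : LineL2}
    (hu : u ∈ edgeDomain Set.univ volume V) (hv : v ∈ edgeDomain Set.univ volume V) :
    Tendsto (fun R : ℕ => edgeForm (Set.Ioi 0) (volume.restrict (Set.Ioi 0))
      (fun x => V (x - R)) (cutoffLp R u) (cutoffLp R v)) atTop
      (𝓝 (edgeForm Set.univ volume V u v)) := by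
  obtain ⟨C, hC0, hC⟩ := exists_bound_deriv_smoothTransition
  simp only [edgeForm_cutoffLp _ hu.1 hv.1]
  have hint := integrable_potential_mul isOpen_univ isUpperSet_univ volume_eq_restrict_univ hV
    hu hv
  have hm : ∀ (f : LineL2) (R : ℕ), AEStronglyMeasurable (fun x =>
      ((deriv χ (x + R) : ℝ) : ℂ) * f x + (χ (x + R) : ℂ) * weakDeriv Set.univ f x) volume := by
    intro f R
    have h1 : Continuous fun x : ℝ => ((deriv χ (x + R) : ℝ) : ℂ) :=
      Complex.continuous_ofReal.comp (continuous_deriv_smoothTransition.comp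
        (continuous_add_const (R : ℝ)))
    have h2 : Continuous fun x : ℝ => (χ (x + R) : ℂ) :=
      Complex.continuous_ofReal.comp (Real.smoothTransition.continuous.comp
        (continuous_add_const (R : ℝ)))
    exact (h1.aestronglyMeasurable.mul (Lp.aestronglyMeasurable f)).add
      (h2.aestronglyMeasurable.mul (memLp_weakDeriv_univ f).1)
  have hb : ∀ f : LineL2, MemLp (fun x => C * ‖f x‖ + ‖weakDeriv Set.univ f x‖) 2 volume :=
    fun f => ((Lp.memLp f).norm.const_mul C).add (memLp_weakDeriv_univ f).norm
  have hle : ∀ (f : LineL2) (R : ℕ) (x : ℝ), ‖((deriv χ (x + R) : ℝ) : ℂ) * f x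
      + (χ (x + R) : ℂ) * weakDeriv Set.univ f x‖ ≤ C * ‖f x‖ + ‖weakDeriv Set.univ f x‖ := by
    intro f R x
    refine (norm_add_le _ _).trans (add_le_add ?_ ?_)
    · rw [norm_mul, Complex.norm_real]
      exact mul_le_mul_of_nonneg_right (hC _) (norm_nonneg _)
    · rw [norm_mul, Complex.norm_real]
      exact mul_le_of_le_one_left (norm_nonneg _) (abs_smoothTransition_le _)
  refine tendsto_integral_of_dominated_convergence
    (fun x => (C * ‖u x‖ + ‖weakDeriv Set.univ u x‖) * (C * ‖v x‖ + ‖weakDeriv Set.univ v x‖)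
      + ‖(V x : ℂ) * (starRingEnd ℂ (u x) * v x)‖)
    (fun R => ?_) (((hb u).integrable_mul (hb v)).add hint.norm)
    (fun R => ae_of_all _ fun x => ?_) (ae_of_all _ fun x => ?_)
  · have : Continuous fun x : ℝ => ((χ (x + R) : ℂ)) ^ 2 :=
      (Complex.continuous_ofReal.comp (Real.smoothTransition.continuous.comp
        (continuous_add_const (R : ℝ)))).pow 2
    exact ((Complex.continuous_conj.comp_aestronglyMeasurable (hm u R)).mul (hm v R)).add
      (this.aestronglyMeasurable.mul hint.1)
  · refine (norm_add_le _ _).trans (add_le_add ?_ ?_)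
    · rw [norm_mul, RCLike.norm_conj]
      exact mul_le_mul (hle u R x) (hle v R x) (norm_nonneg _) (by positivity)
    · rw [norm_mul]
      refine mul_le_of_le_one_left (norm_nonneg _) ?_
      rw [norm_pow, Complex.norm_real]
      exact pow_le_one₀ (norm_nonneg _) (abs_smoothTransition_le _)
  · refine tendsto_const_nhds.congr' ?_
    filter_upwards [eventually_one_le_add x] with R hR
    rw [Real.smoothTransition.one_of_one_le hR, deriv_smoothTransition_of_one_le hR]
    simp

end Cutoff

/-! ### Transplanting a line potential to one edge -/

section LowerBound

variable {N : ℕ}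

theorem locallyIntegrable_translate {f : ℝ → ℝ} (hf : LocallyIntegrable f) (R : ℝ) :
    LocallyIntegrable fun x => f (x - R) := by
  rw [locallyIntegrable_iff] at hf ⊢
  intro K hK
  have h := (measurePreserving_sub_right volume R).integrableOn_comp_preimage
    (Homeomorph.subRight R).measurableEmbedding (f := f) (s := (fun x => x - R) '' K)
  rw [Set.preimage_image_eq K (sub_left_injective)] at h
  exact h.2 (hf _ (hK.image (continuous_sub_right R)))

/-- The potential on the star graph that is a shifted copy of `V` on the edge `j₀` and vanishes on
the other edges. -/
def transplant (V : ℝ → ℝ) (R : ℝ) (j₀ j : Fin N) (x : ℝ) : ℝ :=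
  if j = j₀ then V (x - R) else 0

theorem transplant_self (V : ℝ → ℝ) (R : ℝ) (j₀ : Fin N) :
    transplant V R j₀ j₀ = fun x => V (x - R) := by
  funext x
  simp [transplant]

theorem transplant_of_ne (V : ℝ → ℝ) (R : ℝ) {j₀ j : Fin N} (h : j ≠ j₀) :
    transplant V R j₀ j = fun _ => 0 := by
  funext x
  simp [transplant, h]

theorem LinePotential.starPotential_transplant {p : ℝ} {V : ℝ → ℝ} (hV : LinePotential p V)
    (R : ℝ) (j₀ : Fin N) : StarPotential p (transplant V R j₀) := by
  intro j
  by_cases h : j = j₀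
  · subst h
    rw [transplant_self]
    exact ⟨(locallyIntegrable_translate hV.1 R).locallyIntegrableOn _,
      (memLp_translate hV.2 R).restrict _⟩
  · rw [transplant_of_ne V R h]
    simp only [neg_zero, max_self]
    exact ⟨(locallyIntegrable_const 0).locallyIntegrableOn _, MemLp.zero'⟩

/-- Translation preserves the integral and truncation to the half-line can only decrease it; the
other edges contribute zero. -/
theorem sum_lintegral_transplant_le {p : ℝ} (hp : 0 < p) (V : ℝ → ℝ) (R : ℝ) (j₀ : Fin N) :
    ∑ j, ∫⁻ x in Set.Ioi (0 : ℝ), ENNReal.ofReal (max (-transplant V R j₀ j x) 0 ^ p)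
      ≤ ∫⁻ x, ENNReal.ofReal (max (-V x) 0 ^ p) := by
  rw [Finset.sum_eq_single j₀]
  · rw [transplant_self, ← lintegral_sub_right_eq_self
      (fun x => ENNReal.ofReal (max (-V x) 0 ^ p)) R]
    exact setLIntegral_le_lintegral _ _
  · intro j _ h
    rw [transplant_of_ne V R h]
    simp [Real.zero_rpow hp.ne']
  · simp

theorem single_mem_starDomain {V : Fin N → ℝ → ℝ}
    (hV : ∀ j, IsEdgePotential (volume.restrict (Set.Ioi 0)) (V j)) {j₀ : Fin N}
    {u : Lp ℂ 2 (volume.restrict (Set.Ioi (0 : ℝ)))}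
    (hu : u ∈ edgeDomain (Set.Ioi 0) (volume.restrict (Set.Ioi 0)) (V j₀))
    (hb : HasBoundaryValue u 0) : (PiLp.single 2 j₀ u : StarL2 N) ∈ starDomain V := by
  refine mem_starDomain.2 ⟨fun j => ?_, 0, fun j => ?_⟩
  · by_cases h : j = j₀
    · subst h
      simpa using hu
    · simpa [h] using (isHermitianForm_edge isOpen_Ioi isUpperSet_Ioi_zero rfl (hV j)).zero_mem
  · by_cases h : j = j₀
    · subst h
      simpa using hb
    · have h0 : (PiLp.single 2 j₀ u : StarL2 N) j = 0 := by simp [h]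
      rw [h0]
      exact hasBoundaryValue_zero

theorem starForm_single {V : Fin N → ℝ → ℝ}
    (hV : ∀ j, IsEdgePotential (volume.restrict (Set.Ioi 0)) (V j)) (j₀ : Fin N)
    (u v : Lp ℂ 2 (volume.restrict (Set.Ioi (0 : ℝ)))) :
    starForm V (PiLp.single 2 j₀ u) (PiLp.single 2 j₀ v)
      = edgeForm (Set.Ioi 0) (volume.restrict (Set.Ioi 0)) (V j₀) u v := by
  rw [starForm_eq, graphForm, Finset.sum_eq_single j₀]
  · simp
  · intro j _ h
    have hf := isHermitianForm_edge isOpen_Ioi isUpperSet_Ioi_zero rfl (hV j)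
    simpa [h] using hf.zero_left hf.zero_mem
  · simp

theorem inner_single (j₀ : Fin N) (u v : Lp ℂ 2 (volume.restrict (Set.Ioi (0 : ℝ)))) :
    inner ℂ (PiLp.single 2 j₀ u : StarL2 N) (PiLp.single 2 j₀ v) = inner ℂ u v := by
  rw [PiLp.inner_apply, Finset.sum_eq_single j₀]
  · simp
  · intro j _ h
    simp [h]
  · simp

theorem norm_sum_smul_sq {E : Type*} [NormedAddCommGroup E] [InnerProductSpace ℂ E] {n : ℕ}
    (w : Fin n → E) (c : Fin n → ℂ) :
    ‖∑ i, c i • w i‖ ^ 2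
      = (∑ i, ∑ j, starRingEnd ℂ (c i) * c j * inner ℂ (w i) (w j)).re := by
  rw [← inner_self_eq_norm_sq (𝕜 := ℂ), sum_inner]
  simp only [inner_sum, inner_smul_left, inner_smul_right, mul_assoc, mul_left_comm,
    RCLike.re_to_complex]

/-- Eigenfunctions on the line, shifted far into one edge and cut off near the vertex, are trial
functions on the star graph. -/
theorem sum_ofReal_add_le {γ : ℝ} (hγ : 1 / 2 ≤ γ) (j₀ : Fin N) {L : ENNReal}
    (hL : StarLiebThirring γ N L) {V : ℝ → ℝ} (hV : LinePotential (γ + 1 / 2) V) {n : ℕ}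
    {u : Fin n → LineL2} {t : Fin n → ℝ} (hu : Orthonormal ℂ u) (hmono : Monotone t)
    (ht : ∀ i, OperatorRel (lineDomain V) (lineForm V) (u i) ((t i : ℂ) • u i)) {ε : ℝ}
    (hε : 0 < ε) (hlt : ∀ k, t k + ε < 0) :
    ∑ i, ENNReal.ofReal (|t i + ε| ^ γ)
      ≤ L * ∫⁻ x, ENNReal.ofReal (max (-V x) 0 ^ (γ + 1 / 2)) := by
  have hVe := hV.isEdgePotential (by linarith)
  have huD : ∀ i, u i ∈ edgeDomain Set.univ volume V := fun i => (ht i).1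
  -- R may depend on the chosen eigenfunctions and on ε. The resulting bound does not, so a single
  -- good R suffices.
  obtain ⟨R, hR⟩ := (eventually_rayleigh_le hmono
    (G := fun R i j => inner ℂ (cutoffLp R (u i)) (cutoffLp R (u j)))
    (H := fun R i j => edgeForm (Set.Ioi 0) (volume.restrict (Set.Ioi 0)) (fun x => V (x - R))
      (cutoffLp R (u i)) (cutoffLp R (u j)))
    (fun i j => by
      rw [← orthonormal_iff_ite.1 hu i j]
      exact tendsto_inner_cutoffLp _ _)
    (fun i j => by
      rw [← form_eigensystem hu ht i j]
      exact tendsto_edgeForm_cutoffLp hVe (huD i) (huD j)) hε hlt).exists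
  have hVR := hV.starPotential_transplant (R : ℝ) j₀
  have hVRe := fun j => hVR.isEdgePotential (by linarith) j
  have hw : ∀ i, (PiLp.single 2 j₀ (cutoffLp R (u i)) : StarL2 N)
      ∈ starDomain (transplant V R j₀) := fun i =>
    single_mem_starDomain hVRe (by
      rw [transplant_self]
      exact cutoffLp_mem_edgeDomain R (huD i)) (cutoffLp_hasBoundaryValue R (huD i).1)
  have hf := isHermitianForm_star hVRe
  refine (sum_le_negTrace_of_trial hf (hasMinimizers_star hVRe) (by linarith) hw hlt
    fun k c hc hck => ?_).trans ((hL _ hVR).trans ?_)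
  · obtain ⟨h1, h2⟩ := hR k c hc hck
    have hnorm := norm_sum_smul_sq (fun i => (PiLp.single 2 j₀ (cutoffLp R (u i)) : StarL2 N)) c
    simp only [inner_single] at hnorm
    rw [hf.apply_sum_smul hw, hnorm]
    simp only [starForm_single hVRe, transplant_self]
    refine ⟨fun h0 => ?_, h2⟩
    rw [h0, norm_zero] at hnorm
    rw [← hnorm] at h1
    norm_num at h1
  · gcongr
    exact sum_lintegral_transplant_le (by linarith) V R j₀

/-- Transplantation loses an arbitrarily small ε in each eigenvalue. For a finite system the sum is
continuous in ε, so the loss disappears as ε tends to 0 from above. -/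
theorem lineLiebThirring_of_star {γ : ℝ} (hγ : 1 / 2 ≤ γ) (hN : 1 ≤ N) {L : ENNReal}
    (hL : StarLiebThirring γ N L) : LineLiebThirring γ L := by
  intro V hV
  have hVe := hV.isEdgePotential (by linarith)
  refine negTrace_le (isHermitianForm_edge isOpen_univ isUpperSet_univ volume_eq_restrict_univ hVe)
    fun n u t hu hmono ht0 ht => ?_
  have hlim : Tendsto (fun ε : ℝ => ∑ i, ENNReal.ofReal (|t i + ε| ^ γ)) (𝓝[>] 0)
      (𝓝 (∑ i, ENNReal.ofReal (|t i| ^ γ))) := by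
    have hc : Continuous fun ε : ℝ => ∑ i, ENNReal.ofReal (|t i + ε| ^ γ) :=
      continuous_finsetSum _ fun i _ => ENNReal.continuous_ofReal.comp
        ((continuous_const.add continuous_id).abs.rpow_const fun _ => Or.inr (by linarith))
    have := hc.tendsto 0
    simp only [add_zero] at this
    exact this.mono_left nhdsWithin_le_nhds
  refine le_of_tendsto hlim ?_
  have hlt : ∀ᶠ ε in 𝓝[>] (0 : ℝ), ∀ k, t k + ε < 0 := by
    refine eventually_all.2 fun k => ?_
    have : ∀ᶠ ε in 𝓝 (0 : ℝ), ε < -t k := eventually_lt_nhds (by linarith [ht0 k])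
    filter_upwards [nhdsWithin_le_nhds this] with ε hε
    linarith
  filter_upwards [hlt, self_mem_nhdsWithin] with ε h1 h2
  exact sum_ofReal_add_le hγ ⟨0, hN⟩ hL hV hu hmono ht h2 h1

end LowerBound

/-! ### Comparison of the optimal constants -/

theorem starConst_eq_of_even {γ : ℝ} (hγ : 1 / 2 ≤ γ) {N : ℕ} (hN : 1 ≤ N) (he : Even N) :
    starConst γ N = lineConst γ :=
  le_antisymm (le_sInf fun _ hL => sInf_le (starLiebThirring_of_even hγ he hL))
    (le_sInf fun _ hL => sInf_le (lineLiebThirring_of_star hγ hN hL))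

theorem starConst_le_of_odd {γ : ℝ} (hγ : 1 / 2 ≤ γ) {N : ℕ} (ho : Odd N) :
    starConst γ N ≤ ((N : ENNReal) + 1) / (N : ENNReal) * lineConst γ := by
  have hN0 : (N : ENNReal) ≠ 0 := by exact_mod_cast ho.pos.ne'
  have hNt : (N : ENNReal) ≠ ⊤ := ENNReal.natCast_ne_top N
  have hc0 : ((N : ENNReal) + 1) / (N : ENNReal) ≠ 0 :=
    (ENNReal.div_pos (by simp) hNt).ne'
  have hct : ((N : ENNReal) + 1) / (N : ENNReal) ≠ ⊤ :=
    ENNReal.div_ne_top (ENNReal.add_ne_top.2 ⟨hNt, ENNReal.one_ne_top⟩) hN0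
  -- The factor is neither 0 nor ⊤, so it can be moved to the other side; the bound is then checked
  -- against each constant in the infimum.
  rw [mul_comm, ← ENNReal.div_le_iff_le_mul (Or.inl hc0) (Or.inl hct)]
  refine le_sInf fun L hL => ?_
  rw [ENNReal.div_le_iff_le_mul (Or.inl hc0) (Or.inl hct), mul_comm]
  exact sInf_le (starLiebThirring_of_odd hγ ho hL)

end StarLT

end

theorem theorem1 (γ : ℝ) (hγ : 1 / 2 ≤ γ) (N : ℕ) (hN : 1 ≤ N) :
    (Even N → StarLT.starConst γ N = StarLT.lineConst γ) ∧
    (Odd N → StarLT.starConst γ N ≤ ((N : ENNReal) + 1) / (N : ENNReal) * StarLT.lineConst γ) := by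
  exact ⟨fun he => StarLT.starConst_eq_of_even hγ hN he, fun ho => StarLT.starConst_le_of_odd hγ ho⟩
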